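/- Complex-demand knapsack problem (C-KP) with selfish agents. There are $n$ agents; agent $k$ has a private type $t_k=(d_k,v_k)$ with demand $d_k\in\mathbb C_+=\{z\in\mathbb C:\operatorname{Re}z\ge 0,\ \operatorname{Im}z\ge 0\}$ and value $v_k$, a positive integer; a capacity $C>0$ is given. A set $S$ of agents is feasible if $\left|\sum_{k\in S}d_k\right|\le C$, and $v(S)=\sum_{k\in S}v_k$. For $z,w\in\mathbb C_+$ write $z\le w$ if $\operatorname{Re}z\le\operatorname{Re}w$ and $\operatorname{Im}z\le\operatorname{Im}w$. A mechanism maps the reported types $t=(t_1,\dots,t_n)$ (and $n$, $C$) to assignments $o_k(t)\in\mathbb C_+$ with $\left|\sum_k o_k(t)\right|\le C$ and payments $p_k(t)\in\mathbb R$. Agent $k$ is selected if his reported demand satisfies $d_k\le o_k(t)$; $S(t)$ is the set of selected agents. An agent of true type $(d,v)$ has utility $v-p_k(t)$ if $d\le o_k(t)$, and $-p_k(t)$ otherwise. The mechanism is incentive compatible if for each agent, whatever the reports of the others, reporting the true type maximizes his utility, and individually rational if truthful agents never have negative utility. It is a $\rho$-approximation if $v(S(t))\ge\rho\, v(S^*)$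 for every input and every feasible $S^*$. Theorem. There are a single algorithm and a polynomial $P$ such that for every real $\varepsilon>0$ there is an incentive compatible and individually rational $(\frac12-\varepsilon)$-approximation mechanism for C-KP, defined and having these properties for all real capacities $C>0$ and all types with (real) demands in $\mathbb C_+$ and positive integer values, which the algorithm, given $\lceil 1/\varepsilon\rceil$, computes: on each input whose capacity and demands are rational, it outputs the assignments and payments in time at most $P(s+1/\varepsilon)$, where $s$ is the size of the input (all numbers in binary, rationals as reduced fractions) and time is the logarithmic cost on a random access machine. Moreover, the mechanism is exact ($o_k(t)\in\{d_k,0\}$ for all $t$ and $k$) and monotone (a selected agent remains selected if he reports $(d_k',v_k')$ with $d_k'\le d_k$ and $v_k'\ge v_k$, the reports of the others being fixed), and its payments are critical values: an agent who is not selected pays $0$, and one who is selected pays a number $\theta$ such that, with the same demand and the same reports of the others, he is selected if he reports a value above $\theta$ and not selected if he reports a value below $\theta$. -/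

import Mathlib

namespace CKP

/-! ### Single-minded agents and mechanisms for the complex-demand knapsack problem -/

/-- The closed first quadrant of the complex plane: the set of demands and of assignments. -/
abbrev Quadrant : Type := {z : ℂ // 0 ≤ z.re ∧ 0 ≤ z.im}

/-- The assignment `o` meets the demand `d` (componentwise order on complex numbers). -/
def Meets (d o : Quadrant) : Prop := d.1.re ≤ o.1.re ∧ d.1.im ≤ o.1.im

/-- The type of an agent: a demand in the first quadrant and a positive integer value. -/
structure AgentType where
  demand : Quadrant
  value : ℕ
  value_pos : 0 < value

/-- A mechanism for C-KP: for each number `n` of agents, each capacity `C` (only `0 < C` matters)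
and each list `t` of reported types, an assignment and a payment for every agent. -/
structure Mechanism where
  alloc : (n : ℕ) → (C : ℝ) → (Fin n → AgentType) → Fin n → Quadrant
  pay : (n : ℕ) → (C : ℝ) → (Fin n → AgentType) → Fin n → ℝ

open Classical in
/-- The value that an agent of type `τ` derives from the assignment `o`. -/
noncomputable def valuation (τ : AgentType) (o : Quadrant) : ℝ :=
  if Meets τ.demand o then (τ.value : ℝ) else 0

/-- `v(S)`, the total value of a set of items. -/
def totalValue {n : ℕ} (t : Fin n → AgentType) (S : Finset (Fin n)) : ℕ :=
  ∑ k ∈ S, (t k).value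

/-- `S` is a feasible solution of C-KP with capacity `C`. -/
def FeasibleSet {n : ℕ} (C : ℝ) (t : Fin n → AgentType) (S : Finset (Fin n)) : Prop :=
  ‖∑ k ∈ S, (t k).demand.1‖ ≤ C

namespace Mechanism

/-- Agent `k` is selected: he receives an assignment that meets his reported demand. -/
def Selected (M : Mechanism) (n : ℕ) (C : ℝ) (t : Fin n → AgentType) (k : Fin n) : Prop :=
  Meets (t k).demand (M.alloc n C t k)

open Classical in
/-- The set of selected agents. -/
noncomputable def selectedSet (M : Mechanism) (n : ℕ) (C : ℝ) (t : Fin n → AgentType) :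
    Finset (Fin n) :=
  Finset.univ.filter (fun k => M.Selected n C t k)

/-- The utility of agent `k` whose true type is `τ` when the reported types are `t`. -/
noncomputable def utility (M : Mechanism) (n : ℕ) (C : ℝ) (τ : AgentType)
    (t : Fin n → AgentType) (k : Fin n) : ℝ :=
  valuation τ (M.alloc n C t k) - M.pay n C t k

/-- Reporting the true type `t k` maximizes the utility of agent `k`, whatever the others report. -/
def IncentiveCompatible (M : Mechanism) : Prop :=
  ∀ (n : ℕ) (C : ℝ), 0 < C → ∀ (t : Fin n → AgentType) (k : Fin n) (τ' : AgentType),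
    M.utility n C (t k) (Function.update t k τ') k ≤ M.utility n C (t k) t k

/-- A truthful agent has nonnegative utility. -/
def IndividuallyRational (M : Mechanism) : Prop :=
  ∀ (n : ℕ) (C : ℝ), 0 < C → ∀ (t : Fin n → AgentType) (k : Fin n),
    0 ≤ M.utility n C (t k) t k

/-- The magnitude of the total assigned demand never exceeds the capacity. -/
def Feasible (M : Mechanism) : Prop :=
  ∀ (n : ℕ) (C : ℝ), 0 < C → ∀ t : Fin n → AgentType,
    ‖∑ k, (M.alloc n C t k).1‖ ≤ C

/-- Every agent is assigned exactly his reported demand or nothing. -/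
def Exact (M : Mechanism) : Prop :=
  ∀ (n : ℕ) (C : ℝ), 0 < C → ∀ (t : Fin n → AgentType) (k : Fin n),
    (M.alloc n C t k).1 = (t k).demand.1 ∨ (M.alloc n C t k).1 = 0

/-- A selected agent remains selected with a smaller demand and a larger value. -/
def Monotone (M : Mechanism) : Prop :=
  ∀ (n : ℕ) (C : ℝ), 0 < C → ∀ (t : Fin n → AgentType) (k : Fin n) (τ' : AgentType),
    (t k).value ≤ τ'.value → Meets τ'.demand (t k).demand →
    M.Selected n C t k → M.Selected n C (Function.update t k τ') k

/-- A selected agent pays a critical value for his demand and the reports of the others: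
with the same demand he is selected when he reports a value above it, and not selected when he
reports a value below it. An agent who is not selected pays nothing. -/
def PaysCriticalValues (M : Mechanism) : Prop :=
  ∀ (n : ℕ) (C : ℝ), 0 < C → ∀ (t : Fin n → AgentType) (k : Fin n),
    (M.Selected n C t k → ∀ τ' : AgentType, τ'.demand = (t k).demand →
      (M.pay n C t k < τ'.value → M.Selected n C (Function.update t k τ') k) ∧
      ((τ'.value : ℝ) < M.pay n C t k → ¬ M.Selected n C (Function.update t k τ') k)) ∧
    (¬ M.Selected n C t k → M.pay n C t k = 0)

/-- The selected agents have total value at least `ρ` times that of any feasible solution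
(equivalently, for `0 ≤ ρ`, of an optimal one). -/
def IsApproximation (M : Mechanism) (ρ : ℝ) : Prop :=
  ∀ (n : ℕ) (C : ℝ), 0 < C → ∀ (t : Fin n → AgentType) (S : Finset (Fin n)),
    FeasibleSet C t S → ρ * (totalValue t S : ℝ) ≤ (totalValue t (M.selectedSet n C t) : ℝ)

end Mechanism

/-! ### Random access machines with logarithmic cost

Programs are structured; the memory is a sequence of natural numbers. Each elementary operation
costs one plus the bit lengths of the numbers (addresses included) that it handles. -/

/-- Expressions. Subtraction is truncated, division is rounded down. -/
inductive RamExpr where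
  | lit (a : ℕ)
  | load (addr : RamExpr)
  | add (e f : RamExpr)
  | sub (e f : RamExpr)
  | mul (e f : RamExpr)
  | div (e f : RamExpr)

namespace RamExpr

/-- The value of an expression when the memory is `σ`. -/
def eval (σ : ℕ → ℕ) : RamExpr → ℕ
  | lit a => a
  | load e => σ (e.eval σ)
  | add e f => e.eval σ + f.eval σ
  | sub e f => e.eval σ - f.eval σ
  | mul e f => e.eval σ * f.eval σ
  | div e f => e.eval σ / f.eval σ

/-- The cost of evaluating an expression when the memory is `σ`. -/
def cost (σ : ℕ → ℕ) : RamExpr → ℕ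
  | lit a => 1 + a.size
  | load e => e.cost σ + (1 + (e.eval σ).size + (σ (e.eval σ)).size)
  | add e f => e.cost σ + f.cost σ + (1 + (e.eval σ).size + (f.eval σ).size)
  | sub e f => e.cost σ + f.cost σ + (1 + (e.eval σ).size + (f.eval σ).size)
  | mul e f => e.cost σ + f.cost σ + (1 + (e.eval σ).size + (f.eval σ).size)
  | div e f => e.cost σ + f.cost σ + (1 + (e.eval σ).size + (f.eval σ).size)

end RamExpr

/-- Programs: do nothing, write the value of `e` into the cell with address `addr`, sequential
composition, branching and looping (a condition holds when its value is nonzero). -/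
inductive RamProg where
  | skip
  | store (addr e : RamExpr)
  | seq (p q : RamProg)
  | ite (c : RamExpr) (p q : RamProg)
  | loop (c : RamExpr) (p : RamProg)

/-- `Exec p σ σ' T`: started with memory `σ`, the program `p` halts with memory `σ'`, at total
cost `T`. -/
inductive Exec : RamProg → (ℕ → ℕ) → (ℕ → ℕ) → ℕ → Prop where
  | skip (σ : ℕ → ℕ) : Exec RamProg.skip σ σ 1
  | store (addr e : RamExpr) (σ : ℕ → ℕ) :
      Exec (RamProg.store addr e) σ (Function.update σ (addr.eval σ) (e.eval σ))
        (addr.cost σ + e.cost σ + (1 + (addr.eval σ).size + (e.eval σ).size))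
  | seq {p q : RamProg} {σ σ₁ σ₂ : ℕ → ℕ} {T₁ T₂ : ℕ} :
      Exec p σ σ₁ T₁ → Exec q σ₁ σ₂ T₂ → Exec (RamProg.seq p q) σ σ₂ (T₁ + T₂)
  | iteTrue {c : RamExpr} {p q : RamProg} {σ σ₁ : ℕ → ℕ} {T : ℕ} :
      c.eval σ ≠ 0 → Exec p σ σ₁ T → Exec (RamProg.ite c p q) σ σ₁ (c.cost σ + 1 + T)
  | iteFalse {c : RamExpr} {p q : RamProg} {σ σ₁ : ℕ → ℕ} {T : ℕ} :
      c.eval σ = 0 → Exec q σ σ₁ T → Exec (RamProg.ite c p q) σ σ₁ (c.cost σ + 1 + T)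
  | loopDone {c : RamExpr} {p : RamProg} {σ : ℕ → ℕ} :
      c.eval σ = 0 → Exec (RamProg.loop c p) σ σ (c.cost σ + 1)
  | loopStep {c : RamExpr} {p : RamProg} {σ σ₁ σ₂ : ℕ → ℕ} {T₁ T₂ : ℕ} :
      c.eval σ ≠ 0 → Exec p σ σ₁ T₁ → Exec (RamProg.loop c p) σ₁ σ₂ T₂ →
      Exec (RamProg.loop c p) σ σ₂ (c.cost σ + 1 + T₁ + T₂)

/-- The initial memory holding the list `l` in cells `0, 1, …` and zeros elsewhere. -/
def initMemory (l : List ℕ) : ℕ → ℕ := fun i => l.getD i 0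

/-! ### Rational inputs, their encoding and their size -/

/-- An agent's type with rational demand. -/
structure RatType where
  re : ℚ≥0
  im : ℚ≥0
  value : ℕ
  value_pos : 0 < value

/-- The type with the same (now real) demand and the same value. -/
noncomputable def RatType.toAgentType (q : RatType) : AgentType where
  demand := ⟨⟨(q.re : ℝ), (q.im : ℝ)⟩, q.re.cast_nonneg, q.im.cast_nonneg⟩
  value := q.value
  value_pos := q.value_pos

/-- Numerators and denominators of the real and imaginary part of the demand, then the value. -/
def RatType.encode (q : RatType) : List ℕ :=
  [q.re.num, q.re.den, q.im.num, q.im.den, q.value]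

/-- The encoding of an input: number of agents, numerator and denominator of the capacity, and
the types of all agents in order. -/
def encodeInput {n : ℕ} (C : ℚ≥0) (t : Fin n → RatType) : List ℕ :=
  [n, C.num, C.den] ++ (List.ofFn t).flatMap RatType.encode

/-- The size of a list of natural numbers: total binary length, plus one for each entry. -/
def bitSize (l : List ℕ) : ℕ := (l.map (fun a => a.size + 1)).sum

/-- The final memory `σ` describes the outcome of `M` on `(n, C, t)`: for each agent `k`, cell
`2k` tells whether he is assigned his demand (1) or nothing, and cell `2k + 1` holds his payment. -/
def IsOutput (M : Mechanism) (n : ℕ) (C : ℝ) (t : Fin n → AgentType) (σ : ℕ → ℕ) : Prop :=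
  ∀ k : Fin n,
    (M.alloc n C t k).1 = (if σ (2 * (k : ℕ)) = 1 then (t k).demand.1 else 0) ∧
    M.pay n C t k = (σ (2 * (k : ℕ) + 1) : ℝ)

/-- On every rational input (capacity `C`, types `t`), the program `prog`, given the number `m` and
the input, computes the outcome and the payments of `M` at a cost of at most `B (input size)`. -/
def Computes (prog : RamProg) (m : ℕ) (M : Mechanism) (B : ℕ → ℝ) : Prop :=
  ∀ (n : ℕ) (C : ℚ≥0), 0 < C → ∀ t : Fin n → RatType,
    ∃ (σ : ℕ → ℕ) (T : ℕ),
      Exec prog (initMemory (m :: encodeInput C t)) σ T ∧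
      IsOutput M n (C : ℝ) (fun k => (t k).toAgentType) σ ∧
      (T : ℝ) ≤ B (bitSize (encodeInput C t))

end CKP

namespace CKP

/-! ### A small array language compiled to the random access machine -/

/-! The mechanism reduces C-KP to an ordinary knapsack problem and solves that one by a monotone
approximation scheme. A demand `d` gets the weight `min (re + im) C` if its norm is at most `C`, and
`2 * C` otherwise. If a set has total weight at most `C`, either no weight is truncated and the
triangle inequality bounds the sum, or one demand uses up the whole capacity and all others are zero
(`norm_sum_le_of_weight`). Conversely, the parts of a feasible set add up to at most `√2 * C ≤ 3 / 2
* C`, and such a set splits into two sets of weight at most `C` (`exists_split_weight`). So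
restricting to sets of weight at most `C` costs a factor of two. The weight is monotone in the
demand.

The usual rounding for knapsack depends on the largest value and is not monotone. Here all scales `2
^ j` compete: at scale `j` a value is divided by `2 ^ j`, rounded down and truncated at `L = 2 * n *
m`, and the pair of a scale and a set with the best score is chosen, ties being broken by the scale
and then by the binary code of the set. At a fixed scale the score of a set without `k` does not
depend on the value of `k`, and that of a set with `k` does not decrease when the value grows. Hence
a chosen agent stays chosen when he raises his value or lowers his demand (`chosen_mono`). Scores
never exceed true values, and at one scale the score loses at most a fraction `1 / m`
(`exists_score_ge`), which gives the ratio `1 / 2 - ε`.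

Monotonicity yields thresholds, and charging them makes truthfulness optimal: a lie that pays must
claim at least the true demand, and the threshold for the true demand is no larger. Zero demands are
met by any assignment, so their critical value is zero.

For the computation, a dynamic program tabulates at each scale the least weight for each of the at
most `L * n + 1` profits. The scales up to the bit length of the values suffice, since later scores
vanish. The table also yields the set of least binary code, so the program follows the tie-breaking
exactly, and bisection with the same routine finds the thresholds (`run_choose`, `run_payAll`).
Rational data are cleared by a common denominator.

Running time is handled once for a small array language. Its syntactic condition `wf` bounds the
number of rounds of each loop by a read-only scalar or a bit length, and lets each assignment add
only boundedly many bits relative to the input and the read-only arrays. By structural induction,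
bit lengths and costs are then polynomially bounded (`Cmd.size_run_le`, `Cmd.sim`). -/

/-- The arrays of the array language; a scalar is stored in entry `0` of its array. -/
inductive Arr where
  | num | lev | top | scales | den | cap | wt | val | cur | prf | tab | sel | out | pay
  | best | sc | ps | remP | remW | lo | hi | mid | re | im | p | q | r | t | u | y | z
  deriving DecidableEq

/-- The offset of an array in the interleaved memory layout. -/
def Arr.code : Arr → ℕ
  | num => 0 | lev => 1 | top => 2 | scales => 3 | den => 4 | cap => 5 | wt => 6 | val => 7
  | cur => 8 | prf => 9 | tab => 10 | sel => 11 | out => 12 | pay => 13 | best => 14 | sc => 15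
  | ps => 16 | remP => 17 | remW => 18 | lo => 19 | hi => 20 | mid => 21 | re => 22 | im => 23
  | p => 24 | q => 25 | r => 26 | t => 27 | u => 28 | y => 29 | z => 30

theorem Arr.code_lt (a : Arr) : a.code < 31 := by cases a <;> decide

theorem Arr.code_injective : Function.Injective Arr.code := by
  intro a b h
  cases a <;> cases b <;> first | rfl | cases h

/-- The contents of all arrays. -/
abbrev Store : Type := Arr → ℕ → ℕ

/-- Overwrite entry `i` of array `a`. -/
def put (s : Store) (a : Arr) (i v : ℕ) : Store :=
  fun b j => if b = a ∧ j = i then v else s b j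

theorem put_ne {s : Store} {a b : Arr} (h : b ≠ a) (i v : ℕ) : put s a i v b = s b := by
  funext j
  simp [put, h]

theorem put_same (s : Store) (a : Arr) (i v j : ℕ) :
    put s a i v a j = if j = i then v else s a j := by
  simp [put]

/-- Expressions over the input cells and the arrays. -/
inductive Ex where
  | lit (a : ℕ)
  | inp (i : Ex)
  | get (a : Arr) (i : Ex)
  | add (e f : Ex)
  | sub (e f : Ex)
  | mul (e f : Ex)
  | div (e f : Ex)

/-- Commands: `loopTo x N p` runs `p` for `x = 0, …, N - 1`, and `loopHalf x e p` runs `p` while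
`x`, starting from `e`, is halved down to `0`. -/
inductive Cmd where
  | skip
  | set (a : Arr) (i e : Ex)
  | seq (p q : Cmd)
  | ite (c : Ex) (p q : Cmd)
  | loopTo (x N : Arr) (p : Cmd)
  | loopHalf (x : Arr) (e : Ex) (p : Cmd)

namespace Ex

/-- The value of an expression with input `I` and store `s`. -/
def eval (I : ℕ → ℕ) (s : Store) : Ex → ℕ
  | lit a => a
  | inp i => I (i.eval I s)
  | get a i => s a (i.eval I s)
  | add e f => e.eval I s + f.eval I s
  | sub e f => e.eval I s - f.eval I s
  | mul e f => e.eval I s * f.eval I s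
  | div e f => e.eval I s / f.eval I s

/-- The expression is a literal, an input cell or an entry of one of the arrays `ro`. -/
def small (ro : List Arr) : Ex → Bool
  | lit _ => true
  | inp _ => true
  | get a _ => decide (a ∈ ro)
  | _ => false

/-- The bit length of the value exceeds that of the cells only by a constant multiple of the bit
length of the input and of the arrays `ro`. -/
def linear (ro : List Arr) : Ex → Bool
  | lit _ => true
  | inp _ => true
  | get _ _ => true
  | add e f => e.linear ro && f.linear ro
  | sub e _ => e.linear ro
  | mul e f => e.linear ro && f.small ro
  | div e _ => e.linear ro

/-- The constant in the bound on the bit length of a linear expression. -/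
def grow : Ex → ℕ
  | lit a => a.size
  | inp _ => 1
  | get _ _ => 1
  | add e f => e.grow + f.grow + 1
  | sub e _ => e.grow
  | mul e f => e.grow + f.grow
  | div e _ => e.grow

end Ex

namespace Cmd

/-- The store after running a command. -/
def run (I : ℕ → ℕ) : Cmd → Store → Store
  | skip => fun s => s
  | set a i e => fun s => put s a (i.eval I s) (e.eval I s)
  | seq p q => fun s => q.run I (p.run I s)
  | ite c p q => fun s => if c.eval I s ≠ 0 then p.run I s else q.run I s
  | loopTo x N p => fun s =>
      (fun s => put (p.run I s) x 0 (p.run I s x 0 + 1))^[s N 0] (put s x 0 0)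
  | loopHalf x e p => fun s =>
      (fun s => put (p.run I s) x 0 (p.run I s x 0 / 2))^[(e.eval I s).size]
        (put s x 0 (e.eval I s))

/-- Whether a command writes to an array. -/
def writes : Cmd → Arr → Bool
  | skip, _ => false
  | set a _ _, b => decide (b = a)
  | seq p q, b => p.writes b || q.writes b
  | ite _ p q, b => p.writes b || q.writes b
  | loopTo x _ p, b => decide (b = x) || p.writes b
  | loopHalf x _ p, b => decide (b = x) || p.writes b

/-- The syntactic conditions that guarantee a polynomial running time: the arrays `ro` are never
written, the loops are bounded by the scalars `ls` or by the bit length of small expressions, and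
all stored values come from linear expressions. -/
def wf (ro ls : List Arr) : Cmd → Bool
  | skip => true
  | set a _ e => !decide (a ∈ ro) && e.linear ro
  | seq p q => p.wf ro ls && q.wf ro ls
  | ite _ p q => p.wf ro ls && q.wf ro ls
  | loopTo x N p =>
      decide (N ∈ ls) && decide (N ∈ ro) && !decide (x ∈ ro) && !p.writes x && p.wf ro ls
  | loopHalf x e p => e.small ro && !decide (x ∈ ro) && !p.writes x && p.wf ro ls

theorem run_frame (I : ℕ → ℕ) {p : Cmd} {a : Arr} (h : p.writes a = false) (s : Store) :
    p.run I s a = s a := by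
  induction p generalizing s with
  | skip => rfl
  | set b i e =>
    have : a ≠ b := by simpa [writes] using h
    exact put_ne this _ _
  | seq p q ihp ihq =>
    simp only [writes, Bool.or_eq_false_iff] at h
    simp only [run]
    rw [ihq h.2, ihp h.1]
  | ite c p q ihp ihq =>
    simp only [writes, Bool.or_eq_false_iff] at h
    simp only [run]
    split
    · exact ihp h.1 s
    · exact ihq h.2 s
  | loopTo x N p ih =>
    simp only [writes, Bool.or_eq_false_iff, decide_eq_false_iff_not] at h
    simp only [run]
    generalize s N 0 = k
    suffices ∀ s' : Store, s' a = s a →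
        ((fun s => put (p.run I s) x 0 (p.run I s x 0 + 1))^[k] s') a = s a from
      this _ (put_ne h.1 _ _)
    induction k with
    | zero => exact fun s' h' => h'
    | succ k ihk =>
      intro s' h'
      rw [Function.iterate_succ_apply]
      exact ihk _ (by rw [put_ne h.1, ih h.2, h'])
  | loopHalf x e p ih =>
    simp only [writes, Bool.or_eq_false_iff, decide_eq_false_iff_not] at h
    simp only [run]
    generalize (e.eval I s).size = k
    suffices ∀ s' : Store, s' a = s a →
        ((fun s => put (p.run I s) x 0 (p.run I s x 0 / 2))^[k] s') a = s a from
      this _ (put_ne h.1 _ _)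
    induction k with
    | zero => exact fun s' h' => h'
    | succ k ihk =>
      intro s' h'
      rw [Function.iterate_succ_apply]
      exact ihk _ (by rw [put_ne h.1, ih h.2, h'])

theorem writes_of_wf {ro ls : List Arr} {p : Cmd} (h : p.wf ro ls = true) {a : Arr}
    (ha : a ∈ ro) : p.writes a = false := by
  induction p with
  | skip => rfl
  | set b i e =>
    simp only [wf, Bool.and_eq_true, Bool.not_eq_true', decide_eq_false_iff_not] at h
    simp only [writes, decide_eq_false_iff_not]
    rintro rfl
    exact h.1 ha
  | seq p q ihp ihq =>
    simp only [wf, Bool.and_eq_true] at h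
    simp [writes, ihp h.1, ihq h.2]
  | ite c p q ihp ihq =>
    simp only [wf, Bool.and_eq_true] at h
    simp [writes, ihp h.1, ihq h.2]
  | loopTo x N p ih =>
    simp only [wf, Bool.and_eq_true, Bool.not_eq_true', decide_eq_false_iff_not] at h
    have : a ≠ x := by rintro rfl; exact h.1.1.2 ha
    simp [writes, ih h.2, this]
  | loopHalf x e p ih =>
    simp only [wf, Bool.and_eq_true, Bool.not_eq_true', decide_eq_false_iff_not] at h
    have : a ≠ x := by rintro rfl; exact h.1.1.2 ha
    simp [writes, ih h.2, this]

end Cmd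

/-! ### Bit lengths -/

theorem size_add_le (a b : ℕ) : (a + b).size ≤ max a.size b.size + 1 := by
  rw [Nat.size_le, pow_succ]
  have ha := (Nat.lt_size_self a).trans_le (Nat.pow_le_pow_right two_pos (le_max_left _ b.size))
  have hb := (Nat.lt_size_self b).trans_le (Nat.pow_le_pow_right two_pos (le_max_right a.size _))
  omega

theorem size_mul_le (a b : ℕ) : (a * b).size ≤ a.size + b.size := by
  rw [Nat.size_le, pow_add]
  exact Nat.mul_lt_mul'' (Nat.lt_size_self a) (Nat.lt_size_self b)

/-- Halving drops exactly one bit, also at `0` thanks to truncated subtraction; hence a `loopHalf`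
has as many rounds as its initial value has bits. -/
theorem size_half (v : ℕ) : (v / 2).size = v.size - 1 := by
  apply eq_of_forall_lt_iff
  intro c
  rw [Nat.lt_sub_iff_add_lt, Nat.lt_size, Nat.lt_size, Nat.le_div_iff_mul_le two_pos, pow_succ]

namespace RamExpr

/-- A bound on the bit length of the value, in multiples of the bit length of the cells. -/
def width : RamExpr → ℕ
  | lit a => a.size
  | load _ => 1
  | add e f => e.width + f.width + 1
  | sub e f => e.width + f.width + 1
  | mul e f => e.width + f.width + 1
  | div e f => e.width + f.width + 1

/-- A bound on the cost, in multiples of the bit length of the cells. -/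
def price : RamExpr → ℕ
  | lit a => 1 + a.size
  | load e => e.price + (1 + e.width + 1)
  | add e f => e.price + f.price + (1 + e.width + f.width)
  | sub e f => e.price + f.price + (1 + e.width + f.width)
  | mul e f => e.price + f.price + (1 + e.width + f.width)
  | div e f => e.price + f.price + (1 + e.width + f.width)

/-- This multiplicative bound suffices for the cost of a single instruction, whose expression is
fixed. Under iteration it would be exponential; there the additive bound `Ex.size_linear` takes
over. -/
theorem size_eval_le {σ : ℕ → ℕ} {B : ℕ} (hB : 1 ≤ B) (hσ : ∀ i, (σ i).size ≤ B) (e : RamExpr) :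
    (e.eval σ).size ≤ e.width * B := by
  induction e with
  | lit a => exact Nat.le_mul_of_pos_right _ hB
  | load e => simpa [eval, width] using hσ _
  | add e f he hf =>
    have := size_add_le (e.eval σ) (f.eval σ)
    simp only [eval, width, add_mul]
    omega
  | sub e f he hf =>
    have := Nat.size_le_size (Nat.sub_le (e.eval σ) (f.eval σ))
    simp only [eval, width, add_mul]
    omega
  | mul e f he hf =>
    have := size_mul_le (e.eval σ) (f.eval σ)
    simp only [eval, width, add_mul]
    omega
  | div e f he hf =>
    have := Nat.size_le_size (Nat.div_le_self (e.eval σ) (f.eval σ))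
    simp only [eval, width, add_mul]
    omega

theorem cost_le {σ : ℕ → ℕ} {B : ℕ} (hB : 1 ≤ B) (hσ : ∀ i, (σ i).size ≤ B) (e : RamExpr) :
    e.cost σ ≤ e.price * B := by
  induction e with
  | lit a => exact Nat.le_mul_of_pos_right _ hB
  | load e he =>
    have h1 := size_eval_le hB hσ e
    have h2 := hσ (e.eval σ)
    simp only [cost, price, add_mul]
    omega
  | add e f he hf | sub e f he hf | mul e f he hf | div e f he hf =>
    have h1 := size_eval_le hB hσ e
    have h2 := size_eval_le hB hσ f
    simp only [cost, price, add_mul]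
    omega

end RamExpr

/-! ### Compilation -/

/-- The first memory cell after the input. -/
def baseExpr : RamExpr := .add (.mul (.lit 5) (.load (.lit 1))) (.lit 4)

/-- The address of an entry of an array. -/
def addrExpr (a : Arr) (i : RamExpr) : RamExpr :=
  .add baseExpr (.add (.mul (.lit 31) i) (.lit a.code))

/-- Compilation of expressions; cells beyond the input are read as `0`. -/
def Ex.comp : Ex → RamExpr
  | lit a => .lit a
  | inp i => .mul (.load i.comp) (.sub (.lit 1) (.sub (.add i.comp (.lit 1)) baseExpr))
  | get a i => .load (addrExpr a i.comp)
  | add e f => .add e.comp f.comp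
  | sub e f => .sub e.comp f.comp
  | mul e f => .mul e.comp f.comp
  | div e f => .div e.comp f.comp

/-- The compilation of an assignment. -/
def compSet (a : Arr) (i e : Ex) : RamProg := .store (addrExpr a i.comp) e.comp

/-- The guard of a counting loop. -/
def guardTo (x N : Arr) : Ex := .sub (.get N (.lit 0)) (.get x (.lit 0))

/-- Compilation of commands. -/
def Cmd.comp : Cmd → RamProg
  | skip => .skip
  | set a i e => compSet a i e
  | seq p q => .seq p.comp q.comp
  | ite c p q => .ite c.comp p.comp q.comp
  | loopTo x N p => .seq (compSet x (.lit 0) (.lit 0))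
      (.loop (guardTo x N).comp
        (.seq p.comp (compSet x (.lit 0) (.add (.get x (.lit 0)) (.lit 1)))))
  | loopHalf x e p => .seq (compSet x (.lit 0) e)
      (.loop (Ex.get x (.lit 0)).comp
        (.seq p.comp (compSet x (.lit 0) (.div (.get x (.lit 0)) (.lit 2)))))

/-- The memory `σ` represents the input `I` and the store `s`. -/
structure Rep (I : ℕ → ℕ) (σ : ℕ → ℕ) (s : Store) : Prop where
  input : ∀ i < 5 * I 1 + 4, σ i = I i
  arrays : ∀ a i, σ (5 * I 1 + 4 + (31 * i + a.code)) = s a i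

theorem Arr.exists_code {c : ℕ} (h : c < 31) : ∃ a : Arr, a.code = c := by
  interval_cases c
  exacts [⟨.num, rfl⟩, ⟨.lev, rfl⟩, ⟨.top, rfl⟩, ⟨.scales, rfl⟩, ⟨.den, rfl⟩, ⟨.cap, rfl⟩,
    ⟨.wt, rfl⟩, ⟨.val, rfl⟩, ⟨.cur, rfl⟩, ⟨.prf, rfl⟩, ⟨.tab, rfl⟩, ⟨.sel, rfl⟩, ⟨.out, rfl⟩,
    ⟨.pay, rfl⟩, ⟨.best, rfl⟩, ⟨.sc, rfl⟩, ⟨.ps, rfl⟩, ⟨.remP, rfl⟩, ⟨.remW, rfl⟩, ⟨.lo, rfl⟩,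
    ⟨.hi, rfl⟩, ⟨.mid, rfl⟩, ⟨.re, rfl⟩, ⟨.im, rfl⟩, ⟨.p, rfl⟩, ⟨.q, rfl⟩, ⟨.r, rfl⟩, ⟨.t, rfl⟩,
    ⟨.u, rfl⟩, ⟨.y, rfl⟩, ⟨.z, rfl⟩]

/-! ### Memory representation, growth of entries, and simulation -/

section Simulation

variable {I : ℕ → ℕ}

/-- The interleaving with stride 31 leaves no gaps: the remainder of the distance to the base names
an array and the quotient the index. Bounds on input and store therefore cover all of the memory. -/
theorem Rep.size_le {σ : ℕ → ℕ} {s : Store} (h : Rep I σ s)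
    {B : ℕ} (hI : ∀ i, (I i).size ≤ B) (hs : ∀ a i, (s a i).size ≤ B) (i : ℕ) :
    (σ i).size ≤ B := by
  by_cases hi : i < 5 * I 1 + 4
  · rw [h.input i hi]
    exact hI i
  · obtain ⟨a, ha⟩ := Arr.exists_code (Nat.mod_lt (i - (5 * I 1 + 4)) (show 31 > 0 by norm_num))
    have := h.arrays a ((i - (5 * I 1 + 4)) / 31)
    rw [ha, Nat.div_add_mod, Nat.add_sub_cancel' (not_lt.1 hi)] at this
    rw [this]
    exact hs _ _

theorem Rep.base_eval {σ : ℕ → ℕ} {s : Store} (h : Rep I σ s) :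
    baseExpr.eval σ = 5 * I 1 + 4 := by
  simp only [baseExpr, RamExpr.eval]
  rw [h.input 1 (by omega)]

/-- Only input reads need thought: the factor `1 - (i + 1 - base)` is `1` below the base and `0`
beyond it, where the cell belongs to an array while `I` vanishes. -/
theorem Rep.eval_comp {σ : ℕ → ℕ} {s : Store} (h : Rep I σ s)
    (hI : ∀ i, 5 * I 1 + 4 ≤ i → I i = 0) (e : Ex) : e.comp.eval σ = e.eval I s := by
  induction e with
  | lit a => rfl
  | inp i ih =>
    simp only [Ex.comp, RamExpr.eval, Ex.eval, ih, h.base_eval]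
    by_cases hi : i.eval I s < 5 * I 1 + 4
    · rw [h.input _ hi, Nat.sub_eq_zero_of_le (show i.eval I s + 1 ≤ _ by omega), Nat.sub_zero,
        mul_one]
    · rw [hI _ (not_lt.1 hi), Nat.sub_eq_zero_of_le (show 1 ≤ _ by omega), mul_zero]
  | get a i ih =>
    simp only [Ex.comp, addrExpr, RamExpr.eval, Ex.eval, ih, h.base_eval, h.arrays]
  | add e f he hf | sub e f he hf | mul e f he hf | div e f he hf =>
    simp only [Ex.comp, RamExpr.eval, Ex.eval, he, hf]

theorem Rep.eval_addr {σ : ℕ → ℕ} {s : Store} (h : Rep I σ s)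
    (hI : ∀ i, 5 * I 1 + 4 ≤ i → I i = 0) (a : Arr) (i : Ex) :
    (addrExpr a i.comp).eval σ = 5 * I 1 + 4 + (31 * i.eval I s + a.code) := by
  simp only [addrExpr, RamExpr.eval, h.base_eval, h.eval_comp hI]

theorem Rep.put {σ : ℕ → ℕ} {s : Store} (h : Rep I σ s) (a : Arr) (i v : ℕ) :
    Rep I (Function.update σ (5 * I 1 + 4 + (31 * i + a.code)) v) (CKP.put s a i v) where
  input j hj := by
    rw [Function.update_of_ne (by omega), h.input j hj]
  arrays b j := by
    have ha := a.code_lt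
    have hb := b.code_lt
    by_cases hab : b = a ∧ j = i
    · obtain ⟨rfl, rfl⟩ := hab
      simp [CKP.put]
    · rw [Function.update_of_ne, h.arrays b j]
      · simp [CKP.put, hab]
      · intro heq
        have hj : j = i := by omega
        exact hab ⟨Arr.code_injective (by omega), hj⟩

/-- The bounds that the cost analysis uses: the arrays `ro` have entries of at most `b` bits and
the scalars `ls` are at most `R`. -/
structure Small (ro ls : List Arr) (b R : ℕ) (s : Store) : Prop where
  ro : ∀ a ∈ ro, ∀ i, (s a i).size ≤ b
  ls : ∀ a ∈ ls, s a 0 ≤ R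

namespace Cmd

/-- A bound, in multiples of the bit length of the input, on the increase of the bit lengths of the
array entries, when all loops have at most `R` rounds per unit. -/
def grow (R : ℕ) : Cmd → ℕ
  | skip => 0
  | set _ _ e => e.grow
  | seq p q => p.grow R + q.grow R
  | ite _ p q => p.grow R + q.grow R
  | loopTo _ _ p => R * (p.grow R + 3)
  | loopHalf _ e p => e.grow + R * e.grow * (p.grow R + 1)

/-- The price of an assignment. -/
def setPrice (a : Arr) (i e : Ex) : ℕ :=
  (addrExpr a i.comp).price + e.comp.price +
    (1 + (addrExpr a i.comp).width + e.comp.width)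

/-- A bound on the running time, in multiples of the bit length of the cells. -/
def time (R : ℕ) : Cmd → ℕ
  | skip => 1
  | set a i e => setPrice a i e
  | seq p q => p.time R + q.time R
  | ite c p q => c.comp.price + 1 + p.time R + q.time R
  | loopTo x N p => setPrice x (.lit 0) (.lit 0) +
      (R * ((guardTo x N).comp.price + 1 + (p.time R +
        setPrice x (.lit 0) (.add (.get x (.lit 0)) (.lit 1)))) + ((guardTo x N).comp.price + 1))
  | loopHalf x e p => setPrice x (.lit 0) e +
      (R * e.grow * ((Ex.get x (.lit 0)).comp.price + 1 + (p.time R +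
        setPrice x (.lit 0) (.div (.get x (.lit 0)) (.lit 2)))) +
          ((Ex.get x (.lit 0)).comp.price + 1))

end Cmd

variable {ro ls : List Arr} {b R : ℕ}

theorem Small.run {s : Store} (h : Small ro ls b R s) (hls : ls ⊆ ro) {p : Cmd}
    (hp : p.wf ro ls = true) : Small ro ls b R (p.run I s) where
  ro a ha i := by rw [p.run_frame I (Cmd.writes_of_wf hp ha)]; exact h.ro a ha i
  ls a ha := by rw [p.run_frame I (Cmd.writes_of_wf hp (hls ha))]; exact h.ls a ha

theorem Small.put {s : Store} (h : Small ro ls b R s) (hls : ls ⊆ ro) {x : Arr} (hx : x ∉ ro)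
    (i v : ℕ) : Small ro ls b R (CKP.put s x i v) where
  ro a ha := by rw [put_ne (by rintro rfl; exact hx ha)]; exact h.ro a ha
  ls a ha := by rw [put_ne (by rintro rfl; exact hx (hls ha))]; exact h.ls a ha

theorem Ex.size_small (hI : ∀ i, (I i).size ≤ b) (hb : 1 ≤ b) {s : Store}
    (hs : Small ro ls b R s) {e : Ex} (he : e.small ro = true) :
    (e.eval I s).size ≤ b * e.grow := by
  cases e with
  | lit a => exact Nat.le_mul_of_pos_left _ hb
  | inp i => simpa [Ex.eval, Ex.grow] using hI _
  | get a i => simpa [Ex.eval, Ex.grow] using hs.ro a (by simpa [Ex.small] using he) _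
  | _ => simp [Ex.small] at he

/-- A sum has one bit more than its longer summand, and one factor of each product is small, with at
most a constant multiple of `b` bits. So `B` enters with coefficient one, which rules out the
blow-up of repeated squaring. -/
theorem Ex.size_linear (hI : ∀ i, (I i).size ≤ b) (hb : 1 ≤ b) {s : Store}
    (hs : Small ro ls b R s) {B : ℕ} (hB : ∀ a i, (s a i).size ≤ B) {e : Ex}
    (he : e.linear ro = true) : (e.eval I s).size ≤ B + b * e.grow := by
  induction e with
  | lit a => exact (Nat.le_mul_of_pos_left _ hb).trans (Nat.le_add_left _ _)
  | inp i => exact (hI _).trans (by simp [Ex.grow])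
  | get a i => exact (hB _ _).trans (Nat.le_add_right _ _)
  | add e f ihe ihf =>
    simp only [Ex.linear, Bool.and_eq_true] at he
    have := size_add_le (e.eval I s) (f.eval I s)
    have h1 := ihe he.1
    have h2 := ihf he.2
    simp only [Ex.eval, Ex.grow, mul_add, mul_one]
    omega
  | sub e f ihe _ => exact (Nat.size_le_size (Nat.sub_le _ _)).trans (ihe he)
  | mul e f ihe _ =>
    simp only [Ex.linear, Bool.and_eq_true] at he
    have := size_mul_le (e.eval I s) (f.eval I s)
    have h1 := ihe he.1
    have h2 := Ex.size_small hI hb hs he.2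
    simp only [Ex.eval, Ex.grow, mul_add]
    omega
  | div e f ihe _ => exact (Nat.size_le_size (Nat.div_le_self _ _)).trans (ihe he)

theorem size_put_le {s : Store} {B : ℕ} (hB : ∀ a i, (s a i).size ≤ B) {x : Arr} {i v : ℕ}
    (hv : v.size ≤ B) (a : Arr) (j : ℕ) : (put s x i v a j).size ≤ B := by
  unfold put
  split
  · exact hv
  · exact hB a j

/-- Iterating a step that preserves a property and adds at most `g` bits. -/
theorem iterate_size_le {P : Store → Prop} {f : Store → Store} {g : ℕ}
    (hf : ∀ s B, P s → (∀ a i, (s a i).size ≤ B) →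
      P (f s) ∧ ∀ a i, (f s a i).size ≤ B + g) (k : ℕ) :
    ∀ s B, P s → (∀ a i, (s a i).size ≤ B) →
      P (f^[k] s) ∧ ∀ a i, (f^[k] s a i).size ≤ B + k * g := by
  induction k with
  | zero => intro s B hP hB; simpa using ⟨hP, hB⟩
  | succ k ih =>
    intro s B hP hB
    rw [Function.iterate_succ_apply]
    obtain ⟨h1, h2⟩ := hf s B hP hB
    obtain ⟨h3, h4⟩ := ih _ _ h1 h2
    refine ⟨h3, fun a i => (h4 a i).trans (le_of_eq (by ring))⟩

/-- Each assignment adds boundedly many multiples of `b` bits and `R` controls the numbers of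
rounds, so the growth adds up along the run. In the loop cases the induction hypothesis is the step
of `iterate_size_le`. -/
theorem Cmd.size_run_le (hls : ls ⊆ ro) (hI : ∀ i, (I i).size ≤ b) (hb : 1 ≤ b) (hbR : b ≤ R)
    {p : Cmd} (hp : p.wf ro ls = true) (s : Store) (B : ℕ) (hs : Small ro ls b R s)
    (hB : ∀ a i, (s a i).size ≤ B) (a : Arr) (i : ℕ) :
    (p.run I s a i).size ≤ B + b * p.grow R := by
  induction p generalizing s B a i with
  | skip => exact (hB a i).trans (Nat.le_add_right _ _)
  | set x j e =>
    simp only [wf, Bool.and_eq_true] at hp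
    exact size_put_le (fun a i => (hB a i).trans (Nat.le_add_right _ _))
      (Ex.size_linear hI hb hs hB hp.2) a i
  | seq p q ihp ihq =>
    simp only [wf, Bool.and_eq_true] at hp
    refine (ihq hp.2 _ _ (hs.run hls hp.1) (ihp hp.1 s B hs hB) a i).trans (le_of_eq ?_)
    simp only [grow]
    ring
  | ite c p q ihp ihq =>
    simp only [wf, Bool.and_eq_true] at hp
    simp only [run, grow, mul_add]
    split
    · exact (ihp hp.1 s B hs hB a i).trans (by omega)
    · exact (ihq hp.2 s B hs hB a i).trans (by omega)
  | loopTo x N p ih =>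
    simp only [wf, Bool.and_eq_true, Bool.not_eq_true', decide_eq_false_iff_not,
      decide_eq_true_eq] at hp
    have key := iterate_size_le (P := Small ro ls b R)
      (f := fun s => CKP.put (p.run I s) x 0 (p.run I s x 0 + 1)) (g := b * (p.grow R + 3))
      (fun s B hs hB => by
        have h1 := ih hp.2 s B hs hB
        refine ⟨(hs.run hls hp.2).put hls hp.1.1.2 _ _, size_put_le (fun a i => ?_) ?_⟩
        · exact (h1 a i).trans (by rw [mul_add]; omega)
        · have := size_add_le (p.run I s x 0) 1
          have h2 := h1 x 0
          rw [Nat.size_one] at this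
          rw [mul_add]
          omega) (s N 0) (CKP.put s x 0 0) B (hs.put hls hp.1.1.2 _ _)
      (size_put_le hB (by simp))
    refine (key.2 a i).trans ?_
    have := Nat.mul_le_mul_right (b * (p.grow R + 3)) (hs.ls N hp.1.1.1.1)
    simp only [grow]
    linarith [mul_left_comm b R (p.grow R + 3)]
  | loopHalf x e p ih =>
    simp only [wf, Bool.and_eq_true, Bool.not_eq_true', decide_eq_false_iff_not] at hp
    have he := Ex.size_small hI hb hs hp.1.1.1
    have key := iterate_size_le (P := Small ro ls b R)
      (f := fun s => CKP.put (p.run I s) x 0 (p.run I s x 0 / 2)) (g := b * (p.grow R + 1))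
      (fun s B hs hB => by
        have h1 := ih hp.2 s B hs hB
        refine ⟨(hs.run hls hp.2).put hls hp.1.1.2 _ _, size_put_le (fun a i => ?_) ?_⟩
        · exact (h1 a i).trans (by rw [mul_add]; omega)
        · have := Nat.size_le_size (Nat.div_le_self (p.run I s x 0) 2)
          have h2 := h1 x 0
          rw [mul_add]
          omega) ((e.eval I s).size) (CKP.put s x 0 (e.eval I s)) (B + b * e.grow)
      (hs.put hls hp.1.1.2 _ _)
      (size_put_le (fun a i => (hB a i).trans (Nat.le_add_right _ _))
        (he.trans (Nat.le_add_left _ _)))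
    refine (key.2 a i).trans ?_
    have := Nat.mul_le_mul_right (b * (p.grow R + 1))
      (he.trans (Nat.mul_le_mul_right e.grow hbR))
    simp only [grow]
    linarith [mul_left_comm b (R * e.grow) (p.grow R + 1)]

theorem sim_set (hI0 : ∀ i, 5 * I 1 + 4 ≤ i → I i = 0) {σ : ℕ → ℕ} {s : Store} {M : ℕ}
    (hI : ∀ i, (I i).size ≤ M) (hM : 1 ≤ M) (hσ : Rep I σ s) (hs : ∀ a i, (s a i).size ≤ M)
    (a : Arr) (i e : Ex) :
    ∃ σ' T, Exec (compSet a i e) σ σ' T ∧ Rep I σ' (put s a (i.eval I s) (e.eval I s)) ∧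
      T ≤ Cmd.setPrice a i e * M := by
  refine ⟨_, _, Exec.store _ _ _, ?_, ?_⟩
  · rw [hσ.eval_addr hI0, hσ.eval_comp hI0]
    exact hσ.put _ _ _
  · have hB := hσ.size_le hI hs
    have h1 := RamExpr.cost_le hM hB (addrExpr a i.comp)
    have h2 := RamExpr.cost_le hM hB e.comp
    have h3 := RamExpr.size_eval_le hM hB (addrExpr a i.comp)
    have h4 := RamExpr.size_eval_le hM hB e.comp
    simp only [Cmd.setPrice, add_mul]
    omega

/-- Simulation of a loop, from a simulation of its body; `P k` holds when `k` rounds remain. -/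
theorem sim_loop {c : RamExpr} {body : RamProg} {f : Store → Store} {P : ℕ → Store → Prop}
    {C tb : ℕ}
    (hC : ∀ k σ s, P k s → Rep I σ s → c.cost σ ≤ C)
    (h0 : ∀ σ s, P 0 s → Rep I σ s → c.eval σ = 0)
    (h1 : ∀ k σ s, P (k + 1) s → Rep I σ s → c.eval σ ≠ 0)
    (hf : ∀ k σ s, P (k + 1) s → Rep I σ s →
      P k (f s) ∧ ∃ σ' T, Exec body σ σ' T ∧ Rep I σ' (f s) ∧ T ≤ tb) (k : ℕ) :
    ∀ σ s, P k s → Rep I σ s →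
      ∃ σ' T, Exec (.loop c body) σ σ' T ∧ Rep I σ' (f^[k] s) ∧
        T ≤ k * (C + 1 + tb) + (C + 1) := by
  induction k with
  | zero =>
    intro σ s hP hσ
    exact ⟨σ, _, Exec.loopDone (h0 σ s hP hσ), hσ, by have := hC 0 σ s hP hσ; omega⟩
  | succ k ih =>
    intro σ s hP hσ
    obtain ⟨hP', σ₁, T₁, e₁, r₁, t₁⟩ := hf k σ s hP hσ
    obtain ⟨σ₂, T₂, e₂, r₂, t₂⟩ := ih σ₁ (f s) hP' r₁
    refine ⟨σ₂, _, Exec.loopStep (h1 k σ s hP hσ) e₁ e₂, r₂, ?_⟩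
    have := hC _ σ s hP hσ
    rw [add_one_mul]
    omega

/-- `M` bounds the bit length of every cell during the whole run: `hM` reserves the bits that the
command may still add. Thus every instruction costs a constant times `M`. -/
theorem Cmd.sim (hI0 : ∀ i, 5 * I 1 + 4 ≤ i → I i = 0) (hls : ls ⊆ ro)
    (hI : ∀ i, (I i).size ≤ b) (hb : 1 ≤ b) (hbR : b ≤ R)
    {p : Cmd} (hp : p.wf ro ls = true) {M : ℕ} (hbM : b ≤ M) (σ : ℕ → ℕ) (s : Store)
    (hσ : Rep I σ s) (hs : Small ro ls b R s)
    (hM : ∀ a i, (s a i).size + b * p.grow R ≤ M) :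
    ∃ σ' T, Exec p.comp σ σ' T ∧ Rep I σ' (p.run I s) ∧ T ≤ p.time R * M := by
  have hM1 : 1 ≤ M := hb.trans hbM
  have hIM : ∀ i, (I i).size ≤ M := fun i => (hI i).trans hbM
  induction p generalizing σ s with
  | skip => exact ⟨σ, 1, Exec.skip σ, hσ, by simpa [time] using hM1⟩
  | set a i e =>
    exact sim_set hI0 hIM hM1 hσ (fun a i => (Nat.le_add_right _ _).trans (hM a i)) a i e
  | seq p q ihp ihq =>
    simp only [wf, Bool.and_eq_true] at hp
    simp only [grow, mul_add] at hM
    obtain ⟨σ₁, T₁, e₁, r₁, t₁⟩ := ihp hp.1 σ s hσ hs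
      (fun a i => by have := hM a i; omega)
    obtain ⟨σ₂, T₂, e₂, r₂, t₂⟩ := ihq hp.2 σ₁ _ r₁ (hs.run hls hp.1) (fun a i => by
      have hM' : ∀ a i, (s a i).size ≤ M - b * p.grow R - b * q.grow R :=
        fun a i => by have := hM a i; omega
      have := size_run_le hls hI hb hbR hp.1 s _ hs hM' a i
      have := hM a i
      omega)
    refine ⟨σ₂, _, Exec.seq e₁ e₂, r₂, ?_⟩
    simp only [time, add_mul]
    omega
  | ite c p q ihp ihq =>
    simp only [wf, Bool.and_eq_true] at hp
    simp only [grow, mul_add] at hM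
    have hc := RamExpr.cost_le hM1 (hσ.size_le hIM
      (fun a i => (Nat.le_add_right _ _).trans (hM a i))) c.comp
    simp only [time, add_mul, run]
    by_cases h : c.eval I s ≠ 0
    · obtain ⟨σ₁, T₁, e₁, r₁, t₁⟩ := ihp hp.1 σ s hσ hs (fun a i => by have := hM a i; omega)
      refine ⟨σ₁, _, Exec.iteTrue (by rwa [hσ.eval_comp hI0]) e₁, by rwa [if_pos h], ?_⟩
      omega
    · obtain ⟨σ₁, T₁, e₁, r₁, t₁⟩ := ihq hp.2 σ s hσ hs (fun a i => by have := hM a i; omega)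
      refine ⟨σ₁, _, Exec.iteFalse (by rw [hσ.eval_comp hI0]; simpa using h) e₁,
        by rwa [if_neg h], ?_⟩
      omega
  | loopTo x N p ih =>
    simp only [wf, Bool.and_eq_true, Bool.not_eq_true', decide_eq_false_iff_not,
      decide_eq_true_eq] at hp
    obtain ⟨⟨⟨⟨hNls, hNro⟩, hx⟩, hxp⟩, hwf⟩ := hp
    have hxN : N ≠ x := by rintro rfl; exact hx hNro
    have hNp := writes_of_wf hwf hNro
    have hN := hs.ls N hNls
    obtain ⟨σ₁, T₁, e₁, r₁, t₁⟩ := sim_set hI0 hIM hM1 hσ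
      (fun a i => (Nat.le_add_right _ _).trans (hM a i)) x (.lit 0) (.lit 0)
    have hsize : ∀ s : Store, Small ro ls b R s → ∀ k, ∀ B,
        (∀ a i, (s a i).size + (k + 1) * (b * (p.grow R + 3)) ≤ B) → ∀ a i,
        (CKP.put (p.run I s) x 0 (p.run I s x 0 + 1) a i).size + k * (b * (p.grow R + 3)) ≤ B := by
      intro s hs k B hB a i
      have hg := mul_add b (p.grow R) 3
      have hB' : ∀ a i, (s a i).size ≤ B - (k + 1) * (b * (p.grow R + 3)) :=
        fun a i => by have := hB a i; omega
      have h1 := size_run_le hls hI hb hbR hwf s _ hs hB'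
      have h2 := size_add_le (p.run I s x 0) 1
      have h3 := h1 x 0
      rw [Nat.size_one] at h2
      have h4 := size_put_le (s := p.run I s) (x := x) (i := 0) (v := p.run I s x 0 + 1)
        (B := B - (k + 1) * (b * (p.grow R + 3)) + b * (p.grow R + 3))
        (fun a i => (h1 a i).trans (by omega)) (by omega) a i
      have h5 := hB a i
      rw [add_one_mul] at h4 h5
      omega
    obtain ⟨σ₂, T₂, e₂, r₂, t₂⟩ := sim_loop (I := I) (c := (guardTo x N).comp)
      (body := .seq p.comp (compSet x (.lit 0) (.add (.get x (.lit 0)) (.lit 1))))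
      (f := fun s => CKP.put (p.run I s) x 0 (p.run I s x 0 + 1))
      -- The guard `N - x` is the number `k` of remaining rounds, and each entry keeps room for
      -- their growth.
      (P := fun k s' => Small ro ls b R s' ∧ s' N 0 = s' x 0 + k ∧
        ∀ a i, (s' a i).size + k * (b * (p.grow R + 3)) ≤ M)
      (C := (guardTo x N).comp.price * M)
      (tb := (p.time R + setPrice x (.lit 0) (.add (.get x (.lit 0)) (.lit 1))) * M)
      (fun k σ s' h hσ => RamExpr.cost_le hM1 (hσ.size_le hIM
        (fun a i => (Nat.le_add_right _ _).trans (h.2.2 a i))) _)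
      (fun σ s' h hσ => by
        rw [hσ.eval_comp hI0]
        have := h.2.1
        simp only [guardTo, Ex.eval]
        omega)
      (fun k σ s' h hσ => by
        rw [hσ.eval_comp hI0]
        have := h.2.1
        simp only [guardTo, Ex.eval]
        omega)
      (fun k σ s' h hσ => by
        have hM' : ∀ a i, (s' a i).size + b * p.grow R ≤ M := fun a i => by
          have := h.2.2 a i
          rw [add_one_mul, mul_add b] at this
          omega
        refine ⟨⟨(h.1.run hls hwf).put hls hx _ _, ?_, hsize s' h.1 k M h.2.2⟩, ?_⟩
        · rw [put_ne hxN, put_same, if_pos rfl, p.run_frame I hNp, p.run_frame I hxp, h.2.1]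
          ring
        · obtain ⟨σ₁, T₁, e₁, r₁, t₁⟩ := ih hwf σ s' hσ h.1 hM'
          have hM'' : ∀ a i, (s' a i).size ≤ M - b * p.grow R :=
            fun a i => by have := hM' a i; omega
          obtain ⟨σ₂, T₂, e₂, r₂, t₂⟩ := sim_set hI0 hIM hM1 r₁
            (fun a i => by
              have := size_run_le hls hI hb hbR hwf s' _ h.1 hM'' a i
              have := hM' a i
              omega) x (.lit 0) (.add (.get x (.lit 0)) (.lit 1))
          refine ⟨σ₂, _, Exec.seq e₁ e₂, r₂, ?_⟩
          rw [add_mul]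
          omega) (s N 0) σ₁ (CKP.put s x 0 0) ⟨hs.put hls hx _ _, by
            rw [put_ne hxN, put_same, if_pos rfl, zero_add], fun a i => by
            have h1 := Nat.mul_le_mul_right (b * (p.grow R + 3)) hN
            have h2 : ∀ a i, (s a i).size ≤ M - R * (b * (p.grow R + 3)) := fun a i => by
              have := hM a i
              simp only [grow] at this
              rw [mul_left_comm] at this
              omega
            have h3 := size_put_le (x := x) (i := 0) (v := 0) h2 (by simp) a i
            have h4 := hM x 0
            simp only [grow] at h4
            rw [mul_left_comm] at h4
            omega⟩ r₁
    refine ⟨σ₂, _, Exec.seq e₁ e₂, r₂, ?_⟩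
    have h5 := Nat.mul_le_mul_right ((guardTo x N).comp.price * M + 1 +
      (p.time R + setPrice x (.lit 0) (.add (.get x (.lit 0)) (.lit 1))) * M) hN
    simp only [time]
    have h6 : R * ((guardTo x N).comp.price * M + 1 +
      (p.time R + setPrice x (.lit 0) (.add (.get x (.lit 0)) (.lit 1))) * M) ≤
      R * ((guardTo x N).comp.price + 1 +
      (p.time R + setPrice x (.lit 0) (.add (.get x (.lit 0)) (.lit 1)))) * M := by
      rw [mul_assoc]
      apply Nat.mul_le_mul_left
      simp only [add_mul]
      omega
    simp only [add_mul _ _ M, one_mul] at h6 ⊢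
    simp only [add_mul _ _ M] at t₂ h5
    omega
  | loopHalf x e p ih =>
    simp only [wf, Bool.and_eq_true, Bool.not_eq_true', decide_eq_false_iff_not] at hp
    obtain ⟨⟨⟨he, hx⟩, hxp⟩, hwf⟩ := hp
    have hsm := Ex.size_small hI hb hs he
    have hN := hsm.trans (Nat.mul_le_mul_right e.grow hbR)
    have hM0 : ∀ a i, (s a i).size + b * e.grow + R * e.grow * (b * (p.grow R + 1)) ≤ M :=
      fun a i => by
        have := hM a i
        simp only [grow] at this
        linarith [mul_left_comm b (R * e.grow) (p.grow R + 1)]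
    obtain ⟨σ₁, T₁, e₁, r₁, t₁⟩ := sim_set hI0 hIM hM1 hσ
      (fun a i => (Nat.le_add_right _ _).trans (hM a i)) x (.lit 0) e
    obtain ⟨σ₂, T₂, e₂, r₂, t₂⟩ := sim_loop (I := I) (c := (Ex.get x (.lit 0)).comp)
      (body := .seq p.comp (compSet x (.lit 0) (.div (.get x (.lit 0)) (.lit 2))))
      (f := fun s => CKP.put (p.run I s) x 0 (p.run I s x 0 / 2))
      -- Here the bit length of the counter is the number of remaining rounds.
      (P := fun k s' => Small ro ls b R s' ∧ (s' x 0).size = k ∧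
        ∀ a i, (s' a i).size + k * (b * (p.grow R + 1)) ≤ M)
      (C := (Ex.get x (.lit 0)).comp.price * M)
      (tb := (p.time R + setPrice x (.lit 0) (.div (.get x (.lit 0)) (.lit 2))) * M)
      (fun k σ s' h hσ => RamExpr.cost_le hM1 (hσ.size_le hIM
        (fun a i => (Nat.le_add_right _ _).trans (h.2.2 a i))) _)
      (fun σ s' h hσ => by
        rw [hσ.eval_comp hI0]
        exact Nat.size_eq_zero.1 h.2.1)
      (fun k σ s' h hσ => by
        rw [hσ.eval_comp hI0]
        intro h0
        have h1 := h.2.1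
        simp only [Ex.eval] at h0
        rw [h0] at h1
        simp at h1)
      (fun k σ s' h hσ => by
        have hM' : ∀ a i, (s' a i).size + b * p.grow R ≤ M := fun a i => by
          have := h.2.2 a i
          rw [add_one_mul, mul_add b] at this
          omega
        have hM'' : ∀ a i, (s' a i).size ≤ M - b * p.grow R :=
          fun a i => by have := hM' a i; omega
        refine ⟨⟨(h.1.run hls hwf).put hls hx _ _, ?_, fun a i => ?_⟩, ?_⟩
        · rw [put_same, if_pos rfl, p.run_frame I hxp, size_half, h.2.1]
          rfl
        · have hB' : ∀ a i, (s' a i).size ≤ M - (k + 1) * (b * (p.grow R + 1)) :=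
            fun a i => by have := h.2.2 a i; omega
          have hg := mul_add b (p.grow R) 1
          have h1 := size_run_le hls hI hb hbR hwf s' _ h.1 hB'
          have h2 := Nat.size_le_size (Nat.div_le_self (p.run I s' x 0) 2)
          have h3 := h1 x 0
          have h4 := size_put_le (s := p.run I s') (x := x) (i := 0) (v := p.run I s' x 0 / 2)
            (B := M - (k + 1) * (b * (p.grow R + 1)) + b * (p.grow R + 1))
            (fun a i => (h1 a i).trans (by omega)) (by omega) a i
          have h5 := h.2.2 a i
          rw [add_one_mul] at h4 h5
          omega
        · obtain ⟨σ₁, T₁, e₁, r₁, t₁⟩ := ih hwf σ s' hσ h.1 hM'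
          obtain ⟨σ₂, T₂, e₂, r₂, t₂⟩ := sim_set hI0 hIM hM1 r₁
            (fun a i => by
              have := size_run_le hls hI hb hbR hwf s' _ h.1 hM'' a i
              have := hM' a i
              omega) x (.lit 0) (.div (.get x (.lit 0)) (.lit 2))
          refine ⟨σ₂, _, Exec.seq e₁ e₂, r₂, ?_⟩
          rw [add_mul]
          omega) ((e.eval I s).size) σ₁ (CKP.put s x 0 (e.eval I s)) ⟨hs.put hls hx _ _, by
            rw [put_same, if_pos rfl], fun a i => by
            have h1 := Nat.mul_le_mul_right (b * (p.grow R + 1)) hN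
            have h2 : ∀ a i, (s a i).size ≤ M - R * e.grow * (b * (p.grow R + 1)) := fun a i => by
              have := hM0 a i
              omega
            have h3 := size_put_le (x := x) (i := 0) (v := e.eval I s) h2
              (by have := hM0 x 0; omega) a i
            have h4 := hM0 x 0
            omega⟩ r₁
    refine ⟨σ₂, _, Exec.seq e₁ e₂, r₂, ?_⟩
    have h5 := Nat.mul_le_mul_right ((Ex.get x (.lit 0)).comp.price * M + 1 +
      (p.time R + setPrice x (.lit 0) (.div (.get x (.lit 0)) (.lit 2))) * M) hN
    simp only [time]
    have h6 : R * e.grow * ((Ex.get x (.lit 0)).comp.price * M + 1 +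
      (p.time R + setPrice x (.lit 0) (.div (.get x (.lit 0)) (.lit 2))) * M) ≤
      R * e.grow * ((Ex.get x (.lit 0)).comp.price + 1 +
      (p.time R + setPrice x (.lit 0) (.div (.get x (.lit 0)) (.lit 2)))) * M := by
      rw [mul_assoc (R * e.grow)]
      apply Nat.mul_le_mul_left
      simp only [add_mul]
      omega
    simp only [add_mul _ _ M, one_mul] at h6 ⊢
    simp only [add_mul _ _ M] at t₂ h5
    omega

/-! ### Polynomial bounds on growth and time -/

/-- A function bounded by a polynomial with natural coefficients. -/
def PolyBounded (f : ℕ → ℕ) : Prop := ∃ Q : Polynomial ℕ, ∀ x, f x ≤ Q.eval x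

theorem PolyBounded.const (c : ℕ) : PolyBounded fun _ => c := ⟨.C c, fun x => by simp⟩

theorem PolyBounded.id : PolyBounded fun x => x := ⟨.X, fun x => by simp⟩

theorem PolyBounded.add {f g : ℕ → ℕ} (hf : PolyBounded f) (hg : PolyBounded g) :
    PolyBounded fun x => f x + g x := by
  obtain ⟨P, hP⟩ := hf
  obtain ⟨Q, hQ⟩ := hg
  exact ⟨P + Q, fun x => by simpa using add_le_add (hP x) (hQ x)⟩

theorem PolyBounded.mul {f g : ℕ → ℕ} (hf : PolyBounded f) (hg : PolyBounded g) :
    PolyBounded fun x => f x * g x := by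
  obtain ⟨P, hP⟩ := hf
  obtain ⟨Q, hQ⟩ := hg
  exact ⟨P * Q, fun x => by simpa using Nat.mul_le_mul (hP x) (hQ x)⟩

theorem eval_polynomial_mono (P : Polynomial ℕ) : Monotone fun x => P.eval x := by
  intro x y h
  simp only [Polynomial.eval_eq_sum_range]
  gcongr

theorem PolyBounded.comp {f g : ℕ → ℕ} (hf : PolyBounded f) (hg : PolyBounded g) :
    PolyBounded fun x => f (g x) := by
  obtain ⟨P, hP⟩ := hf
  obtain ⟨Q, hQ⟩ := hg
  exact ⟨P.comp Q, fun x => by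
    rw [Polynomial.eval_comp]
    exact (hP _).trans (eval_polynomial_mono P (hQ x))⟩

theorem Cmd.grow_polyBounded (p : Cmd) : PolyBounded fun R => p.grow R := by
  induction p with
  | skip => exact .const 0
  | set a i e => exact .const _
  | seq p q hp hq => exact hp.add hq
  | ite c p q hp hq => exact hp.add hq
  | loopTo x N p hp => exact .mul .id (hp.add (.const 3))
  | loopHalf x e p hp => exact .add (.const _) (.mul (.mul .id (.const _)) (hp.add (.const 1)))

theorem Cmd.time_polyBounded (p : Cmd) : PolyBounded fun R => p.time R := by
  induction p with
  | skip => exact .const 1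
  | set a i e => exact .const _
  | seq p q hp hq => exact hp.add hq
  | ite c p q hp hq => exact .add (.add (.const _) hp) hq
  | loopTo x N p hp =>
    exact .add (.const _) (.add (.mul .id (.add (.const _) (hp.add (.const _)))) (.const _))
  | loopHalf x e p hp =>
    exact .add (.const _)
      (.add (.mul (.mul .id (.const _)) (.add (.const _) (hp.add (.const _)))) (.const _))

end Simulation

/-! ### A monotone rule for choosing one of a family of sets -/

/-- The value of item `k`, divided by `2 ^ j` and truncated at `L`. -/
def scaled (v : ℕ → ℕ) (L j k : ℕ) : ℕ := min (v k / 2 ^ j) L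

/-- The total scaled value of a set. -/
def profit (v : ℕ → ℕ) (L j : ℕ) (S : Finset ℕ) : ℕ := ∑ k ∈ S, scaled v L j k

/-- The value of a set as seen at scale `j`. -/
def score (v : ℕ → ℕ) (L j : ℕ) (S : Finset ℕ) : ℕ := profit v L j S * 2 ^ j

/-- The number whose binary digits indicate the elements of a set. -/
def binCode (S : Finset ℕ) : ℕ := ∑ k ∈ S, 2 ^ k

/-- Injectivity makes the tie-breaking decisive, so that the chosen set is unique. -/
theorem binCode_injective : Function.Injective binCode := Finset.geomSum_injective le_rfl

/-- `S`, seen at scale `j`, has the best score in the family `F`; ties are broken by the scale, then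
by the binary code. -/
structure IsChoice (F : Finset ℕ → Prop) (v : ℕ → ℕ) (L j : ℕ) (S : Finset ℕ) : Prop where
  mem : F S
  best : ∀ j' S', F S' → score v L j' S' < score v L j S ∨
    score v L j' S' = score v L j S ∧ (j < j' ∨ j = j' ∧ binCode S ≤ binCode S')

/-- A family that contains the empty set and consists of subsets of `{0, …, n - 1}`. -/
structure IsFamily (n : ℕ) (F : Finset ℕ → Prop) : Prop where
  empty : F ∅
  subset : ∀ S, F S → S ⊆ Finset.range n

/-- Rounding down and truncating never overestimate, so taking the best of all scales is harmless.
-/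
theorem score_le (v : ℕ → ℕ) (L j : ℕ) (S : Finset ℕ) : score v L j S ≤ ∑ k ∈ S, v k := by
  rw [score, profit, Finset.sum_mul]
  exact Finset.sum_le_sum fun k _ =>
    (Nat.mul_le_mul_right _ (min_le_left _ _)).trans (Nat.div_mul_le_self _ _)

theorem exists_isChoice {n : ℕ} {F : Finset ℕ → Prop} (hF : IsFamily n F) (v : ℕ → ℕ) (L : ℕ) :
    ∃ S j, IsChoice F v L j S := by
  set V := ∑ k ∈ Finset.range n, v k
  have hV : ∀ j S, F S → score v L j S ≤ V := fun j S hS =>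
    (score_le v L j S).trans (Finset.sum_le_sum_of_subset (hF.subset S hS))
  -- There are infinitely many scales, but scores are bounded by `V`; so the deficit `V - score`,
  -- the scale and the code, ordered lexicographically, have a least element.
  let key : ℕ × Finset ℕ → ℕ ×ₗ ℕ ×ₗ ℕ := fun x =>
    toLex (V - score v L x.1 x.2, toLex (x.1, binCode x.2))
  obtain ⟨⟨j, S⟩, hS, hmin⟩ := (InvImage.wf key (wellFounded_lt)).has_min
    {x : ℕ × Finset ℕ | F x.2} ⟨(0, ∅), hF.empty⟩
  refine ⟨S, j, hS, fun j' S' hS' => ?_⟩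
  have h := hmin (j', S') hS'
  have h1 := hV j S hS
  have h2 := hV j' S' hS'
  simp only [InvImage, key, not_lt, Prod.Lex.toLex_le_toLex] at h
  omega

theorem IsChoice.unique {F : Finset ℕ → Prop} {v : ℕ → ℕ} {L j j' : ℕ} {S S' : Finset ℕ}
    (h : IsChoice F v L j S) (h' : IsChoice F v L j' S') : S = S' := by
  have h1 := h.best j' S' h'.mem
  have h2 := h'.best j S h.mem
  exact binCode_injective (by omega)

open Classical in
/-- The set chosen from a family. -/
noncomputable def chosen (F : Finset ℕ → Prop) (v : ℕ → ℕ) (L : ℕ) : Finset ℕ :=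
  if h : ∃ S j, IsChoice F v L j S then h.choose else ∅

theorem IsFamily.chosen_spec {n : ℕ} {F : Finset ℕ → Prop} (hF : IsFamily n F) (v : ℕ → ℕ)
    (L : ℕ) : ∃ j, IsChoice F v L j (chosen F v L) := by
  have h := exists_isChoice hF v L
  rw [chosen, dif_pos h]
  exact h.choose_spec

theorem IsChoice.chosen_eq {F : Finset ℕ → Prop} {v : ℕ → ℕ} {L j : ℕ} {S : Finset ℕ}
    (h : IsChoice F v L j S) : chosen F v L = S := by
  have h' : ∃ S j, IsChoice F v L j S := ⟨S, j, h⟩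
  rw [chosen, dif_pos h']
  obtain ⟨j', hj'⟩ := h'.choose_spec
  exact hj'.unique h

/-- The chosen set still contains `k` when the value of `k` increases and when the family gains
sets that contain `k`. -/
theorem chosen_mono {n : ℕ} {F F' : Finset ℕ → Prop} (hF : IsFamily n F) (hF' : IsFamily n F')
    {v v' : ℕ → ℕ} {L k : ℕ} (hout : ∀ S, k ∉ S → F' S → F S) (hin : ∀ S, k ∈ S → F S → F' S)
    (hv : ∀ i, i ≠ k → v' i = v i) (hk : v k ≤ v' k) (h : k ∈ chosen F v L) :
    k ∈ chosen F' v' L := by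
  obtain ⟨j, hS⟩ := hF.chosen_spec v L
  obtain ⟨j', hS'⟩ := hF'.chosen_spec v' L
  -- Otherwise both sets lie in both families. The old winner contains `k` and has not lost score,
  -- the new one lacks `k` and has kept its score; each beats the other once, so they tie in
  -- everything, including the binary code.
  by_contra hn
  have h1 := hS.best j' _ (hout _ hn hS'.mem)
  have h2 := hS'.best j _ (hin _ h hS.mem)
  have h3 : score v' L j' (chosen F' v' L) = score v L j' (chosen F' v' L) := by
    unfold score profit
    congr 1
    refine Finset.sum_congr rfl fun i hi => ?_
    rw [scaled, scaled, hv i (by rintro rfl; exact hn hi)]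
  have h4 : score v L j (chosen F v L) ≤ score v' L j (chosen F v L) := by
    unfold score profit
    refine Nat.mul_le_mul_right _ (Finset.sum_le_sum fun i _ => ?_)
    refine min_le_min_right _ (Nat.div_le_div_right ?_)
    by_cases hi : i = k
    · rw [hi]; exact hk
    · exact (hv i hi).ge
  have h5 : chosen F v L = chosen F' v' L := binCode_injective (by omega)
  exact hn (h5 ▸ h)

/-! ### Critical values of the choice rule -/

/-- The greatest value up to the reported one with which `k` is not chosen. -/
noncomputable def threshold (F : Finset ℕ → Prop) (v : ℕ → ℕ) (L k : ℕ) : ℕ :=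
  open Classical in Nat.findGreatest (fun x => k ∉ chosen F (Function.update v k x) L) (v k)

theorem IsFamily.chosen_update_mono {n : ℕ} {F : Finset ℕ → Prop} (hF : IsFamily n F) {v : ℕ → ℕ}
    {L k x y : ℕ} (hxy : x ≤ y) (h : k ∈ chosen F (Function.update v k x) L) :
    k ∈ chosen F (Function.update v k y) L :=
  chosen_mono hF hF (fun _ _ h => h) (fun _ _ h => h)
    (fun i hi => by rw [Function.update_of_ne hi, Function.update_of_ne hi]) (by simpa using hxy) h

theorem threshold_le (F : Finset ℕ → Prop) (v : ℕ → ℕ) (L k : ℕ) : threshold F v L k ≤ v k :=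
  Nat.findGreatest_le _

/-- Up to the reported value this is the maximality of the threshold, beyond it monotonicity. -/
theorem IsFamily.mem_of_threshold_lt {n : ℕ} {F : Finset ℕ → Prop} (hF : IsFamily n F) {v : ℕ → ℕ}
    {L k x : ℕ} (h : k ∈ chosen F v L) (hx : threshold F v L k < x) :
    k ∈ chosen F (Function.update v k x) L := by
  classical
  rcases le_total x (v k) with hxv | hxv
  · have := Nat.findGreatest_is_greatest hx hxv
    simpa using this
  · exact hF.chosen_update_mono hxv (by simpa using h)

/-- `Nat.findGreatest` also returns `0` when `k` is chosen with every value, hence the assumption.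
-/
theorem IsFamily.threshold_notMem {F : Finset ℕ → Prop} {v : ℕ → ℕ}
    {L k : ℕ} (hx : threshold F v L k ≠ 0) :
    k ∉ chosen F (Function.update v k (threshold F v L k)) L := by
  classical
  exact Nat.findGreatest_of_ne_zero (P := fun x => k ∉ chosen F (Function.update v k x) L) rfl hx

theorem IsFamily.notMem_of_lt_threshold {n : ℕ} {F : Finset ℕ → Prop} (hF : IsFamily n F)
    {v : ℕ → ℕ} {L k x : ℕ} (hx : x < threshold F v L k) :
    k ∉ chosen F (Function.update v k x) L := fun h =>
  IsFamily.threshold_notMem (Nat.ne_of_gt (Nat.zero_lt_of_lt hx))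
    (hF.chosen_update_mono hx.le h)

/-- At a suitable scale the score of a set is almost its value. -/
theorem exists_score_ge {n m : ℕ} (v : ℕ → ℕ) (S : Finset ℕ)
    (hS : S ⊆ Finset.range n) :
    ∃ j, m * ∑ k ∈ S, v k ≤ m * score v (2 * n * m) j S + ∑ k ∈ S, v k := by
  classical
  set L := 2 * n * m with hL
  set V := S.sup v
  have hle : ∀ k ∈ S, v k ≤ V := fun k hk => Finset.le_sup hk
  have hVS : V ≤ ∑ k ∈ S, v k :=
    Finset.sup_le fun k hk => Finset.single_le_sum (fun _ _ => Nat.zero_le _) hk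
  have hex : ∃ j, V / 2 ^ j ≤ L := ⟨V, by rw [Nat.div_eq_of_lt Nat.lt_two_pow_self]; omega⟩
  have hscore : ∀ j, V / 2 ^ j ≤ L → score v L j S = ∑ k ∈ S, v k / 2 ^ j * 2 ^ j := by
    intro j hj
    rw [score, profit, Finset.sum_mul]
    refine Finset.sum_congr rfl fun k hk => ?_
    rw [scaled, min_eq_left ((Nat.div_le_div_right (hle k hk)).trans hj)]
  -- Take the finest scale at which no value in `S` is truncated; only rounding is lost there.
  refine ⟨Nat.find hex, ?_⟩
  have hj := Nat.find_spec hex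
  have hmin := fun i => Nat.find_min (H := hex) (m := i)
  generalize Nat.find hex = j at hj hmin
  rw [hscore j hj]
  cases j with
  | zero => simp
  | succ j =>
    have h1 := hmin j (Nat.lt_succ_self j)
    -- The next finer scale does truncate, so `V` is large. The rounding loss is at most `n * 2 ^ (j
    -- + 1)`, and `m` times it is exactly `L * 2 ^ j`; this is why `L = 2 * n * m`.
    have h2 : L * 2 ^ j ≤ V := (Nat.le_div_iff_mul_le (by positivity)).1 (not_le.1 h1).le
    have h3 : ∑ k ∈ S, v k ≤ ∑ k ∈ S, v k / 2 ^ (j + 1) * 2 ^ (j + 1) + n * 2 ^ (j + 1) := by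
      have hc : S.card ≤ n := by simpa using Finset.card_le_card hS
      calc ∑ k ∈ S, v k ≤ ∑ k ∈ S, (v k / 2 ^ (j + 1) * 2 ^ (j + 1) + 2 ^ (j + 1)) :=
            Finset.sum_le_sum fun k _ => by
              have := Nat.div_add_mod' (v k) (2 ^ (j + 1))
              have := Nat.mod_lt (v k) (show 2 ^ (j + 1) > 0 by positivity)
              omega
        _ ≤ _ := by
            rw [Finset.sum_add_distrib, Finset.sum_const, smul_eq_mul]
            gcongr
    have h4 := Nat.mul_le_mul_left m h3
    have h5 : m * (n * 2 ^ (j + 1)) = L * 2 ^ j := by rw [hL]; ring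
    rw [mul_add] at h4
    omega

/-! ### Reduction to a knapsack problem with real weights -/

/-- The sets of items among `0, …, n - 1` of total weight at most `C`. -/
def Fits {α : Type*} [AddCommMonoid α] [LE α] (n : ℕ) (w : ℕ → α) (C : α) (S : Finset ℕ) : Prop :=
  S ⊆ Finset.range n ∧ ∑ k ∈ S, w k ≤ C

/-- A set of total size at most `3 / 2 * C` splits into two sets that fit when sizes are truncated
at `C`. -/
theorem exists_split {ι : Type*} [DecidableEq ι] {C : ℝ} (hC : 0 < C) (S : Finset ι) {l : ι → ℝ}
    (hS : ∑ k ∈ S, l k ≤ 3 / 2 * C) :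
    ∃ A ⊆ S, ∑ k ∈ A, min (l k) C ≤ C ∧ ∑ k ∈ S \ A, min (l k) C ≤ C := by
  have htrunc : ∀ T : Finset ι, ∑ k ∈ T, l k ≤ C → ∑ k ∈ T, min (l k) C ≤ C := fun T hT =>
    (Finset.sum_le_sum fun k _ => min_le_left _ _).trans hT
  -- A large item forms one part alone, where truncation makes it fit; the rest is at most `3 / 2 *
  -- C - C / 2 = C`.
  by_cases hbig : ∃ k ∈ S, C / 2 ≤ l k
  · obtain ⟨k, hk, hkC⟩ := hbig
    refine ⟨{k}, by simpa using hk, by simp, htrunc _ ?_⟩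
    have := Finset.sum_sdiff (f := l) (Finset.singleton_subset_iff.2 hk)
    rw [Finset.sum_singleton] at this
    linarith
  · push Not at hbig
    -- If all items are below `C / 2`, collecting items until the next one does not fit stops at `C
    -- / 2` or above, so again at most `C` remains.
    have key : ∀ T ⊆ S, ∃ A ⊆ T, ∑ k ∈ A, l k ≤ C ∧ (A = T ∨ C / 2 ≤ ∑ k ∈ A, l k) := by
      intro T
      induction T using Finset.induction_on with
      | empty => exact fun _ => ⟨∅, le_rfl, by simpa using hC.le, Or.inl rfl⟩
      | insert a T ha ih =>
        intro hT
        obtain ⟨A, hA, hAC, h⟩ := ih ((Finset.subset_insert _ _).trans hT)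
        rcases h with rfl | h
        · by_cases hfit : ∑ k ∈ insert a A, l k ≤ C
          · exact ⟨_, le_rfl, hfit, Or.inl rfl⟩
          · refine ⟨A, Finset.subset_insert _ _, hAC, Or.inr ?_⟩
            rw [Finset.sum_insert ha] at hfit
            have := hbig a (hT (Finset.mem_insert_self _ _))
            linarith
        · exact ⟨A, hA.trans (Finset.subset_insert _ _), hAC, Or.inr h⟩
    obtain ⟨A, hA, hAC, h⟩ := key S le_rfl
    refine ⟨A, hA, htrunc A hAC, htrunc _ ?_⟩
    have := Finset.sum_sdiff (f := l) hA
    rcases h with rfl | h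
    · simpa using hC.le
    · linarith

/-! ### Weights of complex demands -/

open Classical in
/-- The weight of a demand: the sum of its parts, truncated at the capacity, if the demand is
feasible on its own, and twice the capacity otherwise. -/
noncomputable def weight (C : ℝ) (d : Quadrant) : ℝ :=
  if ‖d.1‖ ≤ C then min (d.1.re + d.1.im) C else 2 * C

theorem Quadrant.norm_le_norm {d e : Quadrant} (h : Meets d e) : ‖d.1‖ ≤ ‖e.1‖ := by
  rw [Complex.norm_def, Complex.norm_def, Complex.normSq_apply, Complex.normSq_apply]
  have := d.2.1
  have := d.2.2
  exact Real.sqrt_le_sqrt (add_le_add (mul_self_le_mul_self d.2.1 h.1)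
    (mul_self_le_mul_self d.2.2 h.2))

theorem Quadrant.norm_le_add (d : Quadrant) : ‖d.1‖ ≤ d.1.re + d.1.im := by
  have := Complex.norm_le_abs_re_add_abs_im d.1
  rwa [abs_of_nonneg d.2.1, abs_of_nonneg d.2.2] at this

theorem weight_nonneg {C : ℝ} (hC : 0 < C) (d : Quadrant) : 0 ≤ weight C d := by
  unfold weight
  split
  · exact le_min (add_nonneg d.2.1 d.2.2) hC.le
  · linarith

theorem weight_mono {C : ℝ} (hC : 0 < C) {d e : Quadrant} (h : Meets d e) :
    weight C d ≤ weight C e := by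
  unfold weight
  split_ifs with h1 h2
  · exact min_le_min_right _ (add_le_add h.1 h.2)
  · exact (min_le_right _ _).trans (by linarith)
  · exact absurd ((Quadrant.norm_le_norm h).trans ‹_›) h1
  · exact le_rfl

/-- Truncation at `C` is what makes every demand of norm at most `C` fit alone, even when its parts
add up to more than `C`. -/
theorem weight_le_iff {C : ℝ} (hC : 0 < C) {d : Quadrant} : weight C d ≤ C ↔ ‖d.1‖ ≤ C := by
  unfold weight
  split_ifs with h
  · simp [h]
  · simp only [h, iff_false]
    linarith

theorem eq_zero_of_weight {C : ℝ} (hC : 0 < C) {d : Quadrant} (h : weight C d = 0) : d.1 = 0 := by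
  have h1 := (weight_le_iff hC (d := d)).1 (by linarith)
  rw [weight, if_pos h1] at h
  have h2 : d.1.re + d.1.im = 0 := by
    rcases min_choice (d.1.re + d.1.im) C with h' | h' <;> rw [h'] at h
    · exact h
    · linarith
  have := d.2.1
  have := d.2.2
  exact Complex.ext (by simp; linarith) (by simp; linarith)

/-- A set of demands of total weight at most `C` is feasible. -/
theorem norm_sum_le_of_weight {ι : Type*} {C : ℝ} (hC : 0 < C) (T : Finset ι) (d : ι → Quadrant)
    (h : ∑ k ∈ T, weight C (d k) ≤ C) : ‖∑ k ∈ T, (d k).1‖ ≤ C := by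
  classical
  have hone : ∀ k ∈ T, ‖(d k).1‖ ≤ C := fun k hk => (weight_le_iff hC).1 <|
    (Finset.single_le_sum (fun i _ => weight_nonneg hC (d i)) hk).trans h
  -- A demand whose parts exceed `C` has weight exactly `C` and leaves room only for weight zero,
  -- that is, for zero demands. Without such a demand nothing is truncated and the triangle
  -- inequality suffices.
  by_cases hbig : ∃ k ∈ T, C < (d k).1.re + (d k).1.im
  · obtain ⟨k, hk, hkC⟩ := hbig
    have hw : weight C (d k) = C := by rw [weight, if_pos (hone k hk), min_eq_right hkC.le]
    have hrest : ∀ i ∈ T, i ≠ k → (d i).1 = 0 := by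
      intro i hi hik
      apply eq_zero_of_weight hC
      have := Finset.sum_le_sum_of_subset_of_nonneg
        (Finset.insert_subset hi (Finset.singleton_subset_iff.2 hk))
        (fun j _ _ => weight_nonneg hC (d j))
      rw [Finset.sum_pair hik, hw] at this
      have := weight_nonneg hC (d i)
      linarith
    rw [Finset.sum_eq_single_of_mem k hk hrest]
    exact hone k hk
  · push Not at hbig
    refine (norm_sum_le _ _).trans (le_trans (Finset.sum_le_sum fun k hk => ?_) h)
    rw [weight, if_pos (hone k hk), min_eq_left (hbig k hk)]
    exact Quadrant.norm_le_add _

/-- A feasible set of demands splits into two sets of total weight at most `C`. -/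
theorem exists_split_weight {ι : Type*} [DecidableEq ι] {C : ℝ} (hC : 0 < C) (S : Finset ι)
    (d : ι → Quadrant) (h : ‖∑ k ∈ S, (d k).1‖ ≤ C) :
    ∃ A ⊆ S, ∑ k ∈ A, weight C (d k) ≤ C ∧ ∑ k ∈ S \ A, weight C (d k) ≤ C := by
  -- All parts are nonnegative, so each member of a feasible set is feasible alone and the weight `2
  -- * C` does not occur.
  have hw : ∀ k ∈ S, weight C (d k) = min ((d k).1.re + (d k).1.im) C := by
    intro k hk
    refine if_pos (le_trans ?_ h)
    refine Quadrant.norm_le_norm (d := d k) (e := ⟨∑ k ∈ S, (d k).1, ?_, ?_⟩) ⟨?_, ?_⟩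
    · rw [Complex.re_sum]; exact Finset.sum_nonneg fun i _ => (d i).2.1
    · rw [Complex.im_sum]; exact Finset.sum_nonneg fun i _ => (d i).2.2
    · simp only [Complex.re_sum]
      exact Finset.single_le_sum (f := fun i => (d i).1.re) (fun i _ => (d i).2.1) hk
    · simp only [Complex.im_sum]
      exact Finset.single_le_sum (f := fun i => (d i).1.im) (fun i _ => (d i).2.2) hk
  -- Cauchy–Schwarz gives `√2 * C`; the rational `3 / 2` is enough for the splitting.
  have hsum : ∑ k ∈ S, ((d k).1.re + (d k).1.im) ≤ 3 / 2 * C := by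
    rw [Finset.sum_add_distrib, ← Complex.re_sum, ← Complex.im_sum]
    set z := ∑ k ∈ S, (d k).1
    have h1 : z.re ^ 2 + z.im ^ 2 ≤ C ^ 2 := by
      have h2 := Complex.sq_norm z
      rw [Complex.normSq_apply] at h2
      nlinarith [norm_nonneg z]
    refine abs_le_of_sq_le_sq' (a := z.re + z.im) ?_ (by linarith) |>.2
    nlinarith [sq_nonneg (z.re - z.im), sq_nonneg C]
  obtain ⟨A, hA, h1, h2⟩ := exists_split hC S (l := fun k => (d k).1.re + (d k).1.im)
    hsum
  refine ⟨A, hA, ?_, ?_⟩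
  · rwa [Finset.sum_congr rfl fun k hk => hw k (hA hk)]
  · rwa [Finset.sum_congr rfl fun k hk => hw k (Finset.mem_sdiff.1 hk).1]

/-! ### The mechanism -/

/-- The function on the natural numbers that extends `f` by zero. -/
def extend {α : Type*} [Zero α] {n : ℕ} (f : Fin n → α) (k : ℕ) : α :=
  if h : k < n then f ⟨k, h⟩ else 0

theorem extend_val {α : Type*} [Zero α] {n : ℕ} (f : Fin n → α) (k : Fin n) :
    extend f k = f k := by simp [extend]

theorem extend_update {α β : Type*} [Zero α] {n : ℕ} (g : β → α) (t : Fin n → β) (k : Fin n)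
    (x : β) : extend (fun i => g (Function.update t k x i)) =
      Function.update (extend fun i => g (t i)) k (g x) := by
  funext i
  by_cases hi : i < n
  · by_cases hk : i = k
    · subst hk; simp [extend]
    · have : (⟨i, hi⟩ : Fin n) ≠ k := fun h => hk (by rw [← h])
      simp [extend, hi, hk, this]
  · have : i ≠ k := fun h => hi (h ▸ k.2)
    simp [extend, hi, this]

theorem sum_map_extend {α : Type*} [AddCommMonoid α] {n : ℕ} (f : Fin n → α) (S : Finset (Fin n)) :
    ∑ k ∈ S.map Fin.valEmbedding, extend f k = ∑ k ∈ S, f k := by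
  simp [extend_val]

/-- The values of the agents. -/
def values {n : ℕ} (t : Fin n → AgentType) : ℕ → ℕ := extend fun k => (t k).value

/-- The weights of the demands of the agents. -/
noncomputable def weights {n : ℕ} (C : ℝ) (t : Fin n → AgentType) : ℕ → ℝ :=
  extend fun k => weight C (t k).demand

/-- The sets of agents among which the mechanism chooses. -/
def family {n : ℕ} (C : ℝ) (t : Fin n → AgentType) : Finset ℕ → Prop := Fits n (weights C t) C

theorem family_isFamily {n : ℕ} {C : ℝ} (hC : 0 < C) (t : Fin n → AgentType) :
    IsFamily n (family C t) :=
  ⟨⟨by simp, by simpa using hC.le⟩, fun _ h => h.1⟩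

open Classical in
/-- The mechanism with precision `m`: the chosen agents get their demands and pay the thresholds,
except that agents without demand do not pay. -/
noncomputable def mechanism (m : ℕ) : Mechanism where
  alloc n C t k :=
    if (k : ℕ) ∈ chosen (family C t) (values t) (2 * n * m) then (t k).demand else ⟨0, by simp⟩
  pay n C t k :=
    if (k : ℕ) ∈ chosen (family C t) (values t) (2 * n * m) ∧ (t k).demand.1 ≠ 0 then
      (threshold (family C t) (values t) (2 * n * m) k : ℝ) else 0

section Mechanism

variable {m n : ℕ} {C : ℝ}

theorem meets_refl (d : Quadrant) : Meets d d := ⟨le_rfl, le_rfl⟩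

theorem meets_zero_iff {d : Quadrant} : Meets d ⟨0, by simp⟩ ↔ d.1 = 0 := by
  constructor
  · rintro ⟨h1, h2⟩
    exact Complex.ext (le_antisymm h1 d.2.1) (le_antisymm h2 d.2.2)
  · intro h
    simp [Meets, h]

theorem meets_of_eq_zero {d : Quadrant} (h : d.1 = 0) (e : Quadrant) : Meets d e := by
  have := e.2
  simp [Meets, h, this]

/-- The zero assignment meets a zero demand, so such agents count as selected even when they are not
chosen. This is the reason for their exemption from payment. -/
theorem mechanism_selected_iff {t : Fin n → AgentType} {k : Fin n} :
    (mechanism m).Selected n C t k ↔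
      (k : ℕ) ∈ chosen (family C t) (values t) (2 * n * m) ∨ (t k).demand.1 = 0 := by
  simp only [Mechanism.Selected, mechanism]
  split_ifs with h
  · simp [h, meets_refl]
  · simp [h, meets_zero_iff]

theorem values_update (t : Fin n → AgentType) (k : Fin n) (τ : AgentType) :
    values (Function.update t k τ) = Function.update (values t) k τ.value :=
  extend_update AgentType.value t k τ

theorem weights_update (C : ℝ) (t : Fin n → AgentType) (k : Fin n) (τ : AgentType) :
    weights C (Function.update t k τ) = Function.update (weights C t) k (weight C τ.demand) :=
  extend_update (fun τ : AgentType => weight C τ.demand) t k τ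

theorem family_update_of_eq (t : Fin n → AgentType) (k : Fin n) {τ : AgentType}
    (h : τ.demand = (t k).demand) : family C (Function.update t k τ) = family C t := by
  rw [family, weights_update, h, family]
  congr 1
  refine Function.update_eq_self_iff.2 ?_
  rw [weights, extend_val]

theorem fits_congr {w w' : ℕ → ℝ} {k : ℕ} (h : ∀ i, i ≠ k → w i = w' i) {S : Finset ℕ}
    (hk : k ∉ S) (hS : Fits n w C S) : Fits n w' C S :=
  ⟨hS.1, (Finset.sum_congr rfl fun i hi => (h i (by rintro rfl; exact hk hi)).symm).le.trans hS.2⟩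

/-- A smaller demand has a smaller weight, so the family can only gain sets that contain `k`, and
`chosen_mono` applies. The values are left free because incentive compatibility also needs the case
of hypothetical values. -/
theorem chosen_of_smaller_demand (hC : 0 < C) {t : Fin n → AgentType} {k : Fin n} {τ : AgentType}
    {v v' : ℕ → ℕ} {L : ℕ} (hτ : Meets τ.demand (t k).demand) (hv : ∀ i, i ≠ (k : ℕ) → v' i = v i)
    (hk : v k ≤ v' k) (h : (k : ℕ) ∈ chosen (family C t) v L) :
    (k : ℕ) ∈ chosen (family C (Function.update t k τ)) v' L := by
  refine chosen_mono (family_isFamily hC t) (family_isFamily hC _) ?_ ?_ hv hk h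
  · intro S hS
    rw [family, family, weights_update]
    exact fits_congr (fun i hi => Function.update_of_ne hi _ _) hS
  · rintro S - ⟨h1, h2⟩
    refine ⟨h1, le_trans (Finset.sum_le_sum fun i _ => ?_) h2⟩
    rw [weights_update]
    by_cases hi : i = k
    · subst hi
      rw [Function.update_self, weights, extend_val]
      exact weight_mono hC hτ
    · rw [Function.update_of_ne hi]

theorem mechanism_pay_nonneg {t : Fin n → AgentType} {k : Fin n} :
    0 ≤ (mechanism m).pay n C t k := by
  simp only [mechanism]
  split_ifs <;> simp

theorem mechanism_individuallyRational (m : ℕ) : (mechanism m).IndividuallyRational := by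
  intro n C hC t k
  have hle : (threshold (family C t) (values t) (2 * n * m) k : ℝ) ≤ (t k).value := by
    have := threshold_le (family C t) (values t) (2 * n * m) k
    rw [values, extend_val] at this
    exact_mod_cast this
  by_cases h : (k : ℕ) ∈ chosen (family C t) (values t) (2 * n * m)
  · simp only [Mechanism.utility, mechanism, valuation]
    simp only [h, if_true, meets_refl, true_and]
    split_ifs
    · linarith
    · simp
  · have hp : (mechanism m).pay n C t k = 0 := by simp [mechanism, h]
    rw [Mechanism.utility, hp, sub_zero]
    unfold valuation
    split
    · exact Nat.cast_nonneg _
    · exact le_rfl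

theorem mechanism_exact (m : ℕ) : (mechanism m).Exact := by
  intro n C _ t k
  simp only [mechanism]
  split_ifs <;> simp

theorem mechanism_monotone (m : ℕ) : (mechanism m).Monotone := by
  intro n C hC t k τ hv hd h
  rw [mechanism_selected_iff] at h ⊢
  rcases h with h | h
  · left
    refine chosen_of_smaller_demand hC hd (fun i hi => ?_) ?_ h
    · rw [values_update, Function.update_of_ne hi]
    · rwa [values_update, Function.update_self, values, extend_val]
  · right
    rw [Function.update_self]
    refine meets_zero_iff.1 ?_
    simpa [Meets, h] using hd

theorem mechanism_feasible (m : ℕ) : (mechanism m).Feasible := by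
  classical
  intro n C hC t
  obtain ⟨j, hS⟩ := (family_isFamily hC t).chosen_spec (values t) (2 * n * m)
  have h1 : ∑ k, ((mechanism m).alloc n C t k).1 =
      ∑ k with ((k : Fin n) : ℕ) ∈ chosen (family C t) (values t) (2 * n * m), (t k).demand.1 := by
    rw [Finset.sum_filter]
    refine Finset.sum_congr rfl fun k _ => ?_
    simp only [mechanism]
    split_ifs <;> rfl
  rw [h1]
  refine norm_sum_le_of_weight hC _ (fun k => (t k).demand) ?_
  rw [← sum_map_extend]
  refine le_trans (Finset.sum_le_sum_of_subset_of_nonneg ?_ ?_) hS.mem.2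
  · intro i hi
    simp only [Finset.mem_map, Finset.mem_filter, Finset.mem_univ, true_and] at hi
    obtain ⟨k, hk, rfl⟩ := hi
    exact hk
  · intro i _ _
    simp only [extend]
    split_ifs
    · exact weight_nonneg hC _
    · exact le_rfl

theorem mechanism_paysCriticalValues (m : ℕ) : (mechanism m).PaysCriticalValues := by
  intro n C hC t k
  refine ⟨fun hsel τ hτ => ?_, fun hsel => ?_⟩
  · rw [mechanism_selected_iff, family_update_of_eq t k hτ, values_update, Function.update_self, hτ]
    rw [mechanism_selected_iff] at hsel
    -- A zero demand pays `0`; it is selected with every value, and no value lies below `0`.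
    by_cases hd : (t k).demand.1 = 0
    · refine ⟨fun _ => Or.inr hd, fun h => absurd h ?_⟩
      simp [mechanism, hd]
    · have hch := hsel.resolve_right hd
      have hpay : (mechanism m).pay n C t k =
          (threshold (family C t) (values t) (2 * n * m) k : ℝ) := by
        simp [mechanism, hch, hd]
      rw [hpay]
      simp only [Nat.cast_lt, hd, or_false]
      exact ⟨fun h => (family_isFamily hC t).mem_of_threshold_lt hch h,
        fun h => (family_isFamily hC t).notMem_of_lt_threshold h⟩
  · rw [mechanism_selected_iff, not_or] at hsel
    simp [mechanism, hsel.1]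

theorem mechanism_incentiveCompatible (m : ℕ) : (mechanism m).IncentiveCompatible := by
  classical
  intro n C hC t k τ
  have hIR := mechanism_individuallyRational m n C hC t k
  have hpay : 0 ≤ (mechanism m).pay n C (Function.update t k τ) k := mechanism_pay_nonneg
  by_cases hd : (t k).demand.1 = 0
  · have h1 : (mechanism m).utility n C (t k) t k = (t k).value := by
      simp [Mechanism.utility, mechanism, valuation, hd, meets_of_eq_zero hd]
    rw [h1, Mechanism.utility, valuation, if_pos (meets_of_eq_zero hd _)]
    linarith
  · by_cases hm : Meets (t k).demand ((mechanism m).alloc n C (Function.update t k τ) k)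
    swap
    · rw [Mechanism.utility, valuation, if_neg hm]
      linarith
    have hch : (k : ℕ) ∈ chosen (family C (Function.update t k τ))
        (values (Function.update t k τ)) (2 * n * m) := by
      by_contra hn
      simp only [mechanism, hn, if_false] at hm
      exact hd (meets_zero_iff.1 hm)
    have hmd : Meets (t k).demand τ.demand := by
      simpa [mechanism, hch] using hm
    have hd' : τ.demand.1 ≠ 0 := fun h0 => hd <| meets_zero_iff.1 <| by
      simpa [Meets, h0] using hmd
    set F' := family C (Function.update t k τ) with hF'
    set θ := threshold F' (values (Function.update t k τ)) (2 * n * m) k with hθ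
    have hp : (mechanism m).pay n C (Function.update t k τ) k = θ := by
      simp [mechanism, ← hF', hch, hd', hθ]
    rw [Mechanism.utility, valuation, if_pos hm, hp]
    by_cases hv : (t k).value ≤ θ
    · have : ((t k).value : ℝ) ≤ θ := by exact_mod_cast hv
      linarith
    -- Values above the price `θ` of the lie win with the claimed demand, hence also with the
    -- smaller true one; so the truthful price is at most `θ`.
    have hsel : ∀ x, θ < x →
        (k : ℕ) ∈ chosen (family C t) (Function.update (values t) k x) (2 * n * m) := by
      intro x hx
      have h1 := (family_isFamily hC _).mem_of_threshold_lt hch hx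
      rw [values_update, Function.update_idem] at h1
      have h2 := chosen_of_smaller_demand hC (τ := t k) (by simpa using hmd)
        (v' := Function.update (values t) k x) (fun _ _ => rfl) le_rfl h1
      rwa [Function.update_idem, Function.update_eq_self] at h2
    have hcht : (k : ℕ) ∈ chosen (family C t) (values t) (2 * n * m) := by
      have := hsel _ (not_le.1 hv)
      rwa [show (t k).value = values t k by rw [values, extend_val],
        Function.update_eq_self] at this
    have hle : threshold (family C t) (values t) (2 * n * m) k ≤ θ := by
      by_contra hlt
      exact IsFamily.threshold_notMem (by omega) (hsel _ (not_le.1 hlt))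
    have hp' : (mechanism m).utility n C (t k) t k =
        (t k).value - threshold (family C t) (values t) (2 * n * m) k := by
      simp [Mechanism.utility, valuation, mechanism, hcht, hd, meets_refl]
    rw [hp']
    have : (threshold (family C t) (values t) (2 * n * m) k : ℝ) ≤ θ := by exact_mod_cast hle
    linarith

theorem mechanism_isApproximation {m : ℕ} {ε : ℝ} (hm : 1 ≤ m) (hε : 1 / (m : ℝ) ≤ ε) :
    (mechanism m).IsApproximation (1 / 2 - ε) := by
  classical
  intro n C hC t S hS
  obtain ⟨j, hX⟩ := (family_isFamily hC t).chosen_spec (values t) (2 * n * m)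
  set X := chosen (family C t) (values t) (2 * n * m) with hXdef
  have hsel : ∑ k ∈ X, values t k ≤ totalValue t ((mechanism m).selectedSet n C t) := by
    rw [totalValue, ← sum_map_extend]
    refine Finset.sum_le_sum_of_subset fun i hi => ?_
    have hin := Finset.mem_range.1 (hX.mem.1 hi)
    refine Finset.mem_map.2 ⟨⟨i, hin⟩, ?_, rfl⟩
    simp only [Mechanism.selectedSet, Finset.mem_filter, Finset.mem_univ, true_and]
    exact mechanism_selected_iff.2 (Or.inl hi)
  -- Each part that fits is worth at most the outcome, up to a fraction `1 / m` of its own value.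
  -- Adding this over the two parts of a feasible set yields the ratio.
  have hpart : ∀ A : Finset (Fin n), ∑ k ∈ A, weight C (t k).demand ≤ C →
      m * totalValue t A ≤
        m * totalValue t ((mechanism m).selectedSet n C t) + totalValue t A := by
    intro A hA
    have hfit : family C t (A.map Fin.valEmbedding) := by
      refine ⟨fun i hi => ?_, ?_⟩
      · obtain ⟨k, -, rfl⟩ := Finset.mem_map.1 hi
        exact Finset.mem_range.2 k.2
      · rwa [weights, sum_map_extend]
    obtain ⟨i, hi⟩ := exists_score_ge (m := m) (values t) _ hfit.1
    have h1 := hX.best i _ hfit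
    have h2 := score_le (values t) (2 * n * m) j X
    have h3 : score (values t) (2 * n * m) i (A.map Fin.valEmbedding) ≤
      totalValue t ((mechanism m).selectedSet n C t) := by omega
    have h4 : ∑ k ∈ A.map Fin.valEmbedding, values t k = totalValue t A := sum_map_extend _ _
    rw [h4] at hi
    have := Nat.mul_le_mul_left m h3
    omega
  obtain ⟨A, hA, h1, h2⟩ := exists_split_weight hC S (fun k => (t k).demand) hS
  have h3 := hpart A h1
  have h4 := hpart _ h2
  have h5 : totalValue t (S \ A) + totalValue t A = totalValue t S := Finset.sum_sdiff hA
  have h6 : m * totalValue t S ≤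
      2 * (m * totalValue t ((mechanism m).selectedSet n C t)) + totalValue t S := by
    rw [← h5, mul_add]
    omega
  have hm0 : (0 : ℝ) < m := by exact_mod_cast hm
  have h7 : (m : ℝ) * totalValue t S ≤
      2 * (m * totalValue t ((mechanism m).selectedSet n C t)) + totalValue t S := by
    exact_mod_cast h6
  have h8 : (totalValue t S : ℝ) ≤
      2 * totalValue t ((mechanism m).selectedSet n C t) + 1 / (m : ℝ) * totalValue t S := by
    rw [← mul_le_mul_iff_right₀ hm0]
    field_simp
    linarith
  have h9 : (0 : ℝ) ≤ totalValue t S := by positivity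
  have h10 := mul_le_mul_of_nonneg_right hε h9
  nlinarith [mul_nonneg (show (0 : ℝ) ≤ ε from (by positivity : (0 : ℝ) ≤ 1 / m).trans hε) h9]

end Mechanism


/-! ### The dynamic program, in mathematical terms -/

/-- The least weight (or a number above `W`) of a set of items below `i` with total profit `p`. -/
def leastWeight (c w : ℕ → ℕ) (W : ℕ) : ℕ → ℕ → ℕ
  | 0, p => if p = 0 then 0 else W + 1
  | i + 1, p =>
    if c i ≤ p then min (leastWeight c w W i p) (leastWeight c w W i (p - c i) + w i)
    else leastWeight c w W i p

/-- The sets below `i + 1` are split by whether they contain `i`. Requiring `x ≤ W` lets the default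
value `W + 1` stand for the absence of a set. -/
theorem leastWeight_le_iff (c w : ℕ → ℕ) (W i p x : ℕ) (hx : x ≤ W) :
    leastWeight c w W i p ≤ x ↔
      ∃ A ⊆ Finset.range i, ∑ k ∈ A, c k = p ∧ ∑ k ∈ A, w k ≤ x := by
  induction i generalizing p x with
  | zero =>
    simp only [leastWeight, Finset.range_zero, Finset.subset_empty]
    constructor
    · intro h
      split_ifs at h with hp
      · exact ⟨∅, rfl, by simp [hp], by simp⟩
      · omega
    · rintro ⟨A, rfl, h, -⟩
      simp at h
      simp [← h]
  | succ i ih =>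
    have hsplit : (∃ A ⊆ Finset.range (i + 1), ∑ k ∈ A, c k = p ∧ ∑ k ∈ A, w k ≤ x) ↔
        (∃ A ⊆ Finset.range i, ∑ k ∈ A, c k = p ∧ ∑ k ∈ A, w k ≤ x) ∨
        ∃ A ⊆ Finset.range i, ∑ k ∈ A, c k + c i = p ∧ ∑ k ∈ A, w k + w i ≤ x := by
      constructor
      · rintro ⟨A, hA, h1, h2⟩
        rw [Finset.range_add_one] at hA
        by_cases hi : i ∈ A
        · refine Or.inr ⟨A.erase i, ?_, ?_, ?_⟩
          · rwa [← Finset.subset_insert_iff]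
          · rwa [Finset.sum_erase_add _ _ hi]
          · rwa [Finset.sum_erase_add _ _ hi]
        · exact Or.inl ⟨A, (Finset.subset_insert_iff_of_notMem hi).1 hA, h1, h2⟩
      · rintro (⟨A, hA, h1, h2⟩ | ⟨A, hA, h1, h2⟩)
        · exact ⟨A, hA.trans (Finset.range_subset_range.2 (Nat.le_succ i)), h1, h2⟩
        · have hi : i ∉ A := fun h => absurd (Finset.mem_range.1 (hA h)) (lt_irrefl i)
          refine ⟨insert i A, ?_, ?_, ?_⟩
          · rw [Finset.range_add_one]
            exact Finset.insert_subset_insert i hA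
          · rw [Finset.sum_insert hi, add_comm, h1]
          · rwa [Finset.sum_insert hi, add_comm]
    rw [hsplit, leastWeight]
    split_ifs with hc
    · rw [min_le_iff, ih p x hx]
      refine or_congr_right ?_
      constructor
      · intro h
        obtain ⟨A, hA, h1, h2⟩ := (ih (p - c i) (x - w i) (by omega)).1 (by omega)
        exact ⟨A, hA, by omega, by omega⟩
      · rintro ⟨A, hA, h1, h2⟩
        have := (ih (p - c i) (x - w i) (by omega)).2 ⟨A, hA, by omega, by omega⟩
        omega
    · rw [ih p x hx]
      refine ⟨Or.inl, ?_⟩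
      rintro (h | ⟨A, hA, h1, h2⟩)
      · exact h
      · omega

/-! ### Reconstruction of the set of least binary code -/

/-- `R` is the part from `i` on of the set of least binary code among the sets of items below `n`
with profit `p` and weight at most `W`. -/
structure IsLeastPart (c w : ℕ → ℕ) (n W p i : ℕ) (R : Finset ℕ) : Prop where
  subset : R ⊆ Finset.Ico i n
  exists_rest : ∃ A ⊆ Finset.range i, ∑ k ∈ A, c k + ∑ k ∈ R, c k = p ∧
    ∑ k ∈ A, w k + ∑ k ∈ R, w k ≤ W
  least : ∀ S ⊆ Finset.range n, ∑ k ∈ S, c k = p → ∑ k ∈ S, w k ≤ W →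
    binCode R ≤ binCode (S.filter (i ≤ ·))

theorem two_pow_dvd_binCode {i : ℕ} {S : Finset ℕ} (h : ∀ k ∈ S, i ≤ k) : 2 ^ i ∣ binCode S :=
  Finset.dvd_sum fun k hk => pow_dvd_pow 2 (h k hk)

theorem filter_le_eq_of_notMem {i : ℕ} {S : Finset ℕ} (h : i ∉ S) :
    S.filter (i ≤ ·) = S.filter (i + 1 ≤ ·) := by
  refine Finset.filter_congr fun k hk => ?_
  have : k ≠ i := by rintro rfl; exact h hk
  omega

theorem binCode_filter_le (i : ℕ) (S : Finset ℕ) :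
    binCode (S.filter (i + 1 ≤ ·)) ≤ binCode (S.filter (i ≤ ·)) :=
  Finset.sum_le_sum_of_subset
    (Finset.monotone_filter_right S fun _ _ (h : i + 1 ≤ _) => by omega)

theorem IsLeastPart.keep {c w : ℕ → ℕ} {n W p i : ℕ} {R : Finset ℕ}
    (h : IsLeastPart c w n W p (i + 1) R)
    (hA : ∃ A ⊆ Finset.range i, ∑ k ∈ A, c k + ∑ k ∈ R, c k = p ∧
      ∑ k ∈ A, w k + ∑ k ∈ R, w k ≤ W) : IsLeastPart c w n W p i R where
  subset := h.subset.trans (Finset.Ico_subset_Ico_left (Nat.le_succ i))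
  exists_rest := hA
  least S hS h1 h2 := (h.least S hS h1 h2).trans (binCode_filter_le i S)

/-- Item `i` is forced, as no completion avoids it. A competitor without `i` has a tail different
from `R`, since equal tails would give such a completion. Codes of tails from `i + 1` on are
multiples of `2 ^ (i + 1)`, so its code is larger by at least that much, more than the `2 ^ i` added
here. -/
theorem IsLeastPart.insert_item {c w : ℕ → ℕ} {n W p i : ℕ} {R : Finset ℕ} (hi : i < n)
    (h : IsLeastPart c w n W p (i + 1) R)
    (hA : ¬ ∃ A ⊆ Finset.range i, ∑ k ∈ A, c k + ∑ k ∈ R, c k = p ∧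
      ∑ k ∈ A, w k + ∑ k ∈ R, w k ≤ W) : IsLeastPart c w n W p i (insert i R) := by
  have hiR : i ∉ R := fun hn => by
    have := Finset.mem_Ico.1 (h.subset hn)
    omega
  refine ⟨Finset.insert_subset (Finset.mem_Ico.2 ⟨le_rfl, hi⟩)
    (h.subset.trans (Finset.Ico_subset_Ico_left (Nat.le_succ i))), ?_, ?_⟩
  · obtain ⟨A, hAr, h1, h2⟩ := h.exists_rest
    rw [Finset.range_add_one] at hAr
    by_cases hiA : i ∈ A
    · refine ⟨A.erase i, by rwa [← Finset.subset_insert_iff], ?_, ?_⟩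
      · rw [Finset.sum_insert hiR, ← add_assoc, Finset.sum_erase_add _ _ hiA, h1]
      · rwa [Finset.sum_insert hiR, ← add_assoc, Finset.sum_erase_add _ _ hiA]
    · exact absurd ⟨A, (Finset.subset_insert_iff_of_notMem hiA).1 hAr, h1, h2⟩ hA
  · intro S hS h1 h2
    have h3 := h.least S hS h1 h2
    have h4 : binCode (insert i R) = 2 ^ i + binCode R := Finset.sum_insert hiR
    by_cases hiS : i ∈ S
    · have h5 : S.filter (i ≤ ·) = insert i (S.filter (i + 1 ≤ ·)) := by
        ext k
        simp only [Finset.mem_filter, Finset.mem_insert]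
        constructor
        · rintro ⟨h, h'⟩
          rcases h'.eq_or_lt with rfl | h'
          · exact Or.inl rfl
          · exact Or.inr ⟨h, h'⟩
        · rintro (rfl | ⟨h, h'⟩)
          · exact ⟨hiS, le_rfl⟩
          · exact ⟨h, by omega⟩
      have h6 : binCode (S.filter (i ≤ ·)) = 2 ^ i + binCode (S.filter (i + 1 ≤ ·)) := by
        rw [h5]
        exact Finset.sum_insert (by simp)
      omega
    · rw [filter_le_eq_of_notMem hiS]
      have hne : binCode R ≠ binCode (S.filter (i + 1 ≤ ·)) := by
        intro heq
        have hR := binCode_injective heq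
        have hlt : S.filter (¬ i + 1 ≤ ·) ⊆ Finset.range i := by
          intro k hk
          obtain ⟨hk1, hk2⟩ := Finset.mem_filter.1 hk
          have : k ≠ i := by rintro rfl; exact hiS hk1
          exact Finset.mem_range.2 (by omega)
        refine hA ⟨_, hlt, ?_, ?_⟩
        · rw [hR, add_comm, Finset.sum_filter_add_sum_filter_not, h1]
        · rwa [hR, add_comm, Finset.sum_filter_add_sum_filter_not]
      obtain ⟨x, hx⟩ : 2 ^ (i + 1) ∣ binCode R :=
        two_pow_dvd_binCode fun k hk => (Finset.mem_Ico.1 (h.subset hk)).1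
      obtain ⟨y, hy⟩ : 2 ^ (i + 1) ∣ binCode (S.filter (i + 1 ≤ ·)) :=
        two_pow_dvd_binCode fun k hk => (Finset.mem_filter.1 hk).2
      have hxy : x < y := by
        have := lt_of_le_of_ne h3 hne
        rw [hx, hy] at this
        exact lt_of_mul_lt_mul_left this (Nat.zero_le _)
      have h7 := Nat.mul_le_mul_left (2 ^ (i + 1)) hxy
      have h8 : 2 ^ (i + 1) = 2 * 2 ^ i := by ring
      rw [Nat.succ_eq_add_one, mul_add, mul_one, ← hx, ← hy] at h7
      omega

/-! ### Scanning scales and profits in increasing order -/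

/-- `S₀`, seen at scale `j₀`, is the choice among the sets seen at a scale below `j`, or at scale
`j` with profit below `p`. -/
structure Leading (F : Finset ℕ → Prop) (v : ℕ → ℕ) (L j p j₀ : ℕ) (S₀ : Finset ℕ) : Prop where
  mem : F S₀
  before : j₀ = 0 ∧ S₀ = ∅ ∨ j₀ < j ∨ j₀ = j ∧ profit v L j S₀ < p
  best : ∀ j' S', F S' → (j' < j ∨ j' = j ∧ profit v L j' S' < p) →
    score v L j' S' < score v L j₀ S₀ ∨
    score v L j' S' = score v L j₀ S₀ ∧ (j₀ < j' ∨ j₀ = j' ∧ binCode S₀ ≤ binCode S')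

section Leading

variable {F : Finset ℕ → Prop} {v : ℕ → ℕ} {L j p j₀ : ℕ} {S₀ : Finset ℕ}

theorem leading_init (hF : F ∅) : Leading F v L 0 0 0 ∅ :=
  ⟨hF, Or.inl ⟨rfl, rfl⟩, by omega⟩

theorem Leading.before_succ (h : Leading F v L j p j₀ S₀) :
    j₀ = 0 ∧ S₀ = ∅ ∨ j₀ < j ∨ j₀ = j ∧ profit v L j S₀ < p + 1 :=
  h.before.imp_right (Or.imp_right fun h => ⟨h.1, by omega⟩)

theorem Leading.skip (h : Leading F v L j p j₀ S₀) (hp : ∀ S, F S → profit v L j S ≠ p) :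
    Leading F v L j (p + 1) j₀ S₀ :=
  ⟨h.mem, h.before_succ, fun j' S' hS' hlt => h.best j' S' hS' (by
    rcases hlt with hlt | ⟨rfl, hlt⟩
    · exact Or.inl hlt
    · have := hp S' hS'
      omega)⟩

/-- A tie goes to the incumbent because of `before`: it comes from an earlier scale, or is the
initial empty set, whose code is zero; at the same scale its profit would be below `p`, which
excludes a tie. -/
theorem Leading.keep (h : Leading F v L j p j₀ S₀) (hp : p * 2 ^ j ≤ score v L j₀ S₀) :
    Leading F v L j (p + 1) j₀ S₀ := by
  refine ⟨h.mem, h.before_succ, fun j' S' hS' hlt => ?_⟩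
  by_cases hlt' : j' < j ∨ j' = j ∧ profit v L j' S' < p
  · exact h.best j' S' hS' hlt'
  · obtain ⟨rfl, hpp⟩ : j' = j ∧ profit v L j' S' = p := by omega
    have hs : score v L j' S' = p * 2 ^ j' := by rw [score, hpp]
    rcases hp.lt_or_eq with hp | hp
    · exact Or.inl (hs ▸ hp)
    · refine Or.inr ⟨hs.trans hp, ?_⟩
      rcases h.before with ⟨rfl, rfl⟩ | hb | ⟨rfl, hb⟩
      · rcases Nat.eq_zero_or_pos j' with h0 | h0
        · exact Or.inr ⟨h0.symm, by simp [binCode]⟩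
        · exact Or.inl h0
      · exact Or.inl hb
      · rw [score] at hp
        have := Nat.eq_of_mul_eq_mul_right (by positivity) hp
        omega

/-- After a strict improvement only sets with profit `p` at scale `j` can tie, and among them the
code decides. -/
theorem Leading.replace (h : Leading F v L j p j₀ S₀) (hp : score v L j₀ S₀ < p * 2 ^ j)
    {S : Finset ℕ} (hS : F S) (hSp : profit v L j S = p)
    (hmin : ∀ S', F S' → profit v L j S' = p → binCode S ≤ binCode S') :
    Leading F v L j (p + 1) j S := by
  have hs : score v L j S = p * 2 ^ j := by rw [score, hSp]
  refine ⟨hS, Or.inr (Or.inr ⟨rfl, by omega⟩), fun j' S' hS' hlt => ?_⟩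
  by_cases hlt' : j' < j ∨ j' = j ∧ profit v L j' S' < p
  · have := h.best j' S' hS' hlt'
    omega
  · obtain ⟨rfl, hpp⟩ : j' = j ∧ profit v L j' S' = p := by omega
    exact Or.inr ⟨by rw [score, score, hpp, hSp], Or.inr ⟨rfl, hmin S' hS' hpp⟩⟩

theorem Leading.next (h : Leading F v L j p j₀ S₀) (hp : ∀ S, F S → profit v L j S < p) :
    Leading F v L (j + 1) 0 j₀ S₀ :=
  ⟨h.mem, by have := h.before; omega, fun j' S' hS' hlt => h.best j' S' hS' (by
    rcases Nat.lt_or_ge j' j with hj | hj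
    · exact Or.inl hj
    · obtain rfl : j' = j := by omega
      exact Or.inr ⟨rfl, hp S' hS'⟩)⟩

/-- The scales not visited have score zero, and the incumbent wins a tie at zero since its scale is
smaller; `1 ≤ j` ensures this for the initial empty set at scale `0`. -/
theorem Leading.isChoice (h : Leading F v L j 0 j₀ S₀) (hj : 1 ≤ j)
    (h0 : ∀ j' S, j ≤ j' → F S → score v L j' S = 0) : IsChoice F v L j₀ S₀ := by
  refine ⟨h.mem, fun j' S' hS' => ?_⟩
  rcases Nat.lt_or_ge j' j with hlt | hlt
  · exact h.best j' S' hS' (Or.inl hlt)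
  · have := h0 j' S' hlt hS'
    have := h.before
    omega

end Leading

theorem fits_isFamily (n : ℕ) (w : ℕ → ℕ) (W : ℕ) : IsFamily n (Fits n w W) :=
  ⟨⟨by simp, by simp⟩, fun _ h => h.1⟩

theorem chosen_congr {n : ℕ} {F : Finset ℕ → Prop} (hF : IsFamily n F) {v v' : ℕ → ℕ}
    (h : ∀ k < n, v k = v' k) (L : ℕ) : chosen F v L = chosen F v' L := by
  have hs : ∀ j S, F S → score v L j S = score v' L j S := fun j S hS => by
    unfold score profit
    congr 1
    refine Finset.sum_congr rfl fun k hk => ?_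
    rw [scaled, scaled, h k (Finset.mem_range.1 (hF.subset S hS hk))]
  obtain ⟨j, hj⟩ := hF.chosen_spec v' L
  refine IsChoice.chosen_eq (j := j) ⟨hj.mem, fun j' S' hS' => ?_⟩
  rw [hs j' S' hS', hs j _ hj.mem]
  exact hj.best j' S' hS'

/-- These are the facts that the final interval of a bisection certifies; by monotonicity they
determine the threshold. -/
theorem threshold_eq {n : ℕ} {F : Finset ℕ → Prop} (hF : IsFamily n F) {v : ℕ → ℕ} {L k x : ℕ}
    (hx : x ≤ v k) (h1 : k ∈ chosen F (Function.update v k (x + 1)) L)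
    (h0 : x = 0 ∨ k ∉ chosen F (Function.update v k x) L) : threshold F v L k = x := by
  classical
  apply le_antisymm
  · by_contra hlt
    refine IsFamily.threshold_notMem (F := F) (v := v) (L := L) (k := k) (by omega) ?_
    exact hF.chosen_update_mono (by omega) h1
  · rcases h0 with rfl | h0
    · exact Nat.zero_le _
    · exact Nat.le_findGreatest (P := fun x => k ∉ chosen F (Function.update v k x) L) hx h0

/-! ### Reasoning about loops -/

/-- An invariant rule whose step may also use the value of the counter and that all arrays not
written by the loop keep their contents. -/
theorem Cmd.run_loopTo {I : ℕ → ℕ} {x N : Arr} {p : Cmd} {s : Store} (inv : ℕ → Store → Prop)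
    (hx : p.writes x = false) (h0 : inv 0 (put s x 0 0))
    (hstep : ∀ i s', i < s N 0 → (∀ a, (loopTo x N p).writes a = false → s' a = s a) →
      s' x 0 = i → inv i s' → inv (i + 1) (put (p.run I s') x 0 (i + 1))) :
    inv (s N 0) ((loopTo x N p).run I s) := by
  have key : ∀ k ≤ s N 0,
      let s' := (fun s => put (p.run I s) x 0 (p.run I s x 0 + 1))^[k] (put s x 0 0)
      inv k s' ∧ s' x 0 = k ∧ ∀ a, (loopTo x N p).writes a = false → s' a = s a := by
    intro k
    induction k with
    | zero =>
      intro _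
      refine ⟨h0, by simp [put], fun a ha => ?_⟩
      simp only [writes, Bool.or_eq_false_iff, decide_eq_false_iff_not] at ha
      exact put_ne ha.1 _ _
    | succ k ih =>
      intro hk
      obtain ⟨h1, h2, h3⟩ := ih (by omega)
      simp only [Function.iterate_succ_apply']
      have h4 := hstep k _ hk h3 h2 h1
      refine ⟨?_, ?_, fun a ha => ?_⟩
      · rw [p.run_frame I hx, h2]
        exact h4
      · rw [put_same, if_pos rfl, p.run_frame I hx, h2]
      · rw [← h3 a ha]
        simp only [writes, Bool.or_eq_false_iff, decide_eq_false_iff_not] at ha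
        rw [put_ne ha.1, p.run_frame I ha.2]
  exact (key _ le_rfl).1

theorem Cmd.run_loopHalf {I : ℕ → ℕ} {x : Arr} {e : Ex} {p : Cmd} {s : Store}
    (inv : ℕ → Store → Prop) (h0 : inv (e.eval I s).size (put s x 0 (e.eval I s)))
    (hstep : ∀ k s', (∀ a, (loopHalf x e p).writes a = false → s' a = s a) →
      inv (k + 1) s' → inv k (put (p.run I s') x 0 (p.run I s' x 0 / 2))) :
    inv 0 ((loopHalf x e p).run I s) := by
  have hf0 : ∀ a, (loopHalf x e p).writes a = false → put s x 0 (e.eval I s) a = s a := by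
    intro a ha
    simp only [writes, Bool.or_eq_false_iff, decide_eq_false_iff_not] at ha
    exact put_ne ha.1 _ _
  simp only [run]
  generalize (e.eval I s).size = k at h0
  generalize put s x 0 (e.eval I s) = s₀ at h0 hf0
  induction k generalizing s₀ with
  | zero => exact h0
  | succ k ih =>
    rw [Function.iterate_succ_apply]
    refine ih _ (hstep k s₀ hf0 h0) fun a ha => ?_
    rw [← hf0 a ha]
    simp only [writes, Bool.or_eq_false_iff, decide_eq_false_iff_not] at ha
    rw [put_ne ha.1, p.run_frame I ha.2]


/-! ### The program for the choice rule -/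

instance : Add Ex := ⟨Ex.add⟩
instance : Sub Ex := ⟨Ex.sub⟩
instance : Mul Ex := ⟨Ex.mul⟩
instance : Div Ex := ⟨Ex.div⟩

namespace Ex

/-- The value of a scalar. -/
def var (a : Arr) : Ex := .get a (.lit 0)

/-- The minimum of two expressions. -/
def min (e f : Ex) : Ex := e - (e - f)

/-- Nonzero if and only if `e ≤ f`. -/
def le (e f : Ex) : Ex := f + .lit 1 - e

variable (I : ℕ → ℕ) (s : Store)

theorem eval_lit (n : ℕ) : (lit n).eval I s = n := rfl
theorem eval_inp (e : Ex) : (inp e).eval I s = I (e.eval I s) := rfl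
theorem eval_get (a : Arr) (e : Ex) : (get a e).eval I s = s a (e.eval I s) := rfl
theorem eval_var (a : Arr) : (var a).eval I s = s a 0 := rfl
theorem eval_add (e f : Ex) : (e + f).eval I s = e.eval I s + f.eval I s := rfl
theorem eval_sub (e f : Ex) : (e - f).eval I s = e.eval I s - f.eval I s := rfl
theorem eval_mul (e f : Ex) : (e * f).eval I s = e.eval I s * f.eval I s := rfl
theorem eval_div (e f : Ex) : (e / f).eval I s = e.eval I s / f.eval I s := rfl

theorem eval_min (e f : Ex) : (min e f).eval I s = Min.min (e.eval I s) (f.eval I s) := by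
  simp only [min, eval_sub]
  omega

theorem eval_le (e f : Ex) : (le e f).eval I s ≠ 0 ↔ e.eval I s ≤ f.eval I s := by
  simp only [le, eval_sub, eval_add, eval_lit]
  omega

end Ex

namespace Cmd

/-- Assignment to a scalar. -/
def assign (a : Arr) (e : Ex) : Cmd := .set a (.lit 0) e

variable (I : ℕ → ℕ) (s : Store)

theorem run_skip : skip.run I s = s := rfl

theorem run_set (a : Arr) (i e : Ex) :
    (set a i e).run I s = put s a (i.eval I s) (e.eval I s) := rfl

theorem run_assign (a : Arr) (e : Ex) : (assign a e).run I s = put s a 0 (e.eval I s) := rfl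

theorem run_seq (p q : Cmd) : (seq p q).run I s = q.run I (p.run I s) := rfl

theorem run_ite (c : Ex) (p q : Cmd) :
    (ite c p q).run I s = if c.eval I s ≠ 0 then p.run I s else q.run I s := rfl

end Cmd

open Cmd Ex

/-- The entry of the table in row `i` and column `p`. -/
def cell (i p : Ex) : Ex := i * var .top + p

/-- Compute the scaled values and the table of least weights. -/
def buildTable : Cmd :=
  seq (loopTo .p .top
    (ite (var .p) (set .tab (var .p) (var .cap + lit 1)) (set .tab (var .p) (lit 0))))
  (loopTo .q .num
    (seq (set .prf (var .q) (Ex.min (get .cur (var .q) / var .sc) (var .lev)))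
    (loopTo .p .top
      (ite (le (get .prf (var .q)) (var .p))
        (set .tab (cell (var .q + lit 1) (var .p))
          (Ex.min (get .tab (cell (var .q) (var .p)))
            (get .tab (cell (var .q) (var .p - get .prf (var .q))) + get .wt (var .q))))
        (set .tab (cell (var .q + lit 1) (var .p)) (get .tab (cell (var .q) (var .p))))))))

/-- The item considered in a round of the reconstruction. -/
def lastItem : Ex := var .num - lit 1 - var .r

/-- Find the set of least binary code with profit `p`. -/
def reconstruct : Cmd :=
  seq (assign .remP (var .p)) (seq (assign .remW (var .cap))
  (loopTo .r .num
    (ite (le (get .tab (cell lastItem (var .remP))) (var .remW))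
      (set .sel lastItem (lit 0))
      (seq (set .sel lastItem (lit 1))
      (seq (assign .remP (var .remP - get .prf lastItem))
        (assign .remW (var .remW - get .wt lastItem)))))))

/-- Update the best set with the sets seen at the present scale. -/
def scanProfits : Cmd :=
  seq (assign .ps (lit 0))
  (loopTo .p .top
    (seq (ite (le (get .tab (cell (var .num) (var .p))) (var .cap))
        (ite (le (var .ps) (var .best)) skip (seq (assign .best (var .ps)) reconstruct))
        skip)
    (assign .ps (var .ps + var .sc))))

/-- Compute the chosen set for the values `cur`. -/
def choose : Cmd :=
  seq (assign .best (lit 0)) (seq (assign .sc (lit 1))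
  (seq (loopTo .t .num (set .sel (var .t) (lit 0)))
  (loopTo .u .scales
    (seq buildTable (seq scanProfits (assign .sc (var .sc + var .sc)))))))

/-- Different rows of the table do not overlap, so filling a row preserves the earlier ones. -/
theorem cell_lt {i j p q T : ℕ} (hij : i < j) (hp : p < T) : i * T + p < j * T + q := by
  have := Nat.mul_le_mul_right T hij
  rw [Nat.succ_eq_add_one, add_one_mul] at this
  omega

section Choose

variable (I : ℕ → ℕ)

theorem run_buildTable (s : Store) :
    (∀ i < s .num 0, buildTable.run I s .prf i = min (s .cur i / s .sc 0) (s .lev 0)) ∧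
    ∀ i ≤ s .num 0, ∀ p < s .top 0, buildTable.run I s .tab (i * s .top 0 + p) =
      leastWeight (fun i => min (s .cur i / s .sc 0) (s .lev 0)) (s .wt) (s .cap 0) i p := by
  set c : ℕ → ℕ := fun i => min (s .cur i / s .sc 0) (s .lev 0) with hc
  rw [buildTable, run_seq]
  have hrow0 := run_loopTo (I := I) (x := .p) (N := .top) (s := s)
    (p := ite (var .p) (set .tab (var .p) (var .cap + lit 1)) (set .tab (var .p) (lit 0)))
    (fun k s' => ∀ p < k, s' .tab p = leastWeight c (s .wt) (s .cap 0) 0 p) rfl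
    (fun p hp => absurd hp (Nat.not_lt_zero p))
    (fun k s' hk hfr hx hinv p hp => by
      rw [put_ne (by decide), run_ite]
      have hcap := hfr .cap rfl
      have hval : ∀ y, put s' .tab k y .tab p = if p = k then y else s' .tab p := by
        simp [put]
      split_ifs with h0 <;>
        simp only [run_set, eval_var, eval_add, eval_lit, hx, hcap, hval] at h0 ⊢ <;>
        split_ifs with hpk
      · simp [leastWeight, hpk, h0]
      · exact hinv p (by omega)
      · simp [leastWeight, hpk, not_not.1 h0]
      · exact hinv p (by omega))
  have hfr0 := fun a => run_frame I (a := a) (s := s)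
    (p := loopTo .p .top
      (ite (var .p) (set .tab (var .p) (var .cap + lit 1)) (set .tab (var .p) (lit 0))))
  generalize (loopTo Arr.p Arr.top (ite (var .p) (set .tab (var .p) (var .cap + lit 1))
    (set .tab (var .p) (lit 0)))).run I s = s₀ at hrow0 hfr0
  have hnum := hfr0 .num rfl
  have htop := hfr0 .top rfl
  have hcap := hfr0 .cap rfl
  have hwt := hfr0 .wt rfl
  have hcur := hfr0 .cur rfl
  have hsc := hfr0 .sc rfl
  have hlev := hfr0 .lev rfl
  rw [← hnum]
  refine run_loopTo (I := I) (x := .q) (N := .num) (s := s₀)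
    (fun k s' => (∀ i < k, s' .prf i = c i) ∧ ∀ i ≤ k, ∀ p < s .top 0,
      s' .tab (i * s .top 0 + p) = leastWeight c (s .wt) (s .cap 0) i p) rfl ?_ ?_
  · refine ⟨fun i hi => absurd hi (Nat.not_lt_zero i), fun i hi p hp => ?_⟩
    obtain rfl : i = 0 := by omega
    rw [put_ne (by decide), zero_mul, zero_add]
    exact hrow0 p hp
  · rintro k s' hk hfr hx ⟨hprf, htab⟩
    rw [run_seq, run_set, eval_min]
    simp only [eval_div, eval_var, eval_get, hx, hfr .cur rfl, hcur, hfr .sc rfl, hsc,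
      hfr .lev rfl, hlev]
    set s₁ := put s' .prf k (min (s .cur k / s .sc 0) (s .lev 0)) with hs₁
    have hprf₁ : ∀ i < k + 1, s₁ .prf i = c i := by
      intro i hi
      rw [hs₁, put_same]
      split_ifs with hik
      · rw [hik]
      · exact hprf i (by omega)
    have htop₁ : s₁ .top 0 = s .top 0 := by
      rw [hs₁, put_ne (by decide), hfr .top rfl, htop]
    have hinner := run_loopTo (I := I) (x := .p) (N := .top) (s := s₁)
      (p := (ite (le (get .prf (var .q)) (var .p))
        (set .tab (cell (var .q + lit 1) (var .p))
          (Ex.min (get .tab (cell (var .q) (var .p)))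
            (get .tab (cell (var .q) (var .p - get .prf (var .q))) + get .wt (var .q))))
        (set .tab (cell (var .q + lit 1) (var .p)) (get .tab (cell (var .q) (var .p))))))
      (fun m s'' => (∀ i ≤ k, ∀ p < s .top 0,
        s'' .tab (i * s .top 0 + p) = leastWeight c (s .wt) (s .cap 0) i p) ∧
        ∀ p < m, s'' .tab ((k + 1) * s .top 0 + p) =
          leastWeight c (s .wt) (s .cap 0) (k + 1) p) rfl
      ⟨fun i hi p hp => by
        rw [put_ne (by decide), hs₁, put_ne (by decide)]
        exact htab i hi p hp, fun p hp => absurd hp (Nat.not_lt_zero p)⟩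
      (by
        rintro m s'' hm hfr' hx' ⟨h1, h2⟩
        rw [htop₁] at hm
        have hq : s'' .q 0 = k := by rw [hfr' .q rfl, hs₁, put_ne (by decide), hx]
        have hp : s'' .prf k = c k := by rw [hfr' .prf rfl, hprf₁ k (by omega)]
        have ht : s'' .top 0 = s .top 0 := by rw [hfr' .top rfl, htop₁]
        have hw : s'' .wt k = s .wt k := by
          rw [hfr' .wt rfl, hs₁, put_ne (by decide), hfr .wt rfl, hwt]
        have hval : (ite (le (get .prf (var .q)) (var .p))
            (set .tab (cell (var .q + lit 1) (var .p))
              (Ex.min (get .tab (cell (var .q) (var .p)))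
                (get .tab (cell (var .q) (var .p - get .prf (var .q))) + get .wt (var .q))))
            (set .tab (cell (var .q + lit 1) (var .p))
              (get .tab (cell (var .q) (var .p))))).run I s'' =
            put s'' .tab ((k + 1) * s .top 0 + m)
              (leastWeight c (s .wt) (s .cap 0) (k + 1) m) := by
          rw [run_ite]
          simp only [eval_le, run_set, eval_min, cell, eval_add, eval_sub, eval_mul, eval_lit,
            eval_get, eval_var, hq, hp, ht, hw, hx', leastWeight]
          split_ifs with hcm
          · rw [h1 k le_rfl m hm, h1 k le_rfl (m - c k) (by omega)]
          · rw [h1 k le_rfl m hm]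
        rw [hval]
        refine ⟨fun i hi p hp => ?_, fun p hp => ?_⟩
        · rw [put_ne (by decide), put_same, if_neg]
          · exact h1 i hi p hp
          · exact (cell_lt (by omega) hp).ne
        · rw [put_ne (by decide), put_same]
          split_ifs with hpm
          · rw [show p = m by omega]
          · exact h2 p (by omega))
    rw [htop₁] at hinner
    refine ⟨fun i hi => ?_, fun i hi p hp => ?_⟩
    · rw [put_ne (by decide), run_frame I (by rfl)]
      exact hprf₁ i hi
    · rw [put_ne (by decide)]
      rcases Nat.lt_or_ge k i with hik | hik
      · obtain rfl : i = k + 1 := by omega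
        exact hinner.2 p hp
      · exact hinner.1 i hik p hp

/-- Items are considered from the highest down and left out whenever the table shows that smaller
items can supply the remaining profit within the remaining weight. This greedy rule minimizes the
binary code by `IsLeastPart.keep` and `IsLeastPart.insert_item`. -/
theorem run_reconstruct (s : Store) (c : ℕ → ℕ)
    (hprf : ∀ i < s .num 0, s .prf i = c i)
    (htab : ∀ i ≤ s .num 0, ∀ p < s .top 0, s .tab (i * s .top 0 + p) =
      leastWeight c (s .wt) (s .cap 0) i p) (hp : s .p 0 < s .top 0)
    (hex : ∃ A ⊆ Finset.range (s .num 0), ∑ k ∈ A, c k = s .p 0 ∧ ∑ k ∈ A, s .wt k ≤ s .cap 0) :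
    ∃ S, Fits (s .num 0) (s .wt) (s .cap 0) S ∧ ∑ k ∈ S, c k = s .p 0 ∧
      (∀ S', Fits (s .num 0) (s .wt) (s .cap 0) S' → ∑ k ∈ S', c k = s .p 0 →
        binCode S ≤ binCode S') ∧
      ∀ k < s .num 0, reconstruct.run I s .sel k = if k ∈ S then 1 else 0 := by
  set n := s .num 0 with hn
  set w := s .wt with hw
  set W := s .cap 0 with hW
  -- After `k` rounds the items from `n - k` on are decided; the form `n - n` matches that invariant
  -- at the end of the loop.
  suffices h : ∃ S, IsLeastPart c w n W (s .p 0) (n - n) S ∧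
      (∀ k, n - n ≤ k → k < n → reconstruct.run I s .sel k = if k ∈ S then 1 else 0) by
    obtain ⟨S, h1, h2⟩ := h
    rw [Nat.sub_self] at h1 h2
    obtain ⟨A, hA, h3, h4⟩ := h1.exists_rest
    rw [Finset.range_zero, Finset.subset_empty] at hA
    subst hA
    rw [Finset.sum_empty, zero_add] at h3 h4
    refine ⟨S, ⟨by rw [Finset.range_eq_Ico]; exact h1.subset, h4⟩, h3, fun S' hS' h5 => ?_,
      fun k hk => h2 k (Nat.zero_le k) hk⟩
    have := h1.least S' hS'.1 h5 hS'.2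
    simpa using this
  rw [reconstruct, run_seq, run_seq, run_assign, run_assign]
  simp only [eval_var]
  rw [put_ne (show Arr.cap ≠ .remP by decide)]
  set s₁ := put (put s .remP 0 (s .p 0)) .remW 0 (s .cap 0) with hs₁
  have hfr₁ : ∀ a, a ≠ .remP → a ≠ .remW → s₁ a = s a := fun a h1 h2 => by
    rw [hs₁, put_ne h2, put_ne h1]
  have hnum₁ : s₁ .num 0 = n := by rw [hfr₁ _ (by decide) (by decide)]
  have key := run_loopTo (I := I) (x := .r) (N := .num) (s := s₁)
    (p := ite (le (get .tab (cell lastItem (var .remP))) (var .remW))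
      (set .sel lastItem (lit 0))
      (seq (set .sel lastItem (lit 1))
      (seq (assign .remP (var .remP - get .prf lastItem))
        (assign .remW (var .remW - get .wt lastItem)))))
    (fun k s' => ∃ S, IsLeastPart c w n W (s .p 0) (n - k) S ∧
      (∀ i, n - k ≤ i → i < n → s' .sel i = if i ∈ S then 1 else 0) ∧
      s' .remP 0 + ∑ i ∈ S, c i = s .p 0 ∧ s' .remW 0 + ∑ i ∈ S, w i = W) rfl ?_ ?_
  · rw [hnum₁] at key
    obtain ⟨S, h1, h2, -⟩ := key
    exact ⟨S, h1, h2⟩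
  · refine ⟨∅, ⟨by simp, ?_, by simp [binCode]⟩, fun i h1 h2 => by omega, ?_, ?_⟩
    · simpa using hex
    · simp [hs₁, put]
    · simp [hs₁, put, hW]
  · rintro k s' hk hfr hx ⟨S, hS, hsel, hremP, hremW⟩
    rw [hnum₁] at hk
    obtain ⟨i, hi⟩ : ∃ i, n - k = i + 1 := ⟨n - k - 1, by omega⟩
    have hi' : n - (k + 1) = i := by omega
    rw [hi] at hS hsel
    rw [hi']
    have hin : i < n := by omega
    have hitem : lastItem.eval I s' = i := by
      simp only [lastItem, eval_sub, eval_var, eval_lit, hx, hfr .num rfl, hnum₁]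
      omega
    have htop' : s' .top 0 = s .top 0 := by
      rw [hfr .top rfl, hfr₁ _ (by decide) (by decide)]
    have htab' : s' .tab = s .tab := by rw [hfr .tab rfl, hfr₁ _ (by decide) (by decide)]
    have hprf' : s' .prf i = c i := by
      rw [hfr .prf rfl, hfr₁ _ (by decide) (by decide), hprf i hin]
    have hwt' : s' .wt i = w i := by rw [hfr .wt rfl, hfr₁ _ (by decide) (by decide)]
    have hcond : (le (get .tab (cell lastItem (var .remP))) (var .remW)).eval I s' ≠ 0 ↔
        ∃ A ⊆ Finset.range i, ∑ k ∈ A, c k + ∑ k ∈ S, c k = s .p 0 ∧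
          ∑ k ∈ A, w k + ∑ k ∈ S, w k ≤ W := by
      rw [eval_le]
      simp only [eval_get, cell, eval_add, eval_mul, eval_var, hitem, htop', htab']
      rw [htab i hin.le _ (by omega), leastWeight_le_iff c w W i _ _ (by omega)]
      refine exists_congr fun A => and_congr_right fun _ => ?_
      omega
    rw [run_ite]
    split_ifs with h
    · refine ⟨S, hS.keep (hcond.1 h), fun j h1 h2 => ?_, ?_, ?_⟩
      · rw [run_set, put_ne (by decide), put_same, hitem]
        split_ifs with hji hjS hjS
        · have := Finset.mem_Ico.1 (hS.subset hjS)
          omega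
        · rfl
        · rw [hsel j (by omega) h2, if_pos hjS]
        · rw [hsel j (by omega) h2, if_neg hjS]
      · simpa [run_set, put] using hremP
      · simpa [run_set, put] using hremW
    · have hnot := mt hcond.2 h
      have hins := hS.insert_item hin hnot
      have hiS : i ∉ S := fun hn => by
        have := Finset.mem_Ico.1 (hS.subset hn)
        omega
      obtain ⟨A, hA, h1, h2⟩ := hins.exists_rest
      rw [Finset.sum_insert hiS] at h1 h2
      have hitem1 : lastItem.eval I (put s' .sel i 1) = i := by
        rw [← hitem]; simp [lastItem, put, eval_sub, eval_var, eval_lit]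
      have hitem2 : ∀ v, lastItem.eval I (put (put s' .sel i 1) .remP 0 v) = i := fun v => by
        rw [← hitem]; simp [lastItem, put, eval_sub, eval_var, eval_lit]
      simp only [run_seq, run_set, run_assign, hitem, hitem1, hitem2, eval_sub, eval_var, eval_get,
        eval_lit]
      refine ⟨insert i S, hins, fun j h3 h4 => ?_, ?_, ?_⟩
      · rw [put_ne (by decide), put_ne (by decide), put_ne (by decide), put_same]
        by_cases hji : j = i
        · simp [hji]
        · rw [if_neg hji, hsel j (by omega) h4]
          simp [hji]
      · rw [Finset.sum_insert hiS]
        simp [put, hprf']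
        omega
      · rw [Finset.sum_insert hiS]
        simp [put, hwt']
        omega

/-- The scalar `ps` is the score `p * 2 ^ j` of the current profit. The three branches of the
program are `Leading.keep`, `Leading.replace` and `Leading.skip`. -/
theorem run_scanProfits (s : Store) (v : ℕ → ℕ) (L j j₀ : ℕ) (S₀ : Finset ℕ)
    (hsc : s .sc 0 = 2 ^ j)
    (hprf : ∀ i < s .num 0, s .prf i = scaled v L j i)
    (htab : ∀ i ≤ s .num 0, ∀ p < s .top 0, s .tab (i * s .top 0 + p) =
      leastWeight (scaled v L j) (s .wt) (s .cap 0) i p)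
    (hlead : Leading (Fits (s .num 0) (s .wt) (s .cap 0)) v L j 0 j₀ S₀)
    (hbest : s .best 0 = score v L j₀ S₀)
    (hsel : ∀ k < s .num 0, s .sel k = if k ∈ S₀ then 1 else 0) :
    ∃ j₁ S₁, Leading (Fits (s .num 0) (s .wt) (s .cap 0)) v L j (s .top 0) j₁ S₁ ∧
      scanProfits.run I s .best 0 = score v L j₁ S₁ ∧
      ∀ k < s .num 0, scanProfits.run I s .sel k = if k ∈ S₁ then 1 else 0 := by
  rw [scanProfits, run_seq, run_assign, eval_lit]
  set s₁ := put s .ps 0 0 with hs₁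
  have hfr₁ : ∀ a, a ≠ .ps → s₁ a = s a := fun a h => put_ne h _ _
  have key := run_loopTo (I := I) (x := .p) (N := .top) (s := s₁)
    (p := (seq (ite (le (get .tab (cell (var .num) (var .p))) (var .cap))
        (ite (le (var .ps) (var .best)) skip (seq (assign .best (var .ps)) reconstruct))
        skip)
    (assign .ps (var .ps + var .sc))))
    (fun p s' => s' .ps 0 = p * 2 ^ j ∧
      ∃ j₁ S₁, Leading (Fits (s .num 0) (s .wt) (s .cap 0)) v L j p j₁ S₁ ∧
        s' .best 0 = score v L j₁ S₁ ∧ ∀ k < s .num 0, s' .sel k = if k ∈ S₁ then 1 else 0) rfl ?_ ?_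
  · rw [hfr₁ _ (by decide)] at key
    exact key.2
  · refine ⟨by simp [hs₁, put], j₀, S₀, hlead, ?_, fun k hk => ?_⟩
    · rw [put_ne (by decide), hfr₁ _ (by decide), hbest]
    · rw [put_ne (by decide), hfr₁ _ (by decide), hsel k hk]
  · rintro p s' hp hfr hx ⟨hps, j₁, S₁, hlead₁, hbest₁, hsel₁⟩
    rw [hfr₁ _ (by decide)] at hp
    have hnum' : s' .num 0 = s .num 0 := by rw [hfr .num rfl, hfr₁ _ (by decide)]
    have htop' : s' .top 0 = s .top 0 := by rw [hfr .top rfl, hfr₁ _ (by decide)]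
    have hcap' : s' .cap 0 = s .cap 0 := by rw [hfr .cap rfl, hfr₁ _ (by decide)]
    have hwt' : s' .wt = s .wt := by rw [hfr .wt rfl, hfr₁ _ (by decide)]
    have hprf' : s' .prf = s .prf := by rw [hfr .prf rfl, hfr₁ _ (by decide)]
    have htab' : s' .tab = s .tab := by rw [hfr .tab rfl, hfr₁ _ (by decide)]
    have hsc' : s' .sc 0 = 2 ^ j := by rw [hfr .sc rfl, hfr₁ _ (by decide), hsc]
    have hcond : (le (get .tab (cell (var .num) (var .p))) (var .cap)).eval I s' ≠ 0 ↔
        ∃ A ⊆ Finset.range (s .num 0), ∑ k ∈ A, scaled v L j k = p ∧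
          ∑ k ∈ A, s .wt k ≤ s .cap 0 := by
      rw [eval_le]
      simp only [eval_get, cell, eval_add, eval_mul, eval_var, hx, hnum', htop', htab', hcap']
      rw [htab _ le_rfl _ hp, leastWeight_le_iff _ _ _ _ _ _ le_rfl]
    rw [run_seq, run_assign, run_ite, run_ite]
    simp only [eval_add, eval_var]
    have hps_succ : ∀ s'' : Store, s'' .ps = s' .ps → s'' .sc = s' .sc →
        put (put s'' .ps 0 (s'' .ps 0 + s'' .sc 0)) .p 0 (p + 1) .ps 0 = (p + 1) * 2 ^ j := by
      intro s'' h1 h2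
      rw [put_ne (by decide), put_same, if_pos rfl, h1, h2, hps, hsc']
      ring
    split_ifs with h1 h2
    · refine ⟨hps_succ s' rfl rfl, j₁, S₁, hlead₁.keep ?_, ?_, fun k hk => ?_⟩
      · rw [eval_le] at h2
        simp only [eval_var] at h2
        omega
      · rw [put_ne (by decide), put_ne (by decide), run_skip, hbest₁]
      · rw [put_ne (by decide), put_ne (by decide), run_skip, hsel₁ k hk]
    · have hlt : score v L j₁ S₁ < p * 2 ^ j := by
        rw [eval_le, not_le] at h2
        simpa only [eval_var, hps, hbest₁] using h2
      rw [run_seq, run_assign, eval_var]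
      set s₂ := put s' .best 0 (s' .ps 0) with hs₂
      have hfr₂ : ∀ a, a ≠ .best → s₂ a = s' a := fun a h => put_ne h _ _
      have hnum₂ : s₂ .num 0 = s .num 0 := by rw [hfr₂ _ (by decide), hnum']
      have htop₂ : s₂ .top 0 = s .top 0 := by rw [hfr₂ _ (by decide), htop']
      have hcap₂ : s₂ .cap 0 = s .cap 0 := by rw [hfr₂ _ (by decide), hcap']
      have hwt₂ : s₂ .wt = s .wt := by rw [hfr₂ _ (by decide), hwt']
      have hprf₂ : s₂ .prf = s .prf := by rw [hfr₂ _ (by decide), hprf']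
      have htab₂ : s₂ .tab = s .tab := by rw [hfr₂ _ (by decide), htab']
      have hp₂ : s₂ .p 0 = p := by rw [hfr₂ _ (by decide), hx]
      have hrec := run_reconstruct I s₂ (scaled v L j)
        (by rw [hnum₂, hprf₂]; exact hprf)
        (by rw [hnum₂, htop₂, htab₂, hwt₂, hcap₂]; exact htab)
        (by rw [hp₂, htop₂]; exact hp)
        (by rw [hnum₂, hp₂, hwt₂, hcap₂]; exact hcond.1 h1)
      rw [hnum₂, hp₂, hwt₂, hcap₂] at hrec
      obtain ⟨S, hS, hSp, hmin, hsel₂⟩ := hrec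
      refine ⟨hps_succ _ ?_ ?_, j, S, hlead₁.replace hlt hS hSp hmin, ?_, fun k hk => ?_⟩
      · rw [run_frame I (by rfl), hfr₂ _ (by decide)]
      · rw [run_frame I (by rfl), hfr₂ _ (by decide)]
      · rw [put_ne (by decide), put_ne (by decide), run_frame I (by rfl), hs₂, put_same,
          if_pos rfl, hps, score, profit, hSp]
      · rw [put_ne (by decide), put_ne (by decide), hsel₂ k hk]
    · refine ⟨hps_succ s' rfl rfl, j₁, S₁, hlead₁.skip fun S hS hSp => h1 ?_, ?_, fun k hk => ?_⟩
      · exact hcond.2 ⟨S, hS.1, hSp, hS.2⟩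
      · rw [put_ne (by decide), put_ne (by decide), run_skip, hbest₁]
      · rw [put_ne (by decide), put_ne (by decide), run_skip, hsel₁ k hk]

/-- Hence a table with `L * n + 1` columns covers every attainable profit, which lets the scan pass
to the next scale. -/
theorem profit_le {n : ℕ} (v : ℕ → ℕ) (L j : ℕ) {S : Finset ℕ} (hS : S ⊆ Finset.range n) :
    profit v L j S ≤ L * n := by
  have h1 : profit v L j S ≤ S.card • L := Finset.sum_le_card_nsmul S _ L fun k _ => min_le_right _ _
  have h2 : S.card ≤ n := by simpa using Finset.card_le_card hS
  rw [smul_eq_mul, mul_comm] at h1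
  exact h1.trans (Nat.mul_le_mul_left L h2)

/-- By `hcur` all values vanish from scale `scales` on, so finitely many scales decide the choice.
-/
theorem run_choose (s : Store) (htop : s .top 0 = s .lev 0 * s .num 0 + 1)
    (hscales : 1 ≤ s .scales 0) (hcur : ∀ k < s .num 0, s .cur k < 2 ^ s .scales 0) :
    ∀ k < s .num 0, choose.run I s .sel k =
      if k ∈ chosen (Fits (s .num 0) (s .wt) (s .cap 0)) (s .cur) (s .lev 0) then 1 else 0 := by
  set F := Fits (s .num 0) (s .wt) (s .cap 0) with hF
  rw [choose, run_seq, run_seq, run_seq, run_assign, run_assign, eval_lit, eval_lit]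
  set s₁ := put (put s .best 0 0) .sc 0 1 with hs₁
  have hfr₁ : ∀ a, a ≠ .best → a ≠ .sc → s₁ a = s a := fun a h1 h2 => by
    rw [hs₁, put_ne h2, put_ne h1]
  have hnum₁ : s₁ .num 0 = s .num 0 := by rw [hfr₁ _ (by decide) (by decide)]
  have hzero := run_loopTo (I := I) (x := .t) (N := .num) (s := s₁)
    (p := set .sel (var .t) (lit 0)) (fun k s' => ∀ i < k, s' .sel i = 0) rfl
    (fun i hi => absurd hi (Nat.not_lt_zero i))
    (fun k s' _ _ hx hinv i hi => by
      rw [put_ne (by decide), run_set, put_same, eval_var, hx, eval_lit]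
      split_ifs with hik
      · rfl
      · exact hinv i (by omega))
  rw [hnum₁] at hzero
  have hfr₂ := fun a => run_frame I (a := a) (s := s₁) (p := loopTo .t .num (set .sel (var .t) (lit 0)))
  generalize (loopTo Arr.t Arr.num (set .sel (var .t) (lit 0))).run I s₁ = s₂ at hzero hfr₂
  have hscales₂ : s₂ .scales 0 = s .scales 0 := by
    rw [hfr₂ _ rfl, hfr₁ _ (by decide) (by decide)]
  have key := run_loopTo (I := I) (x := .u) (N := .scales) (s := s₂)
    (p := seq buildTable (seq scanProfits (assign .sc (var .sc + var .sc))))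
    (fun j s' => s' .sc 0 = 2 ^ j ∧ ∃ j₁ S₁, Leading F (s .cur) (s .lev 0) j 0 j₁ S₁ ∧
      s' .best 0 = score (s .cur) (s .lev 0) j₁ S₁ ∧
      ∀ k < s .num 0, s' .sel k = if k ∈ S₁ then 1 else 0) rfl ?_ ?_
  · rw [hscales₂] at key
    obtain ⟨-, j₁, S₁, hlead, -, hsel⟩ := key
    have hch : IsChoice F (s .cur) (s .lev 0) j₁ S₁ := by
      refine hlead.isChoice hscales fun j' S hj' hS => ?_
      rw [score, profit, Finset.sum_eq_zero, zero_mul]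
      intro k hk
      have h1 := hcur k (Finset.mem_range.1 (hS.1 hk))
      rw [scaled, Nat.div_eq_of_lt (h1.trans_le (Nat.pow_le_pow_right two_pos hj')), Nat.zero_min]
    rw [hch.chosen_eq]
    exact hsel
  · refine ⟨?_, 0, ∅, leading_init (fits_isFamily _ _ _).empty, ?_, fun k hk => ?_⟩
    · rw [put_ne (by decide), hfr₂ _ rfl, hs₁, put_same, if_pos rfl, pow_zero]
    · rw [put_ne (by decide), hfr₂ _ rfl, hs₁, put_ne (by decide), put_same, if_pos rfl]
      simp [score, profit]
    · rw [put_ne (by decide), hzero k hk]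
      simp
  · rintro j s' - hfr - ⟨hsc, j₁, S₁, hlead, hbest, hsel⟩
    have hcopy : ∀ a, (choose.writes a = false) → s' a = s a := fun a ha => by
      simp only [choose, assign, writes, Bool.or_eq_false_iff, decide_eq_false_iff_not] at ha
      rw [hfr a (by simp [writes, assign, ha]), hfr₂ a (by simp [writes, ha]), hfr₁ a ha.1 ha.2.1]
    rw [run_seq, run_seq, run_assign]
    obtain ⟨hprf, htab⟩ := run_buildTable I s'
    have hfr₃ := fun a => run_frame I (a := a) (s := s') (p := buildTable)
    generalize buildTable.run I s' = s₃ at hprf htab hfr₃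
    rw [hcopy .num rfl, hcopy .cur rfl, hcopy .lev rfl, hsc] at hprf
    rw [hcopy .num rfl, hcopy .cur rfl, hcopy .lev rfl, hcopy .top rfl, hcopy .wt rfl,
      hcopy .cap rfl, hsc] at htab
    have hnum₃ : s₃ .num = s .num := by rw [hfr₃ _ rfl, hcopy .num rfl]
    have htop₃ : s₃ .top = s .top := by rw [hfr₃ _ rfl, hcopy .top rfl]
    have hwt₃ : s₃ .wt = s .wt := by rw [hfr₃ _ rfl, hcopy .wt rfl]
    have hcap₃ : s₃ .cap = s .cap := by rw [hfr₃ _ rfl, hcopy .cap rfl]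
    have hsc₃ : s₃ .sc 0 = 2 ^ j := by rw [hfr₃ _ rfl, hsc]
    have hscan := run_scanProfits I s₃ (s .cur) (s .lev 0) j j₁ S₁ hsc₃
      (by rw [hnum₃]; exact hprf)
      (by rw [hnum₃, htop₃, hwt₃, hcap₃]; exact htab)
      (by rw [hnum₃, hwt₃, hcap₃]; exact hlead)
      (by rw [hfr₃ _ rfl]; exact hbest)
      (by rw [hnum₃, hfr₃ _ rfl]; exact hsel)
    rw [hnum₃, htop₃, hwt₃, hcap₃] at hscan
    obtain ⟨j₂, S₂, hlead₂, hbest₂, hsel₂⟩ := hscan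
    refine ⟨?_, j₂, S₂, hlead₂.next fun S hS => ?_, ?_, fun k hk => ?_⟩
    · rw [put_ne (by decide), put_same, if_pos rfl, eval_add, eval_var, run_frame I (by rfl), hsc₃]
      ring
    · have := profit_le (s .cur) (s .lev 0) j hS.1
      omega
    · rw [put_ne (by decide), put_ne (by decide), hbest₂]
    · rw [put_ne (by decide), put_ne (by decide), hsel₂ k hk]

end Choose


/-! ### The program for the payments -/

/-- Search for the threshold of item `z` by bisection. -/
def bisect : Cmd :=
  seq (assign .lo (lit 0)) (seq (assign .hi (get .val (var .z)))
  (loopHalf .y (get .val (var .z))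
    (ite (var .hi - var .lo - lit 1)
      (seq (assign .mid ((var .lo + var .hi) / lit 2))
      (seq (set .cur (var .z) (var .mid))
      (seq choose
        (ite (get .sel (var .z)) (assign .hi (var .mid)) (assign .lo (var .mid))))))
      skip)))

/-- Compute the payment of agent `z`. -/
def payOne : Cmd :=
  seq (set .pay (var .z) (lit 0))
  (ite (get .out (var .z))
    (ite (get .wt (var .z))
      (seq bisect (seq (set .pay (var .z) (var .lo)) (set .cur (var .z) (get .val (var .z)))))
      skip)
    skip)

/-- Compute the chosen set and all payments. -/
def payAll : Cmd :=
  seq (loopTo .z .num (set .cur (var .z) (get .val (var .z))))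
  (seq choose
  (seq (loopTo .z .num (set .out (var .z) (get .sel (var .z))))
  (loopTo .z .num payOne)))

/-- The precomputed data are consistent. -/
structure Ready (s : Store) : Prop where
  top : s .top 0 = s .lev 0 * s .num 0 + 1
  scales : 1 ≤ s .scales 0
  val_lt : ∀ k < s .num 0, s .val k < 2 ^ s .scales 0

/-- The family of sets that the program considers. -/
def storeFamily (s : Store) : Finset ℕ → Prop := Fits (s .num 0) (s .wt) (s .cap 0)

section Pay

variable (I : ℕ → ℕ)

theorem storeFamily_isFamily (s : Store) : IsFamily (s .num 0) (storeFamily s) :=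
  fits_isFamily _ _ _

/-- The bisection tries only values up to the reported ones, so the same number of scales serves all
calls. -/
theorem run_choose_of_ready {s s' : Store} (hs : Ready s)
    (hfr : ∀ a, payAll.writes a = false → s' a = s a) {v : ℕ → ℕ}
    (hv : ∀ i < s .num 0, s' .cur i = v i) (hlt : ∀ i < s .num 0, v i ≤ s .val i) :
    ∀ k < s .num 0, choose.run I s' .sel k =
      if k ∈ chosen (storeFamily s) v (s .lev 0) then 1 else 0 := by
  have h := run_choose I s' (by rw [hfr .top rfl, hfr .lev rfl, hfr .num rfl]; exact hs.top)
    (by rw [hfr .scales rfl]; exact hs.scales)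
    (by
      rw [hfr .num rfl, hfr .scales rfl]
      intro k hk
      rw [hv k hk]
      exact (hlt k hk).trans_lt (hs.val_lt k hk))
  rw [hfr .num rfl, hfr .wt rfl, hfr .cap rfl, hfr .lev rfl] at h
  rwa [chosen_congr (fits_isFamily _ _ _) (v' := v) (fun k hk => hv k hk)] at h

/-- With `r` rounds left, `k` is chosen with `hi`, not chosen with `lo` unless `lo = 0`, and `hi ≤
lo + 2 ^ r`. At the end `hi = lo + 1`, and `threshold_eq` identifies `lo`. -/
theorem run_bisect {s₀ s : Store} (hs : Ready s₀)
    (hfr : ∀ a, payAll.writes a = false → s a = s₀ a) {k : ℕ} (hz : s .z 0 = k)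
    (hk : k < s₀ .num 0) (hpos : 0 < s₀ .val k)
    (hcur : ∀ i < s₀ .num 0, s .cur i = s₀ .val i)
    (hch : k ∈ chosen (storeFamily s₀) (s₀ .val) (s₀ .lev 0)) :
    bisect.run I s .lo 0 = threshold (storeFamily s₀) (s₀ .val) (s₀ .lev 0) k ∧
      ∀ i < s₀ .num 0, i ≠ k → bisect.run I s .cur i = s₀ .val i := by
  rw [bisect, run_seq, run_seq, run_assign, run_assign, eval_lit, eval_get, eval_var]
  rw [put_ne (show Arr.z ≠ .lo by decide), put_ne (show Arr.val ≠ .lo by decide), hz,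
    hfr .val rfl]
  set s₁ := put (put s .lo 0 0) .hi 0 (s₀ .val k) with hs₁
  have hfr₁ : ∀ a, a ≠ .lo → a ≠ .hi → s₁ a = s a := fun a h1 h2 => by
    rw [hs₁, put_ne h2, put_ne h1]
  have hlo₁ : s₁ .lo 0 = 0 := by rw [hs₁, put_ne (by decide), put_same, if_pos rfl]
  have hhi₁ : s₁ .hi 0 = s₀ .val k := by rw [hs₁, put_same, if_pos rfl]
  have hz₁ : s₁ .z 0 = k := by rw [hfr₁ _ (by decide) (by decide), hz]
  have key := run_loopHalf (I := I) (x := .y) (e := get .val (var .z)) (s := s₁)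
    (p := ite (var .hi - var .lo - lit 1)
      (seq (assign .mid ((var .lo + var .hi) / lit 2))
      (seq (set .cur (var .z) (var .mid))
      (seq choose
        (ite (get .sel (var .z)) (assign .hi (var .mid)) (assign .lo (var .mid))))))
      skip)
    (fun r s' => s' .lo 0 < s' .hi 0 ∧ s' .hi 0 ≤ s₀ .val k ∧ s' .hi 0 ≤ s' .lo 0 + 2 ^ r ∧
      k ∈ chosen (storeFamily s₀) (Function.update (s₀ .val) k (s' .hi 0)) (s₀ .lev 0) ∧
      (s' .lo 0 = 0 ∨
        k ∉ chosen (storeFamily s₀) (Function.update (s₀ .val) k (s' .lo 0)) (s₀ .lev 0)) ∧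
      ∀ i < s₀ .num 0, i ≠ k → s' .cur i = s₀ .val i) ?_ ?_
  · obtain ⟨h1, h2, h3, h4, h5, h6⟩ := key
    refine ⟨(threshold_eq (storeFamily_isFamily s₀) (by omega) ?_ h5).symm, h6⟩
    rwa [← show _ = _ + 1 from le_antisymm (by simpa using h3) h1]
  · rw [put_ne (show Arr.lo ≠ .y by decide), put_ne (show Arr.hi ≠ .y by decide),
      put_ne (show Arr.cur ≠ .y by decide), hlo₁, hhi₁, eval_get, eval_var, hz₁,
      hfr₁ .val (by decide) (by decide), hfr₁ .cur (by decide) (by decide), hfr .val rfl]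
    refine ⟨hpos, le_rfl, ?_, ?_, Or.inl rfl, fun i hi _ => hcur i hi⟩
    · rw [zero_add]
      exact (Nat.lt_size_self _).le
    · rwa [Function.update_eq_self]
  · rintro r s' hfr' ⟨h1, h2, h3, h4, h5, h6⟩
    simp only [put_ne (show Arr.lo ≠ .y by decide), put_ne (show Arr.hi ≠ .y by decide),
      put_ne (show Arr.cur ≠ .y by decide)]
    have hpow : 2 ^ (r + 1) = 2 * 2 ^ r := by ring
    have hr : 1 ≤ 2 ^ r := Nat.one_le_two_pow
    rw [run_ite]
    split_ifs with hc
    · rw [run_seq, run_seq, run_seq, run_assign, run_set]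
      simp only [eval_sub, eval_add, eval_div, eval_var, eval_lit] at hc ⊢
      have hz' : s' .z 0 = k := by rw [hfr' .z rfl, hz₁]
      set mid := (s' .lo 0 + s' .hi 0) / 2 with hmid
      rw [put_ne (show Arr.z ≠ .mid by decide), hz', put_same, if_pos rfl]
      set s₂ := put (put s' .mid 0 mid) .cur k mid with hs₂
      have hfr₂ : ∀ a, a ≠ .mid → a ≠ .cur → s₂ a = s' a := fun a h1 h2 => by
        rw [hs₂, put_ne h2, put_ne h1]
      have hsel := run_choose_of_ready I hs (s' := s₂) (fun a ha => by
          have ha' : (a ≠ .mid ∧ a ≠ .cur ∧ a ≠ .lo ∧ a ≠ .hi) ∧ (loopHalf .y (get .val (var .z))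
              (ite (var .hi - var .lo - lit 1)
                (seq (assign .mid ((var .lo + var .hi) / lit 2))
                (seq (set .cur (var .z) (var .mid))
                (seq choose
                  (ite (get .sel (var .z)) (assign .hi (var .mid)) (assign .lo (var .mid))))))
                skip)).writes a = false := by
            simp only [payAll, payOne, bisect, assign, writes, Bool.or_eq_false_iff,
              decide_eq_false_iff_not] at ha ⊢
            tauto
          rw [hfr₂ a ha'.1.1 ha'.1.2.1, hfr' a ha'.2, hfr₁ a ha'.1.2.2.1 ha'.1.2.2.2, hfr a ha])
        (v := Function.update (s₀ .val) k mid)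
        (fun i hi => by
          rw [hs₂, put_same]
          by_cases hik : i = k
          · rw [if_pos hik, hik, Function.update_self]
          · rw [if_neg hik, Function.update_of_ne hik, put_ne (by decide), h6 i hi hik])
        (fun i hi => by
          by_cases hik : i = k
          · rw [hik, Function.update_self]
            omega
          · rw [Function.update_of_ne hik])
        k hk
      have hfr₃ := fun a => run_frame I (a := a) (s := s₂) (p := choose)
      generalize choose.run I s₂ = s₃ at hsel hfr₃
      have hz₃ : s₃ .z 0 = k := by rw [hfr₃ _ rfl, hfr₂ _ (by decide) (by decide), hz']
      have hmid₃ : s₃ .mid 0 = mid := by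
        rw [hfr₃ _ rfl, hs₂, put_ne (by decide), put_same, if_pos rfl]
      have hlo₃ : s₃ .lo 0 = s' .lo 0 := by rw [hfr₃ _ rfl, hfr₂ _ (by decide) (by decide)]
      have hhi₃ : s₃ .hi 0 = s' .hi 0 := by rw [hfr₃ _ rfl, hfr₂ _ (by decide) (by decide)]
      have hcur₃ : ∀ i < s₀ .num 0, i ≠ k → s₃ .cur i = s₀ .val i := fun i hi hik => by
        rw [hfr₃ _ rfl, hs₂, put_same, if_neg hik, put_ne (by decide), h6 i hi hik]
      rw [run_ite, eval_get, eval_var, hz₃, hsel]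
      by_cases hin : k ∈ chosen (storeFamily s₀) (Function.update (s₀ .val) k mid) (s₀ .lev 0)
      · rw [if_pos hin, if_pos one_ne_zero, run_assign, eval_var, hmid₃]
        simp only [put_same, if_true, put_ne (show Arr.lo ≠ .hi by decide),
          put_ne (show Arr.cur ≠ .hi by decide), hlo₃]
        exact ⟨by omega, by omega, by omega, hin, h5, hcur₃⟩
      · rw [if_neg hin, if_neg (not_not.2 rfl), run_assign, eval_var, hmid₃]
        simp only [put_same, if_true, put_ne (show Arr.hi ≠ .lo by decide),
          put_ne (show Arr.cur ≠ .lo by decide), hhi₃]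
        exact ⟨by omega, by omega, by omega, h4, Or.inr hin, hcur₃⟩
    · simp only [eval_sub, eval_var, eval_lit] at hc
      rw [run_skip]
      exact ⟨h1, h2, by omega, h4, h5, h6⟩

theorem run_payOne {s₀ s : Store} (hs : Ready s₀)
    (hfr : ∀ a, payAll.writes a = false → s a = s₀ a) {k : ℕ} (hz : s .z 0 = k)
    (hk : k < s₀ .num 0) (hpos : 0 < s₀ .val k)
    (hcur : ∀ i < s₀ .num 0, s .cur i = s₀ .val i)
    (hout : s .out k = if k ∈ chosen (storeFamily s₀) (s₀ .val) (s₀ .lev 0) then 1 else 0) :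
    (payOne.run I s .pay k =
      if k ∈ chosen (storeFamily s₀) (s₀ .val) (s₀ .lev 0) ∧ s₀ .wt k ≠ 0 then
        threshold (storeFamily s₀) (s₀ .val) (s₀ .lev 0) k else 0) ∧
    (∀ i, i ≠ k → payOne.run I s .pay i = s .pay i) ∧
    ∀ i < s₀ .num 0, payOne.run I s .cur i = s₀ .val i := by
  rw [payOne, run_seq, run_set, eval_var, eval_lit, hz, run_ite, eval_get, eval_var,
    put_ne (show Arr.z ≠ .pay by decide), hz, put_ne (show Arr.out ≠ .pay by decide), hout]
  set s₁ := put s .pay k 0 with hs₁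
  have hfr₁ : ∀ a, a ≠ .pay → s₁ a = s a := fun a h => put_ne h _ _
  have hpay₁ : ∀ i, s₁ .pay i = if i = k then 0 else s .pay i := put_same _ _ _ _
  have hcur₁ : ∀ i < s₀ .num 0, s₁ .cur i = s₀ .val i := fun i hi => by
    rw [hfr₁ _ (by decide), hcur i hi]
  by_cases hch : k ∈ chosen (storeFamily s₀) (s₀ .val) (s₀ .lev 0)
  · rw [if_pos hch, if_pos one_ne_zero, run_ite, eval_get, eval_var, hfr₁ .z (by decide), hz,
      hfr₁ .wt (by decide), hfr .wt rfl]
    by_cases hwt : s₀ .wt k ≠ 0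
    · rw [if_pos hwt, if_pos ⟨hch, hwt⟩, run_seq, run_seq]
      obtain ⟨h1, h2⟩ := run_bisect I hs (s := s₁) (fun a ha => by
          rw [hfr₁ a (by rintro rfl; exact absurd ha (by decide)), hfr a ha])
        (by rw [hfr₁ _ (by decide), hz]) hk hpos hcur₁ hch
      have hfr₂ := fun a => run_frame I (a := a) (s := s₁) (p := bisect)
      generalize bisect.run I s₁ = s₂ at h1 h2 hfr₂
      have hz₂ : s₂ .z 0 = k := by rw [hfr₂ _ rfl, hfr₁ _ (by decide), hz]
      have hval₂ : s₂ .val k = s₀ .val k := by rw [hfr₂ _ rfl, hfr₁ _ (by decide), hfr .val rfl]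
      rw [run_set, run_set]
      simp only [eval_var, eval_get, hz₂, h1, put_ne (show Arr.z ≠ .pay by decide),
        put_ne (show Arr.val ≠ .pay by decide), hval₂]
      refine ⟨?_, fun i hi => ?_, fun i hi => ?_⟩
      · rw [put_ne (by decide), put_same, if_pos rfl]
      · rw [put_ne (by decide), put_same, if_neg hi, hfr₂ _ rfl, hpay₁, if_neg hi]
      · rw [put_same]
        split_ifs with hik
        · rw [hik]
        · rw [put_ne (by decide), h2 i hi hik]
    · rw [if_neg hwt, if_neg (fun h => hwt h.2), run_skip]
      exact ⟨by rw [hpay₁, if_pos rfl], fun i hi => by rw [hpay₁, if_neg hi], hcur₁⟩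
  · rw [if_neg hch, if_neg (not_not.2 rfl), if_neg (fun h => hch h.1), run_skip]
    exact ⟨by rw [hpay₁, if_pos rfl], fun i hi => by rw [hpay₁, if_neg hi], hcur₁⟩

theorem run_payAll {s : Store} (hs : Ready s) (hpos : ∀ k < s .num 0, 0 < s .val k) :
    ∀ k < s .num 0,
      (payAll.run I s .out k =
        if k ∈ chosen (storeFamily s) (s .val) (s .lev 0) then 1 else 0) ∧
      payAll.run I s .pay k =
        if k ∈ chosen (storeFamily s) (s .val) (s .lev 0) ∧ s .wt k ≠ 0 then
          threshold (storeFamily s) (s .val) (s .lev 0) k else 0 := by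
  rw [payAll, run_seq, run_seq, run_seq]
  have hcur := run_loopTo (I := I) (x := .z) (N := .num) (s := s)
    (p := set .cur (var .z) (get .val (var .z))) (fun k s' => ∀ i < k, s' .cur i = s .val i) rfl
    (fun i hi => absurd hi (Nat.not_lt_zero i))
    (fun k s' _ hfr hx hinv i hi => by
      rw [put_ne (by decide), run_set, put_same, eval_get, eval_var, hx, hfr .val rfl]
      split_ifs with hik
      · rw [hik]
      · exact hinv i (by omega))
  have hfr₁ := fun a => run_frame I (a := a) (s := s)
    (p := loopTo .z .num (set .cur (var .z) (get .val (var .z))))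
  generalize (loopTo Arr.z Arr.num (set .cur (var .z) (get .val (var .z)))).run I s = s₁
    at hcur hfr₁
  have hw : ∀ a, payAll.writes a = false → a ≠ .z ∧ a ≠ .cur ∧ a ≠ .out ∧ a ≠ .pay ∧
      choose.writes a = false ∧ payOne.writes a = false := fun a ha => by
    simp only [payAll, payOne, bisect, assign, writes, Bool.or_eq_false_iff,
      decide_eq_false_iff_not] at ha ⊢
    tauto
  have hsel := run_choose_of_ready I hs (s' := s₁)
    (fun a ha => hfr₁ a (by simp [writes, hw a ha])) hcur (fun _ _ => le_rfl)
  have hfr₂ := fun a => run_frame I (a := a) (s := s₁) (p := choose)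
  generalize choose.run I s₁ = s₂ at hsel hfr₂
  have hnum₂ : s₂ .num 0 = s .num 0 := by rw [hfr₂ _ rfl, hfr₁ _ rfl]
  have hout := run_loopTo (I := I) (x := .z) (N := .num) (s := s₂)
    (p := set .out (var .z) (get .sel (var .z))) (fun k s' => ∀ i < k, s' .out i = s₂ .sel i) rfl
    (fun i hi => absurd hi (Nat.not_lt_zero i))
    (fun k s' _ hfr hx hinv i hi => by
      rw [put_ne (by decide), run_set, put_same, eval_get, eval_var, hx, hfr .sel rfl]
      split_ifs with hik
      · rw [hik]
      · exact hinv i (by omega))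
  rw [hnum₂] at hout
  have hfr₃ := fun a => run_frame I (a := a) (s := s₂)
    (p := loopTo .z .num (set .out (var .z) (get .sel (var .z))))
  generalize (loopTo Arr.z Arr.num (set .out (var .z) (get .sel (var .z)))).run I s₂ = s₃
    at hout hfr₃
  have hnum₃ : s₃ .num 0 = s .num 0 := by rw [hfr₃ _ rfl, hnum₂]
  have hout₃ : ∀ i < s .num 0, s₃ .out i =
      if i ∈ chosen (storeFamily s) (s .val) (s .lev 0) then 1 else 0 := fun i hi => by
    rw [hout i hi, hsel i hi]
  have hpay := run_loopTo (I := I) (x := .z) (N := .num) (s := s₃) (p := payOne)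
    (fun k s' => (∀ i < s .num 0, s' .cur i = s .val i) ∧ ∀ i < k, s' .pay i =
      if i ∈ chosen (storeFamily s) (s .val) (s .lev 0) ∧ s .wt i ≠ 0 then
        threshold (storeFamily s) (s .val) (s .lev 0) i else 0) rfl
    ⟨fun i hi => by
      rw [put_ne (by decide), hfr₃ _ rfl, hfr₂ _ rfl, hcur i hi],
      fun i hi => absurd hi (Nat.not_lt_zero i)⟩
    (fun k s' hk hfr hx ⟨h1, h2⟩ => by
      rw [hnum₃] at hk
      obtain ⟨h3, h4, h5⟩ := run_payOne I hs (s := s') (fun a ha => by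
          rw [hfr a (by simp [writes, hw a ha]), hfr₃ a (by simp [writes, hw a ha]),
            hfr₂ a (by simp [hw a ha]), hfr₁ a (by simp [writes, hw a ha])])
        hx hk (hpos k hk) h1 (by rw [hfr .out rfl, hout₃ k hk])
      refine ⟨fun i hi => ?_, fun i hi => ?_⟩
      · rw [put_ne (by decide), h5 i hi]
      · rw [put_ne (by decide)]
        by_cases hik : i = k
        · rw [hik, h3]
        · rw [h4 i hik, h2 i (by omega)])
  rw [hnum₃] at hpay
  intro k hk
  refine ⟨?_, hpay.2 k hk⟩
  rw [run_frame I (by rfl), hout₃ k hk]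

end Pay

/-! ### Reading the input -/

/-- Entry `c` of the description of agent `z` in the input. -/
def field (c : ℕ) : Ex := inp (lit 5 * var .z + lit c)

/-- Compute the common denominator, the scaled capacity and the bounds. -/
def readGlobal : Cmd :=
  seq (assign .den (inp (lit 3)))
  (seq (loopTo .z .num (assign .den (var .den * field 5 * field 7)))
  (seq (assign .cap (var .den / inp (lit 3) * inp (lit 2)))
  (seq (assign .lev (lit 2 * var .num * inp (lit 0)))
  (seq (assign .top (var .lev * var .num + lit 1))
    (assign .scales (lit 1))))))

/-- Read the value and the demand of agent `z`. -/
def readAgent : Cmd :=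
  seq (set .val (var .z) (field 8))
  (seq (loopHalf .y (field 8) (assign .scales (var .scales + lit 1)))
  (seq (assign .re (var .den / field 5 * field 4))
  (seq (assign .im (var .den / field 7 * field 6))
    (ite (le (var .re * var .re + var .im * var .im) (var .cap * var .cap))
      (set .wt (var .z) (Ex.min (var .re + var .im) (var .cap)))
      (set .wt (var .z) (var .cap + var .cap))))))

/-- Read the whole input. -/
def readInput : Cmd := seq readGlobal (loopTo .z .num readAgent)

/-- The common denominator of an input with `n` agents. -/
def commonDen (I : ℕ → ℕ) (n : ℕ) : ℕ :=
  I 3 * ∏ i ∈ Finset.range n, (I (5 * i + 5) * I (5 * i + 7))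

/-- The capacity in units of the common denominator. -/
def scaledCap (I : ℕ → ℕ) (n : ℕ) : ℕ := commonDen I n / I 3 * I 2

/-- The weight of agent `k` in units of the common denominator. -/
def scaledWeight (I : ℕ → ℕ) (n k : ℕ) : ℕ :=
  let re := commonDen I n / I (5 * k + 5) * I (5 * k + 4)
  let im := commonDen I n / I (5 * k + 7) * I (5 * k + 6)
  if re * re + im * im ≤ scaledCap I n * scaledCap I n then min (re + im) (scaledCap I n)
  else scaledCap I n + scaledCap I n

section Read

variable (I : ℕ → ℕ)

theorem eval_field {s : Store} {k : ℕ} (hz : s .z 0 = k) (c : ℕ) :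
    (field c).eval I s = I (5 * k + c) := by
  rw [field, eval_inp, eval_add, eval_mul, eval_var, hz, eval_lit, eval_lit]

theorem run_readGlobal (s : Store) :
    readGlobal.run I s .den 0 = commonDen I (s .num 0) ∧
    readGlobal.run I s .cap 0 = scaledCap I (s .num 0) ∧
    readGlobal.run I s .lev 0 = 2 * s .num 0 * I 0 ∧
    readGlobal.run I s .top 0 = 2 * s .num 0 * I 0 * s .num 0 + 1 ∧
    readGlobal.run I s .scales 0 = 1 := by
  rw [readGlobal, run_seq, run_seq, run_assign, eval_inp, eval_lit]
  set s₁ := put s .den 0 (I 3) with hs₁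
  have hnum₁ : s₁ .num 0 = s .num 0 := by rw [hs₁, put_ne (by decide)]
  have hden := run_loopTo (I := I) (x := .z) (N := .num) (s := s₁)
    (p := assign .den (var .den * field 5 * field 7)) (fun k s' => s' .den 0 = commonDen I k) rfl
    (by simp [hs₁, put, commonDen])
    (fun k s' _ _ hx hinv => by
      rw [put_ne (by decide), run_assign, put_same, if_pos rfl, eval_mul, eval_mul, eval_var,
        eval_field I hx, eval_field I hx, hinv, commonDen, commonDen, Finset.prod_range_succ]
      ring)
  rw [hnum₁] at hden
  have hnum₂ : (loopTo .z .num (assign .den (var .den * field 5 * field 7))).run I s₁ .num 0 =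
      s .num 0 := by rw [run_frame I (by rfl), hnum₁]
  generalize (loopTo Arr.z Arr.num (assign .den (var .den * field 5 * field 7))).run I s₁ = s₂
    at hden hnum₂
  simp [run_seq, run_assign, eval_div, eval_mul, eval_var, eval_inp, eval_lit, eval_add, put,
    hden, hnum₂, scaledCap]

theorem run_countBits (s : Store) (e : Ex) :
    (loopHalf .y e (assign .scales (var .scales + lit 1))).run I s .scales 0 =
      s .scales 0 + (e.eval I s).size := by
  have key := run_loopHalf (I := I) (x := .y) (e := e) (s := s)
    (p := assign .scales (var .scales + lit 1))
    (fun r s' => s' .scales 0 + r = s .scales 0 + (e.eval I s).size)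
    (by rw [put_ne (by decide)])
    (fun r s' _ h => by
      rw [put_ne (by decide), run_assign, put_same, if_pos rfl, eval_add, eval_var, eval_lit]
      omega)
  simpa using key

theorem run_readAgent {s : Store} {n k : ℕ} (hz : s .z 0 = k)
    (hden : s .den 0 = commonDen I n) (hcap : s .cap 0 = scaledCap I n) :
    readAgent.run I s .scales 0 = s .scales 0 + (I (5 * k + 8)).size ∧
    (∀ i, readAgent.run I s .val i = if i = k then I (5 * k + 8) else s .val i) ∧
    ∀ i, readAgent.run I s .wt i = if i = k then scaledWeight I n k else s .wt i := by
  rw [readAgent, run_seq, run_seq, run_set, eval_var, hz, eval_field I hz]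
  set s₁ := put s .val k (I (5 * k + 8)) with hs₁
  have hz₁ : s₁ .z 0 = k := by rw [hs₁, put_ne (by decide), hz]
  have hscales := run_countBits I s₁ (field 8)
  rw [eval_field I hz₁] at hscales
  have hfr := fun a => run_frame I (a := a) (s := s₁)
    (p := loopHalf .y (field 8) (assign .scales (var .scales + lit 1)))
  generalize (loopHalf .y (field 8) (assign .scales (var .scales + lit 1))).run I s₁ = s₂
    at hscales hfr
  have hz₂ : s₂ .z 0 = k := by rw [hfr _ rfl, hz₁]
  have hval₂ : ∀ i, s₂ .val i = if i = k then I (5 * k + 8) else s .val i := fun i => by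
    rw [hfr _ rfl, hs₁, put_same]
  have hwt₂ : s₂ .wt = s .wt := by rw [hfr _ rfl, hs₁, put_ne (by decide)]
  have hden₂ : s₂ .den 0 = commonDen I n := by rw [hfr _ rfl, hs₁, put_ne (by decide), hden]
  have hcap₂ : s₂ .cap 0 = scaledCap I n := by rw [hfr _ rfl, hs₁, put_ne (by decide), hcap]
  rw [hs₁, put_ne (by decide)] at hscales
  rw [run_seq, run_seq, run_assign, run_assign]
  simp only [eval_mul, eval_div, eval_var, eval_field I hz₂, hden₂]
  set re := commonDen I n / I (5 * k + 5) * I (5 * k + 4) with hre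
  set s₃ := put s₂ .re 0 re with hs₃
  have hz₃ : s₃ .z 0 = k := by rw [hs₃, put_ne (by decide), hz₂]
  have hden₃ : s₃ .den 0 = commonDen I n := by rw [hs₃, put_ne (by decide), hden₂]
  simp only [eval_field I hz₃, hden₃]
  set im := commonDen I n / I (5 * k + 7) * I (5 * k + 6) with him
  set s₄ := put s₃ .im 0 im with hs₄
  have hz₄ : s₄ .z 0 = k := by rw [hs₄, put_ne (by decide), hz₃]
  have hre₄ : s₄ .re 0 = re := by rw [hs₄, put_ne (by decide), hs₃, put_same, if_pos rfl]
  have him₄ : s₄ .im 0 = im := by rw [hs₄, put_same, if_pos rfl]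
  have hfr₄ : ∀ a, a ≠ .re → a ≠ .im → s₄ a = s₂ a := fun a h1 h2 => by
    rw [hs₄, put_ne h2, hs₃, put_ne h1]
  have hcap₄ : s₄ .cap 0 = scaledCap I n := by rw [hfr₄ _ (by decide) (by decide), hcap₂]
  have hset : (ite (le (var .re * var .re + var .im * var .im) (var .cap * var .cap))
      (set .wt (var .z) (Ex.min (var .re + var .im) (var .cap)))
      (set .wt (var .z) (var .cap + var .cap))).run I s₄ = put s₄ .wt k (scaledWeight I n k) := by
    rw [run_ite]
    simp only [eval_le, run_set, eval_min, eval_add, eval_mul, eval_var, hz₄, hre₄, him₄, hcap₄]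
    rw [scaledWeight, ← hre, ← him]
    split_ifs <;> rfl
  rw [hset]
  refine ⟨?_, fun i => ?_, fun i => ?_⟩
  · rw [put_ne (by decide), hfr₄ _ (by decide) (by decide), hscales]
  · rw [put_ne (by decide), hfr₄ _ (by decide) (by decide), hval₂]
  · rw [put_same, hfr₄ _ (by decide) (by decide), hwt₂]

theorem run_readInput (s : Store) :
    readInput.run I s .cap 0 = scaledCap I (s .num 0) ∧
    readInput.run I s .lev 0 = 2 * s .num 0 * I 0 ∧
    readInput.run I s .top 0 = 2 * s .num 0 * I 0 * s .num 0 + 1 ∧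
    readInput.run I s .scales 0 = 1 + ∑ i ∈ Finset.range (s .num 0), (I (5 * i + 8)).size ∧
    ∀ i < s .num 0, readInput.run I s .val i = I (5 * i + 8) ∧
      readInput.run I s .wt i = scaledWeight I (s .num 0) i := by
  rw [readInput, run_seq]
  obtain ⟨h1, h2, h3, h4, h5⟩ := run_readGlobal I s
  have hfr := fun a => run_frame I (a := a) (s := s) (p := readGlobal)
  generalize readGlobal.run I s = s₁ at h1 h2 h3 h4 h5 hfr
  have key := run_loopTo (I := I) (x := .z) (N := .num) (s := s₁) (p := readAgent)
    (fun k s' => s' .scales 0 = 1 + ∑ i ∈ Finset.range k, (I (5 * i + 8)).size ∧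
      ∀ i < k, s' .val i = I (5 * i + 8) ∧ s' .wt i = scaledWeight I (s .num 0) i) rfl
    ⟨by rw [put_ne (by decide), h5]; simp, fun i hi => absurd hi (Nat.not_lt_zero i)⟩
    (fun k s' _ hfr' hx ⟨h6, h7⟩ => by
      obtain ⟨h8, h9, h10⟩ := run_readAgent I (s := s') (n := s .num 0) hx
        (by rw [hfr' _ rfl, h1]) (by rw [hfr' _ rfl, h2])
      rw [put_ne (show Arr.scales ≠ .z by decide), put_ne (show Arr.val ≠ .z by decide),
        put_ne (show Arr.wt ≠ .z by decide), h8, h6, Finset.sum_range_succ]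
      refine ⟨by ring, fun i hi => ?_⟩
      rw [h9, h10]
      split_ifs with hik
      · rw [hik]
        exact ⟨rfl, rfl⟩
      · exact h7 i (by omega))
  rw [hfr .num rfl] at key
  refine ⟨?_, ?_, ?_, key.1, key.2⟩
  · rw [run_frame I (by rfl), h2]
  · rw [run_frame I (by rfl), h3]
  · rw [run_frame I (by rfl), h4]

/-- `scales` is one plus the sum of the bit lengths of all values: more than their maximum requires,
but still of the order of the input size. -/
theorem ready_readInput (s : Store) : Ready (readInput.run I s) := by
  obtain ⟨h1, h2, h3, h4, h5⟩ := run_readInput I s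
  have hnum : readInput.run I s .num 0 = s .num 0 := by rw [run_frame I (by rfl)]
  refine ⟨by rw [h3, h2, hnum], by omega, fun k hk => ?_⟩
  rw [hnum] at hk
  rw [(h5 k hk).1, h4]
  refine (Nat.lt_size_self _).trans_le (Nat.pow_le_pow_right two_pos ?_)
  have := Finset.single_le_sum (f := fun i => (I (5 * i + 8)).size) (fun _ _ => Nat.zero_le _)
    (Finset.mem_range.2 hk)
  omega

end Read

/-- The two stages are checked separately: the loop bounds `top` and `scales` are computed in the
first and are read-only in the second. -/
theorem readInput_wf : readInput.wf [.num] [.num] = true := by decide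

theorem payAll_wf : payAll.wf [.num, .lev, .top, .scales, .cap, .wt, .val]
    [.num, .top, .scales] = true := by decide


/-! ### Writing the output -/

/-- The counter of the output loop. -/
def outputCounter : RamExpr := .load (addrExpr .z (.lit 0))

/-- The body of the output loop. -/
def outputBody : RamProg :=
  .seq (.store (addrExpr .z (.lit 0)) (.sub outputCounter (.lit 1)))
  (.seq (.store (.mul (.lit 2) outputCounter) (.load (addrExpr .out outputCounter)))
  (.store (.add (.mul (.lit 2) outputCounter) (.lit 1)) (.load (addrExpr .pay outputCounter))))

/-- Copy the arrays `out` and `pay` to the output cells; the number of agents in cell `1`, which is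
needed to locate the arrays, is overwritten last. -/
def writeOutput : RamProg :=
  .seq (.store (addrExpr .z (.lit 0)) (.load (addrExpr .num (.lit 0))))
  (.seq (.loop (.sub outputCounter (.lit 1)) outputBody)
  (.seq (.store (.lit 0) (.load (addrExpr .out (.lit 0))))
    (.store (.lit 1) (.load (addrExpr .pay (.lit 0))))))

/-- The memory while the output is written; the agents from `k` on are done. -/
structure Writing (n : ℕ) (s : Store) (M k : ℕ) (σ : ℕ → ℕ) : Prop where
  one : σ 1 = n
  arrays : ∀ a, a ≠ .z → ∀ i, σ (5 * n + 4 + (31 * i + a.code)) = s a i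
  counter : σ (5 * n + 4 + (31 * 0 + Arr.z.code)) = k
  done : ∀ i, k ≤ i → i < n → σ (2 * i) = s .out i ∧ σ (2 * i + 1) = s .pay i
  size : ∀ i, (σ i).size ≤ M

theorem size_update_le {σ : ℕ → ℕ} {M : ℕ} (h : ∀ i, (σ i).size ≤ M) {j v : ℕ} (hv : v.size ≤ M)
    (i : ℕ) : (Function.update σ j v i).size ≤ M := by
  by_cases hij : i = j
  · rw [hij, Function.update_self]
    exact hv
  · rw [Function.update_of_ne hij]
    exact h i

theorem eval_addrExpr {σ : ℕ → ℕ} {n : ℕ} (h : σ 1 = n) (a : Arr) (e : RamExpr) :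
    (addrExpr a e).eval σ = 5 * n + 4 + (31 * e.eval σ + a.code) := by
  simp only [addrExpr, baseExpr, RamExpr.eval, h]

/-- A bound on the cost of a store instruction, in multiples of the bit length of the cells. -/
def storePrice (a e : RamExpr) : ℕ := a.price + e.price + (1 + a.width + e.width)

theorem exec_store {σ : ℕ → ℕ} {M : ℕ} (hM : 1 ≤ M) (h : ∀ i, (σ i).size ≤ M) {a e : RamExpr}
    {i v : ℕ} (ha : a.eval σ = i) (he : e.eval σ = v) :
    ∃ T, Exec (.store a e) σ (Function.update σ i v) T ∧ T ≤ storePrice a e * M := by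
  subst ha he
  refine ⟨_, Exec.store a e σ, ?_⟩
  have h1 := RamExpr.cost_le hM h a
  have h2 := RamExpr.cost_le hM h e
  have h3 := RamExpr.size_eval_le hM h a
  have h4 := RamExpr.size_eval_le hM h e
  simp only [storePrice, add_mul]
  omega

theorem Arr.addr_ne {n i j : ℕ} {a b : Arr} (h : a ≠ b) :
    5 * n + 4 + (31 * i + a.code) ≠ 5 * n + 4 + (31 * j + b.code) := fun heq => by
  have := a.code_lt
  have := b.code_lt
  exact h (Arr.code_injective (by omega))

/-- For `1 ≤ k` the cells `2 * k` and `2 * k + 1` avoid cell `1`, and for `k < n` they lie below `5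
* n + 4`, where the arrays begin. -/
theorem exec_outputBody : ∃ c, ∀ (n : ℕ) (s : Store) (M k : ℕ) (σ : ℕ → ℕ), 1 ≤ M → 1 ≤ k →
    k < n → Writing n s M (k + 1) σ →
    ∃ σ' T, Exec outputBody σ σ' T ∧ Writing n s M k σ' ∧ T ≤ c * M := by
  refine ⟨storePrice (addrExpr .z (.lit 0)) (.sub outputCounter (.lit 1)) +
    (storePrice (.mul (.lit 2) outputCounter) (.load (addrExpr .out outputCounter)) +
      storePrice (.add (.mul (.lit 2) outputCounter) (.lit 1))
        (.load (addrExpr .pay outputCounter))), fun n s M k σ hM hk hkn h => ?_⟩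
  have hctr : outputCounter.eval σ = k + 1 := by
    rw [outputCounter, RamExpr.eval, eval_addrExpr h.one]
    exact h.counter
  have hksize : k.size ≤ M := by
    have := h.size (5 * n + 4 + (31 * 0 + Arr.z.code))
    rw [h.counter] at this
    exact (Nat.size_le_size (Nat.le_succ k)).trans this
  obtain ⟨T₁, e₁, t₁⟩ := exec_store hM h.size (a := addrExpr .z (.lit 0))
    (e := .sub outputCounter (.lit 1)) (eval_addrExpr h.one _ _)
    (show _ = k by simp only [RamExpr.eval, hctr]; rfl)
  simp only [RamExpr.eval] at e₁
  set σ₁ := Function.update σ (5 * n + 4 + (31 * 0 + Arr.z.code)) k with hσ₁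
  have hone₁ : σ₁ 1 = n := by rw [hσ₁, Function.update_of_ne (by omega), h.one]
  have hsize₁ : ∀ i, (σ₁ i).size ≤ M := size_update_le h.size hksize
  have hctr₁ : outputCounter.eval σ₁ = k := by
    rw [outputCounter, RamExpr.eval, eval_addrExpr hone₁]
    exact Function.update_self _ _ _
  have harr₁ : ∀ a, a ≠ .z → ∀ i, σ₁ (5 * n + 4 + (31 * i + a.code)) = s a i := fun a ha i => by
    rw [hσ₁, Function.update_of_ne (Arr.addr_ne ha), h.arrays a ha]
  have hout : (s .out k).size ≤ M := by
    rw [← h.arrays .out (by decide) k]; exact h.size _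
  have hpay : (s .pay k).size ≤ M := by
    rw [← h.arrays .pay (by decide) k]; exact h.size _
  obtain ⟨T₂, e₂, t₂⟩ := exec_store hM hsize₁ (a := .mul (.lit 2) outputCounter)
    (e := .load (addrExpr .out outputCounter)) (i := 2 * k) (v := s .out k)
    (by simp only [RamExpr.eval, hctr₁])
    (by rw [RamExpr.eval, eval_addrExpr hone₁, hctr₁, harr₁ _ (by decide)])
  set σ₂ := Function.update σ₁ (2 * k) (s .out k) with hσ₂
  have hbig : ∀ a : Arr, ∀ i, σ₂ (5 * n + 4 + (31 * i + a.code)) =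
      σ₁ (5 * n + 4 + (31 * i + a.code)) := fun a i => by
    rw [hσ₂, Function.update_of_ne (by omega)]
  have hone₂ : σ₂ 1 = n := by rw [hσ₂, Function.update_of_ne (by omega), hone₁]
  have hsize₂ : ∀ i, (σ₂ i).size ≤ M := size_update_le hsize₁ hout
  have hctr₂ : outputCounter.eval σ₂ = k := by
    rw [outputCounter, RamExpr.eval, eval_addrExpr hone₂, hbig]
    exact Function.update_self _ _ _
  obtain ⟨T₃, e₃, t₃⟩ := exec_store hM hsize₂
    (a := .add (.mul (.lit 2) outputCounter) (.lit 1))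
    (e := .load (addrExpr .pay outputCounter)) (i := 2 * k + 1) (v := s .pay k)
    (by simp only [RamExpr.eval, hctr₂])
    (by rw [RamExpr.eval, eval_addrExpr hone₂, hctr₂, hbig, harr₁ _ (by decide)])
  refine ⟨_, _, .seq e₁ (.seq e₂ e₃), ⟨?_, ?_, ?_, ?_, size_update_le hsize₂ hpay⟩, ?_⟩
  · rw [Function.update_of_ne (by omega), hone₂]
  · intro a ha i
    rw [Function.update_of_ne (by omega), hbig, harr₁ a ha]
  · rw [Function.update_of_ne (by omega), hbig, hσ₁, Function.update_self]
  · intro i hi hin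
    rcases hi.eq_or_lt with rfl | hi
    · rw [Function.update_of_ne (by omega), Function.update_self, hσ₂, Function.update_self]
      exact ⟨rfl, rfl⟩
    · rw [Function.update_of_ne (by omega), Function.update_of_ne (by omega), hσ₂,
        Function.update_of_ne (by omega), Function.update_of_ne (by omega), hσ₁,
        Function.update_of_ne (by omega), Function.update_of_ne (by omega)]
      exact h.done i (by omega) hin
  · simp only [add_mul]
    omega

theorem exec_outputLoop : ∃ c, ∀ (n : ℕ) (s : Store) (M k : ℕ) (σ : ℕ → ℕ), 1 ≤ M →
    k ≤ n → Writing n s M k σ →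
    ∃ σ' T, Exec (.loop (.sub outputCounter (.lit 1)) outputBody) σ σ' T ∧
      Writing n s M (min k 1) σ' ∧ T ≤ c * (k + 1) * M := by
  obtain ⟨c, hc⟩ := exec_outputBody
  set g : RamExpr := .sub outputCounter (.lit 1) with hg
  refine ⟨c + g.price + 1, fun n s M k => ?_⟩
  have hval : ∀ k σ, Writing n s M k σ → g.eval σ = k - 1 := fun k σ h => by
    simp only [hg, RamExpr.eval, outputCounter]
    rw [eval_addrExpr h.one]
    exact congrArg (· - 1) h.counter
  have hK : (c + g.price + 1) * M = c * M + g.price * M + M := by ring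
  induction k with
  | zero =>
    intro σ hM _ h
    refine ⟨σ, _, .loopDone (hval 0 σ h), h, ?_⟩
    have := RamExpr.cost_le hM h.size g
    rw [zero_add, mul_one, hK]
    omega
  | succ k ih =>
    intro σ hM hk h
    have hcost := RamExpr.cost_le hM h.size g
    have hsucc : (c + g.price + 1) * (k + 1 + 1) * M =
        (c + g.price + 1) * (k + 1) * M + (c * M + g.price * M + M) := by ring
    rw [hsucc]
    rcases Nat.eq_zero_or_pos k with rfl | hk0
    · refine ⟨σ, _, .loopDone (hval 1 σ h), h, ?_⟩
      omega
    · obtain ⟨σ₁, T₁, e₁, h₁, t₁⟩ := hc n s M k σ hM hk0 hk h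
      obtain ⟨σ₂, T₂, e₂, h₂, t₂⟩ := ih σ₁ hM (by omega) h₁
      refine ⟨σ₂, _, .loopStep ?_ e₁ e₂, ?_, ?_⟩
      · have := hval _ _ h
        omega
      · rw [min_eq_right (by omega : 1 ≤ k)] at h₂
        rwa [min_eq_right (by omega)]
      · omega

theorem exec_writeOutput : ∃ c, ∀ (I : ℕ → ℕ) (σ : ℕ → ℕ) (s : Store) (M : ℕ), 1 ≤ M →
    Rep I σ s → s .num 0 = I 1 → (∀ i, (σ i).size ≤ M) →
    ∃ σ' T, Exec writeOutput σ σ' T ∧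
      (∀ i < I 1, σ' (2 * i) = s .out i ∧ σ' (2 * i + 1) = s .pay i) ∧
      T ≤ c * (I 1 + 1) * M := by
  obtain ⟨c, hc⟩ := exec_outputLoop
  refine ⟨storePrice (addrExpr .z (.lit 0)) (.load (addrExpr .num (.lit 0))) +
    (c + (storePrice (.lit 0) (.load (addrExpr .out (.lit 0))) +
      storePrice (.lit 1) (.load (addrExpr .pay (.lit 0))))),
    fun I σ s M hM hσ hn hsize => ?_⟩
  have hone : σ 1 = I 1 := hσ.input 1 (by omega)
  have hnum : (RamExpr.load (addrExpr .num (.lit 0))).eval σ = I 1 := by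
    rw [RamExpr.eval, eval_addrExpr hone, hσ.arrays]
    exact hn
  obtain ⟨T₁, e₁, t₁⟩ := exec_store hM hsize (a := addrExpr .z (.lit 0))
    (eval_addrExpr hone _ _) hnum
  simp only [RamExpr.eval] at e₁
  have hw : Writing (I 1) s M (I 1)
      (Function.update σ (5 * I 1 + 4 + (31 * 0 + Arr.z.code)) (I 1)) := by
    refine ⟨?_, fun a ha i => ?_, Function.update_self _ _ _, fun i h1 h2 => by omega,
      size_update_le hsize (hone ▸ hsize 1)⟩
    · rw [Function.update_of_ne (by omega), hone]
    · rw [Function.update_of_ne (Arr.addr_ne ha), hσ.arrays]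
  obtain ⟨σ₂, T₂, e₂, h₂, t₂⟩ := hc _ s M _ _ hM le_rfl hw
  have hout : (s .out 0).size ≤ M := by
    rw [← hσ.arrays .out 0]; exact hsize _
  -- Only agent `0` is left. Cell `0` comes first, since writing cell `1` destroys the base address.
  obtain ⟨T₃, e₃, t₃⟩ := exec_store hM h₂.size (a := .lit 0)
    (e := .load (addrExpr .out (.lit 0))) (i := 0) (v := s .out 0) rfl
    (by rw [RamExpr.eval, eval_addrExpr h₂.one, h₂.arrays _ (by decide)]; rfl)
  have hone₃ : Function.update σ₂ 0 (s .out 0) 1 = I 1 := by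
    rw [Function.update_of_ne one_ne_zero, h₂.one]
  obtain ⟨T₄, e₄, t₄⟩ := exec_store hM (size_update_le h₂.size hout) (a := .lit 1)
    (e := .load (addrExpr .pay (.lit 0))) (i := 1) (v := s .pay 0) rfl
    (by
      rw [RamExpr.eval, eval_addrExpr hone₃, Function.update_of_ne (by omega),
        h₂.arrays _ (by decide)]
      rfl)
  refine ⟨_, _, .seq e₁ (.seq e₂ (.seq e₃ e₄)), fun i hi => ?_, ?_⟩
  · rcases Nat.eq_zero_or_pos i with rfl | hi0
    · simp
    · rw [Function.update_of_ne (by omega), Function.update_of_ne (by omega),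
        Function.update_of_ne (by omega), Function.update_of_ne (by omega)]
      exact h₂.done i (by omega) hi
  · have h1 : ∀ x, x * M ≤ x * (I 1 + 1) * M := fun x => by
      rw [mul_assoc]
      exact Nat.mul_le_mul_left x (Nat.le_mul_of_pos_left M (Nat.succ_pos _))
    have h2 := t₁.trans (h1 _)
    have h3 := t₃.trans (h1 _)
    have h4 := t₄.trans (h1 _)
    simp only [add_mul (_ : ℕ) (_ : ℕ) (I 1 + 1), add_mul _ _ M]
    omega

/-! ### The encoding of rational inputs -/

theorem getD_flatMap_encode (l : List RatType) (k c : ℕ) (hk : k < l.length) (hc : c < 5) :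
    (l.flatMap RatType.encode).getD (5 * k + c) 0 = (l[k].encode).getD c 0 := by
  induction l generalizing k with
  | nil => simp at hk
  | cons q l ih =>
    rw [List.flatMap_cons]
    have hlen : q.encode.length = 5 := rfl
    cases k with
    | zero => rw [List.getD_append _ _ _ _ (by omega)]; simp
    | succ k =>
      rw [List.getD_append_right _ _ _ _ (by omega), hlen]
      have : 5 * (k + 1) + c - 5 = 5 * k + c := by omega
      rw [this, ih k (by simpa using hk)]
      simp

theorem length_flatMap_encode (l : List RatType) :
    (l.flatMap RatType.encode).length = 5 * l.length := by
  induction l with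
  | nil => rfl
  | cons q l ih =>
    rw [List.flatMap_cons, List.length_append, ih, List.length_cons]
    have : q.encode.length = 5 := rfl
    omega

section Input

variable {n : ℕ} (m : ℕ) (C : ℚ≥0) (t : Fin n → RatType)

/-- The initial memory with precision `m` and a rational input. -/
def inputMemory : ℕ → ℕ := initMemory (m :: encodeInput C t)

theorem inputMemory_field (k : Fin n) {c : ℕ} (hc : c < 5) :
    inputMemory m C t (5 * k + (c + 4)) = ((t k).encode).getD c 0 := by
  have h := getD_flatMap_encode (List.ofFn t) k c (by simp) hc
  rw [List.getElem_ofFn] at h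
  exact h

theorem inputMemory_eq_zero (i : ℕ) (hi : 5 * inputMemory m C t 1 + 4 ≤ i) :
    inputMemory m C t i = 0 := by
  have h1 : inputMemory m C t 1 = n := rfl
  rw [h1] at hi
  refine List.getD_eq_default _ _ ?_
  have := length_flatMap_encode (List.ofFn t)
  simp only [List.length_ofFn] at this
  simp only [encodeInput, List.length_cons, List.length_append, this, List.length_nil]
  omega

theorem size_le_bitSize {l : List ℕ} {a : ℕ} (h : a ∈ l) : a.size + 1 ≤ bitSize l :=
  List.single_le_sum (fun _ _ => Nat.zero_le _) _ (List.mem_map_of_mem h)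

theorem length_le_bitSize (l : List ℕ) : l.length ≤ bitSize l := by
  induction l with
  | nil => exact Nat.zero_le _
  | cons a l ih =>
    simp only [bitSize, List.map_cons, List.sum_cons, List.length_cons] at ih ⊢
    omega

theorem card_lt_bitSize : n < bitSize (encodeInput C t) := by
  refine lt_of_lt_of_le ?_ (length_le_bitSize _)
  have := length_flatMap_encode (List.ofFn t)
  simp only [List.length_ofFn] at this
  simp only [encodeInput, List.length_cons, List.length_append, this, List.length_nil]
  omega

/-- The precision `m` enters with its value, not its bit length, because the time is measured in `1
/ ε`; the sum on the right can then also bound loop counts. -/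
theorem size_inputMemory_le (i : ℕ) :
    (inputMemory m C t i).size ≤ bitSize (encodeInput C t) + m := by
  rw [inputMemory, initMemory]
  by_cases hi : i < (m :: encodeInput C t).length
  · rw [List.getD_eq_getElem _ _ hi]
    have h := List.getElem_mem hi
    rcases List.mem_cons.1 h with h | h
    · rw [h]
      exact (Nat.size_le.2 Nat.lt_two_pow_self).trans (Nat.le_add_left _ _)
    · have := size_le_bitSize h
      omega
  · rw [List.getD_eq_default _ _ (not_lt.1 hi)]
    simp

theorem commonDen_pos : 0 < commonDen (inputMemory m C t) n := by
  refine Nat.mul_pos C.den_pos (Finset.prod_pos fun i hi => ?_)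
  have hin := Finset.mem_range.1 hi
  have h5 := inputMemory_field m C t ⟨i, hin⟩ (c := 1) (by omega)
  have h7 := inputMemory_field m C t ⟨i, hin⟩ (c := 3) (by omega)
  simp only [RatType.encode, List.getD_cons_succ, List.getD_cons_zero] at h5 h7
  exact Nat.mul_pos (h5 ▸ (t _).re.den_pos) (h7 ▸ (t _).im.den_pos)

theorem dvd_commonDen (k : Fin n) :
    (t k).re.den ∣ commonDen (inputMemory m C t) n ∧
      (t k).im.den ∣ commonDen (inputMemory m C t) n := by
  have h5 := inputMemory_field m C t k (c := 1) (by omega)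
  have h7 := inputMemory_field m C t k (c := 3) (by omega)
  simp only [RatType.encode, List.getD_cons_succ, List.getD_cons_zero] at h5 h7
  have h := Finset.dvd_prod_of_mem (fun i => inputMemory m C t (5 * i + 5) *
    inputMemory m C t (5 * i + 7)) (Finset.mem_range.2 k.2)
  have h' := h.trans (Dvd.intro_left (inputMemory m C t 3) rfl)
  rw [← h5, ← h7]
  exact ⟨(Dvd.intro _ rfl).trans h', (Dvd.intro_left _ rfl).trans h'⟩

theorem cast_div_mul {D : ℕ} {q : ℚ≥0} (h : q.den ∣ D) :
    ((D / q.den * q.num : ℕ) : ℝ) = D * (q : ℝ) := by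
  have hne : (q.den : ℝ) ≠ 0 := by exact_mod_cast q.den_ne_zero
  rw [Nat.cast_mul, Nat.cast_div h hne, NNRat.cast_def]
  ring

theorem scaledCap_eq : (scaledCap (inputMemory m C t) n : ℝ) =
    commonDen (inputMemory m C t) n * (C : ℝ) :=
  cast_div_mul (Dvd.intro _ rfl)

/-- In units of the common denominator all data are integers, and the norm is compared with the
capacity through squares, so no root is computed. -/
theorem scaledWeight_eq (hC : 0 < C) (k : Fin n) :
    (scaledWeight (inputMemory m C t) n k : ℝ) =
      commonDen (inputMemory m C t) n * weight (C : ℝ) (t k).toAgentType.demand := by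
  have hD : (0 : ℝ) < commonDen (inputMemory m C t) n := by exact_mod_cast commonDen_pos m C t
  have hcap := scaledCap_eq m C t
  have h4 := inputMemory_field m C t k (c := 0) (by omega)
  have h5 := inputMemory_field m C t k (c := 1) (by omega)
  have h6 := inputMemory_field m C t k (c := 2) (by omega)
  have h7 := inputMemory_field m C t k (c := 3) (by omega)
  simp only [RatType.encode, List.getD_cons_succ, List.getD_cons_zero, zero_add,
    Nat.reduceAdd] at h4 h5 h6 h7
  obtain ⟨hd1, hd2⟩ := dvd_commonDen m C t k
  have hre := cast_div_mul hd1
  have him := cast_div_mul hd2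
  have hC' : (0 : ℝ) < C := by exact_mod_cast hC
  simp only [scaledWeight, h4, h5, h6, h7]
  generalize commonDen (inputMemory m C t) n = D at *
  generalize scaledCap (inputMemory m C t) n = W at *
  generalize D / (t k).re.den * (t k).re.num = x at *
  generalize D / (t k).im.den * (t k).im.num = y at *
  have hnorm : x * x + y * y ≤ W * W ↔ ‖(t k).toAgentType.demand.1‖ ≤ C := by
    have h1 : ‖(t k).toAgentType.demand.1‖ ≤ C ↔
        ((t k).re : ℝ) * (t k).re + ((t k).im : ℝ) * (t k).im ≤ (C : ℝ) * C := by
      rw [Complex.norm_def, Complex.normSq_apply, Real.sqrt_le_left hC'.le, sq (C : ℝ)]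
      rfl
    rw [h1, ← Nat.cast_le (α := ℝ)]
    push_cast
    rw [hre, him, hcap, show (D : ℝ) * (t k).re * (D * (t k).re) +
      D * (t k).im * (D * (t k).im) = D * D * ((t k).re * (t k).re + (t k).im * (t k).im) by ring,
      show (D : ℝ) * C * (D * C) = D * D * (C * C) by ring]
    exact mul_le_mul_iff_right₀ (mul_pos hD hD)
  rw [weight]
  by_cases h : x * x + y * y ≤ W * W
  · rw [if_pos h, if_pos (hnorm.1 h), mul_min_of_nonneg _ _ hD.le, Nat.cast_min, Nat.cast_add,
      hre, him, hcap, ← mul_add]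
    rfl
  · rw [if_neg h, if_neg (mt hnorm.2 h), Nat.cast_add, hcap]
    ring

theorem fits_scaled (hC : 0 < C) {w : ℕ → ℕ}
    (hw : ∀ k < n, w k = scaledWeight (inputMemory m C t) n k) :
    Fits n w (scaledCap (inputMemory m C t) n) =
      family (C : ℝ) fun k => (t k).toAgentType := by
  have hD : (0 : ℝ) < commonDen (inputMemory m C t) n := by exact_mod_cast commonDen_pos m C t
  funext S
  refine propext (and_congr_right fun hS => ?_)
  have h1 : ((∑ k ∈ S, w k : ℕ) : ℝ) = commonDen (inputMemory m C t) n *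
      ∑ k ∈ S, weights (C : ℝ) (fun k => (t k).toAgentType) k := by
    rw [Nat.cast_sum, Finset.mul_sum]
    refine Finset.sum_congr rfl fun k hk => ?_
    have hkn := Finset.mem_range.1 (hS hk)
    rw [hw k hkn, weights, extend, dif_pos hkn]
    exact scaledWeight_eq m C t hC ⟨k, hkn⟩
  rw [← Nat.cast_le (α := ℝ), h1, scaledCap_eq]
  exact mul_le_mul_iff_right₀ hD

/-- This allows the program to recognize agents without demand, who do not pay, by their weight. -/
theorem scaledWeight_eq_zero_iff (hC : 0 < C) (k : Fin n) :
    scaledWeight (inputMemory m C t) n k = 0 ↔ (t k).toAgentType.demand.1 = 0 := by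
  have hD : (0 : ℝ) < commonDen (inputMemory m C t) n := by exact_mod_cast commonDen_pos m C t
  have hC' : (0 : ℝ) < C := by exact_mod_cast hC
  rw [← Nat.cast_eq_zero (R := ℝ), scaledWeight_eq m C t hC k, mul_eq_zero, or_iff_right hD.ne']
  refine ⟨eq_zero_of_weight hC', fun h => ?_⟩
  rw [weight, h]
  simp [hC'.le]

end Input

/-! ### The complete program -/

/-- Copy the number of agents to a scalar. -/
def readNum : Cmd := .assign .num (.inp (.lit 1))

/-- The program that computes the mechanism. -/
def mechanismProg : RamProg :=
  .seq readNum.comp (.seq readInput.comp (.seq payAll.comp writeOutput))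

/-- The final store of the computation. -/
def finalStore (I : ℕ → ℕ) : Store :=
  payAll.run I (readInput.run I (readNum.run I fun _ _ => 0))

theorem finalStore_spec {n : ℕ} (m : ℕ) (C : ℚ≥0) (hC : 0 < C) (t : Fin n → RatType) (k : Fin n) :
    (finalStore (inputMemory m C t) .out k = 1 ↔
      (k : ℕ) ∈ chosen (family (C : ℝ) fun k => (t k).toAgentType)
        (values fun k => (t k).toAgentType) (2 * n * m)) ∧
    (finalStore (inputMemory m C t) .pay k : ℝ) =
      (mechanism m).pay n C (fun k => (t k).toAgentType) k := by
  classical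
  set I := inputMemory m C t with hI
  have hnum₀ : readNum.run I (fun _ _ => 0) .num 0 = n := rfl
  have hready := ready_readInput I (readNum.run I fun _ _ => 0)
  obtain ⟨h1, h2, -, -, h5⟩ := run_readInput I (readNum.run I fun _ _ => 0)
  have hnum : readInput.run I (readNum.run I fun _ _ => 0) .num 0 = n := by
    rw [Cmd.run_frame I (by rfl), hnum₀]
  rw [hnum₀] at h1 h2 h5
  set s := readInput.run I (readNum.run I fun _ _ => 0) with hs
  have hF : storeFamily s = family (C : ℝ) fun k => (t k).toAgentType := by
    rw [storeFamily, hnum, h1]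
    exact fits_scaled m C t hC fun k hk => (h5 k hk).2
  have hval : ∀ k (hk : k < n), s .val k = (t ⟨k, hk⟩).value := fun k hk => by
    rw [(h5 k hk).1]
    exact inputMemory_field m C t ⟨k, hk⟩ (c := 4) (by omega)
  have hvalues : ∀ k < n, s .val k = values (fun k => (t k).toAgentType) k := fun k hk => by
    rw [hval k hk, values, extend, dif_pos hk]
    rfl
  have hpos : ∀ k < s .num 0, 0 < s .val k := fun k hk => by
    rw [hnum] at hk
    rw [hval k hk]
    exact (t _).value_pos
  have hC' : (0 : ℝ) < C := by exact_mod_cast hC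
  have hfam := family_isFamily hC' fun k => (t k).toAgentType
  have hlev : s .lev 0 = 2 * n * m := h2
  have hch : ∀ x, chosen (storeFamily s) (Function.update (s .val) k x) (s .lev 0) =
      chosen (family (C : ℝ) fun k => (t k).toAgentType)
        (Function.update (values fun k => (t k).toAgentType) k x) (2 * n * m) := fun x => by
    rw [hF, hlev]
    refine chosen_congr hfam (fun i hi => ?_) _
    by_cases hik : i = k
    · rw [hik, Function.update_self, Function.update_self]
    · rw [Function.update_of_ne hik, Function.update_of_ne hik, hvalues i hi]
  have hch₀ : chosen (storeFamily s) (s .val) (s .lev 0) =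
      chosen (family (C : ℝ) fun k => (t k).toAgentType)
        (values fun k => (t k).toAgentType) (2 * n * m) := by
    have := hch (s .val k)
    rwa [Function.update_eq_self, hvalues k k.2, Function.update_eq_self] at this
  have hth : threshold (storeFamily s) (s .val) (s .lev 0) k =
      threshold (family (C : ℝ) fun k => (t k).toAgentType)
        (values fun k => (t k).toAgentType) (2 * n * m) k := by
    simp only [threshold, hch, hvalues k k.2]
  obtain ⟨h6, h7⟩ := run_payAll I hready hpos k (by rw [hnum]; exact k.2)
  rw [hch₀] at h6
  rw [hch₀, hth, (h5 k k.2).2] at h7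
  rw [finalStore, ← hs, h6, h7]
  refine ⟨by split_ifs with h <;> simp [h], ?_⟩
  have hwt := (scaledWeight_eq_zero_iff m C t hC k).not
  rw [← hI] at hwt
  simp only [mechanism, ne_eq, ← hwt, Nat.cast_ite, Nat.cast_zero]

theorem isOutput_of_finalStore {n : ℕ} (m : ℕ) (C : ℚ≥0) (hC : 0 < C) (t : Fin n → RatType)
    (σ : ℕ → ℕ) (hσ : ∀ i < n, σ (2 * i) = finalStore (inputMemory m C t) .out i ∧
      σ (2 * i + 1) = finalStore (inputMemory m C t) .pay i) :
    IsOutput (mechanism m) n C (fun k => (t k).toAgentType) σ := by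
  intro k
  obtain ⟨h1, h2⟩ := finalStore_spec m C hC t k
  rw [(hσ k k.2).1, (hσ k k.2).2, h2]
  refine ⟨?_, rfl⟩
  simp only [h1, mechanism]
  split_ifs <;> rfl

/-- One parameter `x`, the input size plus `m`, bounds the number of agents, the precision and all
input bit lengths. From it come polynomial bounds `b₂` for the entries after reading, `R` for the
loop scalars and `M` for the bit lengths during the run. -/
theorem exists_polynomial_bound : ∃ Q : Polynomial ℕ, ∀ (m n : ℕ) (C : ℚ≥0) (t : Fin n → RatType),
    ∃ σ T, Exec mechanismProg (inputMemory m C t) σ T ∧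
      (∀ i < n, σ (2 * i) = finalStore (inputMemory m C t) .out i ∧
        σ (2 * i + 1) = finalStore (inputMemory m C t) .pay i) ∧
      T ≤ Q.eval (bitSize (encodeInput C t) + m) := by
  obtain ⟨c, hc⟩ := exec_writeOutput
  let b₁ : ℕ → ℕ := fun x => x * readNum.grow x
  let b₂ : ℕ → ℕ := fun x => b₁ x + x * readInput.grow x + x
  let R : ℕ → ℕ := fun x => b₂ x + (x + (2 * x * x * x + 1) + (1 + x * x))
  let M : ℕ → ℕ := fun x => b₂ x + b₂ x * payAll.grow (R x)
  have hb₁ : PolyBounded b₁ := .mul .id readNum.grow_polyBounded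
  have hb₂ : PolyBounded b₂ := .add (.add hb₁ (.mul .id readInput.grow_polyBounded)) .id
  have hR : PolyBounded R := hb₂.add (.add (.add .id (.add (.mul (.mul (.mul (.const 2) .id) .id)
    .id) (.const 1))) (.add (.const 1) (.mul .id .id)))
  have hM : PolyBounded M := hb₂.add (hb₂.mul (payAll.grow_polyBounded.comp hR))
  obtain ⟨Q, hQ⟩ : PolyBounded fun x => readNum.time x * M x + (readInput.time x * M x +
      (payAll.time (R x) * M x + c * (x + 1) * M x)) :=
    .add (.mul readNum.time_polyBounded hM) (.add (.mul readInput.time_polyBounded hM)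
      (.add (.mul (payAll.time_polyBounded.comp hR) hM)
        (.mul (.mul (.const c) (.add .id (.const 1))) hM)))
  refine ⟨Q, fun m n C t => ?_⟩
  set x := bitSize (encodeInput C t) + m with hx
  set I := inputMemory m C t with hI
  have hIsize : ∀ i, (I i).size ≤ x := size_inputMemory_le m C t
  have hI0 : ∀ i, 5 * I 1 + 4 ≤ i → I i = 0 := inputMemory_eq_zero m C t
  have hn : n < x := (card_lt_bitSize C t).trans_le (Nat.le_add_right _ _)
  have hmx : m ≤ x := Nat.le_add_left _ _
  have hx1 : 1 ≤ x := by omega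
  have hM1 : b₁ x + x * readInput.grow x + x ≤ M x := Nat.le_add_right _ _
  have hM2 : b₂ x + b₂ x * payAll.grow (R x) ≤ M x := le_rfl
  have hxM : x ≤ M x := by omega
  have hrep₀ : Rep I I fun _ _ => 0 := ⟨fun _ _ => rfl, fun _ _ => hI0 _ (by omega)⟩
  have hsm₀ : Small [] [] x x fun _ _ => 0 := ⟨by simp, by simp⟩
  obtain ⟨σ₁, T₁, e₁, r₁, t₁⟩ := Cmd.sim hI0 (List.Subset.refl _) hIsize hx1 le_rfl
    (p := readNum) (by rfl) hxM I _ hrep₀ hsm₀ (fun a i => by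
      have : x * readNum.grow x = b₁ x := rfl
      rw [Nat.size_zero]
      omega)
  have hs₁ : ∀ a i, (readNum.run I (fun _ _ => 0) a i).size ≤ b₁ x := fun a i => by
    have := Cmd.size_run_le (List.Subset.refl _) hIsize hx1 le_rfl (p := readNum) (by rfl)
      (fun _ _ => 0) 0 hsm₀ (by simp) a i
    rwa [zero_add] at this
  set s₁ := readNum.run I fun _ _ => 0 with hs₁def
  have hnum₁ : s₁ .num 0 = n := rfl
  have hsm₁ : Small [.num] [.num] x x s₁ := by
    refine ⟨fun a ha i => ?_, fun a ha => ?_⟩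
    · rw [List.mem_singleton.1 ha]
      cases i with
      | zero => exact hIsize 1
      | succ i => exact Nat.zero_le _
    · rw [List.mem_singleton.1 ha, hnum₁]
      exact hn.le
  obtain ⟨σ₂, T₂, e₂, r₂, t₂⟩ := Cmd.sim hI0 (List.Subset.refl _) hIsize hx1 le_rfl
    readInput_wf hxM σ₁ s₁ r₁ hsm₁ (fun a i => by
      have := hs₁ a i
      omega)
  have hs₂ : ∀ a i, (readInput.run I s₁ a i).size ≤ b₁ x + x * readInput.grow x :=
    Cmd.size_run_le (List.Subset.refl _) hIsize hx1 le_rfl readInput_wf s₁ _ hsm₁ hs₁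
  obtain ⟨-, -, htop, hscales, -⟩ := run_readInput I s₁
  have hnum₂ : readInput.run I s₁ .num 0 = n := by rw [Cmd.run_frame I (by rfl), hnum₁]
  set s₂ := readInput.run I s₁ with hs₂def
  have hb₂x : b₁ x + x * readInput.grow x + x = b₂ x := rfl
  have hRx : R x = b₂ x + (x + (2 * x * x * x + 1) + (1 + x * x)) := rfl
  have hsm₂ : Small [.num, .lev, .top, .scales, .cap, .wt, .val] [.num, .top, .scales]
      (b₂ x) (R x) s₂ := by
    refine ⟨fun a _ i => by have := hs₂ a i; omega, fun a ha => ?_⟩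
    simp only [List.mem_cons, List.not_mem_nil, or_false] at ha
    rcases ha with rfl | rfl | rfl
    · rw [hnum₂]
      omega
    · rw [htop, hnum₁]
      have h1 : 2 * n * I 0 * n ≤ 2 * x * x * x :=
        Nat.mul_le_mul (Nat.mul_le_mul (by omega) hmx) hn.le
      omega
    · rw [hscales, hnum₁]
      have h1 : ∑ i ∈ Finset.range n, (I (5 * i + 8)).size ≤ n * x := by
        have := Finset.sum_le_card_nsmul (Finset.range n) (fun i => (I (5 * i + 8)).size) x
          fun i _ => hIsize _
        simpa using this
      have h2 : n * x ≤ x * x := Nat.mul_le_mul_right x hn.le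
      omega
  have hls : [Arr.num, .top, .scales] ⊆ [.num, .lev, .top, .scales, .cap, .wt, .val] := by decide
  have hIb₂ : ∀ i, (I i).size ≤ b₂ x := fun i => (hIsize i).trans (by omega)
  obtain ⟨σ₃, T₃, e₃, r₃, t₃⟩ := Cmd.sim hI0 hls hIb₂ (by omega) (by omega : b₂ x ≤ R x)
    payAll_wf (hM2.trans' (Nat.le_add_right _ _)) σ₂ s₂ r₂ hsm₂ (fun a i => by
      have := hs₂ a i
      omega)
  have hs₃ := Cmd.size_run_le hls hIb₂ (by omega) (by omega : b₂ x ≤ R x) payAll_wf s₂ (b₂ x)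
    hsm₂ (fun a i => by have := hs₂ a i; omega)
  obtain ⟨σ₄, T₄, e₄, h₄, t₄⟩ := hc I σ₃ _ (M x) (hx1.trans hxM) r₃
    (by rw [Cmd.run_frame I (by rfl), hnum₂]; rfl)
    (r₃.size_le (fun i => (hIsize i).trans hxM) hs₃)
  refine ⟨σ₄, _, .seq e₁ (.seq e₂ (.seq e₃ e₄)), h₄, le_trans ?_ (hQ x)⟩
  have h5 : c * (I 1 + 1) * M x ≤ c * (x + 1) * M x :=
    Nat.mul_le_mul_right _ (Nat.mul_le_mul_left c (Nat.succ_le_succ hn.le))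
  beta_reduce
  omega

theorem eval_le_aeval (P : Polynomial ℕ) {k : ℕ} {y : ℝ} (h : (k : ℝ) ≤ y) :
    ((P.eval k : ℕ) : ℝ) ≤ Polynomial.aeval y P := by
  rw [Polynomial.aeval_eq_sum_range, Polynomial.eval_eq_sum_range]
  push_cast
  refine Finset.sum_le_sum fun i _ => ?_
  rw [nsmul_eq_mul]
  gcongr

end CKP

theorem corollary3 :
    ∃ (prog : CKP.RamProg) (P : Polynomial ℕ), ∀ ε : ℝ, 0 < ε →
      ∃ M : CKP.Mechanism,
        M.IncentiveCompatible ∧ M.IndividuallyRational ∧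
        M.Feasible ∧ M.IsApproximation (1 / 2 - ε) ∧
        M.Exact ∧ M.Monotone ∧ M.PaysCriticalValues ∧
        CKP.Computes prog ⌈1 / ε⌉₊ M
          (fun s => Polynomial.aeval ((s : ℝ) + 1 / ε) P) := by
  obtain ⟨Q, hQ⟩ := CKP.exists_polynomial_bound
  -- The shift by one pays for rounding: the bound involves `⌈1 / ε⌉₊`, which is at most `1 / ε +
  -- 1`.
  refine ⟨CKP.mechanismProg, Q.comp (Polynomial.X + 1), fun ε hε => ?_⟩
  have hpos : 0 < 1 / ε := by positivity
  have hm : 1 ≤ ⌈1 / ε⌉₊ := Nat.ceil_pos.2 hpos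
  refine ⟨CKP.mechanism ⌈1 / ε⌉₊, CKP.mechanism_incentiveCompatible _,
    CKP.mechanism_individuallyRational _, CKP.mechanism_feasible _,
    CKP.mechanism_isApproximation hm ?_, CKP.mechanism_exact _, CKP.mechanism_monotone _,
    CKP.mechanism_paysCriticalValues _, fun n C hC t => ?_⟩
  · rw [one_div_le (by exact_mod_cast hm) hε]
    exact Nat.le_ceil _
  · obtain ⟨σ, T, h1, h2, h3⟩ := hQ ⌈1 / ε⌉₊ n C t
    refine ⟨σ, T, h1, CKP.isOutput_of_finalStore _ C hC t σ h2, ?_⟩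
    refine (Nat.cast_le.2 h3).trans ((CKP.eval_le_aeval Q (y := ?_) ?_).trans_eq ?_)
    · exact (CKP.bitSize (CKP.encodeInput C t) : ℝ) + 1 / ε + 1
    · have := (Nat.ceil_lt_add_one hpos.le).le
      push_cast
      linarith
    · simp [Polynomial.aeval_comp]
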